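/- Let $X$ be a compact complex manifold or (effective) orbifold of dimension $n$ with a Kähler metric $g$ with Kähler form $\omega$ and $\omega^{[n]}=\omega^n/n!$, and let a compact torus $\mathbb T$ with Lie algebra $\mathfrak t$ act on $X$ by holomorphic isometries, in a Hamiltonian way, with momentum map $\mu:X\to\mathfrak t^*$ and momentum polytope $P=\mu(X)$ (for instance, $\mathbb T$ is a maximal torus of the reduced automorphism group and $\omega$ is a $\mathbb T$-invariant Kähler metric in a fixed class). For a function $v$ smooth near $P$ put $$\mathrm{Scal}_v(\omega)=v(\mu)\,\mathrm{Scal}(\omega)+2\Delta_\omega v(\mu)+\langle g,\mu^*\mathrm{Hess}(v)\rangle ,$$ where $\mathrm{Scal}(\omega)$ is the Riemannian scalar curvature, $\Delta_\omega=\delta d\ge 0$, and $g$ is restricted to the fundamental vector fields. Put $F_k(a,t)=(1+at)^{(1-ka)/a}$ for $a\neq0$ and $F_k(0,t)=e^t$. For $a\in\mathbb R\setminus\{1\}$ let $\mathcal A_a$ be the set of affine-linear functions $l$ on $\mathfrak t^*$ with $0<1+al<2$ on $P$ (so $\mathcal A_0$ is the whole finite-dimensional space $\mathrm{Aff}(\mathfrak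 t^*)=\mathfrak t\oplus\mathbb R$). Writing $l$ for $l(\mu)$ under integrals, put $$\mathbf S_a(l)=\int_X \mathrm{Scal}_{F_1(a,l)}(\omega)(1+al)\,\omega^{[n]},\qquad \mathbf V_a(l)=\Big(\int_X F_1(a,l)\,\omega^{[n]}\Big)^{\frac1{1-a}},$$ and, for $\lambda,b\in\mathbb R$, $$\mathbf{EH}_{\lambda,a,b}(l)=\frac{\mathbf S_a(l)}{\mathbf V_a(l)}+\lambda\Big(-\frac{\int_X F_0(a,l)\,\omega^{[n]}}{a\mathbf V_a(l)}+\frac1a\Big)+\frac b{\mathbf V_a(l)}\quad(a\ne0),$$ $$\mathbf{EH}_{\lambda,0,b}(l)=\frac{\mathbf S_0(l)}{\mathbf V_0(l)}+\lambda\Big(-\frac{\int_X l e^l\,\omega^{[n]}}{\mathbf V_0(l)}+\log\mathbf V_0(l)\Big)+\frac b{\mathbf V_0(l)} .$$ Let $c_{\lambda,a}(l)=\mathbf V_a(l)^a\,\mathbf{EH}_{\lambda,a,0}(l)-\frac\lambda a(\mathbf V_a(l)^a-1)$ for $a\ne0$, $c_{\lambda,0}(l)=\mathbf{EH}_{\lambda,0,0}(l)-\lambda\log\mathbf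 V_0(l)$, and for affine-linear $\dot l$ let $$\mathrm{Fut}_{\lambda,a,b,l}(\dot l)=\int_X\Big(\mathrm{Scal}_{F_1(a,l)}(\omega)-\tfrac\lambda a\big(F_1(a,l)-F_2(a,l)\big)\Big)\dot l\,\omega^{[n]}-\int_X\Big(c_{\lambda,a}(l)+\tfrac{b}{\mathbf V_a(l)^{1-a}}\Big)F_2(a,l)\,\dot l\,\omega^{[n]}\quad(a\neq0),$$ $$\mathrm{Fut}_{\lambda,0,b,l}(\dot l)=\int_X\Big(\mathrm{Scal}_{e^l}(\omega)-\lambda l e^l-e^l\big[c_{\lambda,0}(l)+\tfrac b{\mathbf V_0(l)}\big]\Big)\dot l\,\omega^{[n]} .$$ Then, for every $\lambda\in\mathbb R$: (1) For all $a\neq1$ and $b$, the set $\mathcal A_a$ is open and $\mathbf{EH}_{\lambda,a,b}$ is of class $C^2$ on $\mathcal A_a$. As $(a,b)\to(0,0)$, $\mathbf{EH}_{\lambda,a,b}$ converges to $\mathbf{EH}_{\lambda,0,0}$ in $C^2_{\rm loc}$: every compact set $C\subset\mathrm{Aff}(\mathfrak t^*)$ lies in $\mathcal A_a$ for $a$ close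 to $0$, and the derivatives of $\mathbf{EH}_{\lambda,a,b}$ of order $0,1,2$ converge uniformly on $C$ to those of $\mathbf{EH}_{\lambda,0,0}$. (2) The limit is Inoue's log-volume functional: for $l=\langle\xi,\cdot\rangle+c$ with $\xi\in\mathfrak t$, $c\in\mathbb R$, $$\mathbf{EH}_{\lambda,0,0}(l)=\frac{\int_X e^{\langle\xi,\mu\rangle}\big(\mathrm{Scal}(\omega)+\Delta_\omega\langle\xi,\mu\rangle-\lambda\langle\xi,\mu\rangle\big)\omega^{[n]}}{\int_X e^{\langle\xi,\mu\rangle}\omega^{[n]}}+\lambda\log\int_X e^{\langle\xi,\mu\rangle}\omega^{[n]} .$$ (3) For all $a\ne1$, $b\in\mathbb R$, $l\in\mathcal A_a$ and affine-linear $\dot l$, $$(\mathrm d\,\mathbf{EH}_{\lambda,a,b})_l(\dot l)=\frac{\mathrm{Fut}_{\lambda,a,b,l}(\dot l)}{\mathbf V_a(l)} .$$ -/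

import Mathlib

open scoped ContDiff Topology

noncomputable section

/-- The model `ℂⁿ` of a complex orbifold chart. -/
abbrev Cn (n : ℕ) : Type := Fin n → ℂ

/-- An effective complex orbifold structure of complex dimension `n` on the space `X`: an atlas of
charts `proj i : dom i → X`, where `dom i ⊆ ℂⁿ` is open and connected, and `proj i` induces a
homeomorphism of `dom i / grp i` onto an open subset of `X`, for a finite group `grp i` of
biholomorphisms of `dom i`. Complex manifolds are the case in which all groups are trivial. -/
structure ComplexOrbifold (n : ℕ) (ι : Type*) (X : Type*) [TopologicalSpace X] where
  dom : ι → Set (Cn n)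
  isOpen_dom : ∀ i, IsOpen (dom i)
  isConnected_dom : ∀ i, IsConnected (dom i)
  /-- A subgroup of homeomorphisms, so the action on `dom i` is effective. -/
  grp : ∀ i, Subgroup (dom i ≃ₜ dom i)
  finite_grp : ∀ i, Finite (grp i)
  holo_grp : ∀ i, ∀ γ ∈ grp i, ∃ f : Cn n → Cn n,
    DifferentiableOn ℂ f (dom i) ∧ ∀ u : dom i, f u = γ u
  proj : ι → Cn n → X
  continuousOn_proj : ∀ i, ContinuousOn (proj i) (dom i)
  isOpenMap_proj : ∀ i, IsOpenMap ((dom i).domRestrict (proj i))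
  /-- The fibres of a chart are the orbits of its group. -/
  fiber : ∀ i, ∀ u v : dom i, proj i u = proj i v ↔ ∃ γ ∈ grp i, γ u = v
  cover : ∀ x : X, ∃ i, ∃ u ∈ dom i, proj i u = x
  /-- Charts are compatible: points over the same point of `X` are matched by a germ of a
  biholomorphism that covers the identity of `X`. -/
  compat : ∀ i j, ∀ u ∈ dom i, ∀ v ∈ dom j, proj i u = proj j v →
    ∃ ψ : OpenPartialHomeomorph (Cn n) (Cn n), u ∈ ψ.source ∧ ψ u = v ∧
      ψ.source ⊆ dom i ∧ ψ.target ⊆ dom j ∧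
      DifferentiableOn ℂ ψ ψ.source ∧ DifferentiableOn ℂ ψ.symm ψ.target ∧
      ∀ z ∈ ψ.source, proj j (ψ z) = proj i z

namespace ComplexOrbifold

variable {n : ℕ} {ι X : Type*} [TopologicalSpace X]

/-- `ψ` is a local biholomorphic lift, from chart `i` to chart `j`, of the map `F : X → X`. -/
def IsLift (A : ComplexOrbifold n ι X) (F : X → X) (i j : ι)
    (ψ : OpenPartialHomeomorph (Cn n) (Cn n)) : Prop :=
  ψ.source ⊆ A.dom i ∧ ψ.target ⊆ A.dom j ∧
    DifferentiableOn ℂ ψ ψ.source ∧ DifferentiableOn ℂ ψ.symm ψ.target ∧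
    ∀ z ∈ ψ.source, A.proj j (ψ z) = F (A.proj i z)

/-- A finite family of open sets, relatively compact in chart domains, whose images cover `X`. -/
structure CompactCover (A : ComplexOrbifold n ι X) where
  N : ℕ
  chart : Fin N → ι
  core : Fin N → Set (Cn n)
  isOpen_core : ∀ k, IsOpen (core k)
  relCompact : ∀ k, ∃ C, IsCompact C ∧ core k ⊆ C ∧ C ⊆ A.dom (chart k)
  cover : ∀ x : X, ∃ k, ∃ u ∈ core k, A.proj (chart k) u = x

theorem nonempty_compactCover [CompactSpace X] (A : ComplexOrbifold n ι X) :
    Nonempty A.CompactCover := by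
  choose i u hu hx using A.cover
  have hball : ∀ x : X, ∃ ε > 0, Metric.closedBall (u x) ε ⊆ A.dom (i x) := fun x =>
    Metric.nhds_basis_closedBall.mem_iff.1 ((A.isOpen_dom (i x)).mem_nhds (hu x))
  choose ε hε hsub using hball
  have hsub' : ∀ x, Metric.ball (u x) (ε x) ⊆ A.dom (i x) := fun x =>
    Metric.ball_subset_closedBall.trans (hsub x)
  have hopen : ∀ x, IsOpen (A.proj (i x) '' Metric.ball (u x) (ε x)) := by
    intro x
    have h := A.isOpenMap_proj (i x) _
      ((Metric.isOpen_ball (x := u x) (ε := ε x)).preimage continuous_subtype_val)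
    rwa [Set.image_domRestrict, Set.inter_eq_left.2 (hsub' x)] at h
  obtain ⟨t, ht⟩ := isCompact_univ.elim_finite_subcover _ hopen
    (fun x _ => Set.mem_iUnion.2 ⟨x, u x, Metric.mem_ball_self (hε x), hx x⟩)
  refine ⟨⟨t.card, fun k => i (t.equivFin.symm k : X),
    fun k => Metric.ball (u (t.equivFin.symm k : X)) (ε (t.equivFin.symm k : X)),
    fun k => Metric.isOpen_ball,
    fun k => ⟨_, isCompact_closedBall _ _, Metric.ball_subset_closedBall, hsub _⟩, ?_⟩⟩
  intro x
  obtain ⟨y, hy, hxy⟩ := Set.mem_iUnion₂.1 (ht (Set.mem_univ x))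
  obtain ⟨w, hw, hwx⟩ := hxy
  exact ⟨t.equivFin ⟨y, hy⟩, w, by simpa using hw, by simpa using hwx⟩

/-- A fixed cover of a compact orbifold, used to decompose integrals. -/
def compactCover [CompactSpace X] (A : ComplexOrbifold n ι X) : A.CompactCover :=
  Classical.choice A.nonempty_compactCover

/-- The preimage, in its chart, of the `k`-th set of the partition of `X` obtained by making the
images of the cores disjoint. -/
def CompactCover.piece {A : ComplexOrbifold n ι X} (Q : A.CompactCover) (k : Fin Q.N) :
    Set (Cn n) :=
  {u | u ∈ A.dom (Q.chart k) ∧ A.proj (Q.chart k) u ∈ A.proj (Q.chart k) '' Q.core k ∧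
    ∀ j < k, A.proj (Q.chart k) u ∉ A.proj (Q.chart j) '' Q.core j}

end ComplexOrbifold

/-! ### Riemannian geometry of a metric on an open subset of `ℂⁿ ≅ ℝ²ⁿ` -/

/-- Fields of real bilinear forms on `ℂⁿ`. -/
abbrev BilinField (n : ℕ) : Type := Cn n → (Cn n →L[ℝ] Cn n →L[ℝ] ℝ)

namespace BilinField

variable {n : ℕ}

/-- The standard real basis `e₁, …, eₙ, i e₁, …, i eₙ` of `ℂⁿ`. -/
def basis : Fin n ⊕ Fin n → Cn n :=
  Sum.elim (fun j => Pi.single j 1) (fun j => Pi.single j Complex.I)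

/-- The real partial derivative of `f` in the direction of a basis vector. -/
def partialD (p : Fin n ⊕ Fin n) (f : Cn n → ℝ) (u : Cn n) : ℝ := fderiv ℝ f u (basis p)

/-- The components `g_pq`. -/
def gram (g : BilinField n) (u : Cn n) : Matrix (Fin n ⊕ Fin n) (Fin n ⊕ Fin n) ℝ :=
  Matrix.of fun p q => g u (basis p) (basis q)

/-- The components `g^pq` of the inverse. -/
def cometric (g : BilinField n) (u : Cn n) : Matrix (Fin n ⊕ Fin n) (Fin n ⊕ Fin n) ℝ :=
  (gram g u)⁻¹

/-- The density of the Riemannian volume with respect to Lebesgue measure. -/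
def volDensity (g : BilinField n) (u : Cn n) : ℝ := Real.sqrt (gram g u).det

/-- The Christoffel symbols `Γ^s_pq` of the Levi-Civita connection. -/
def christoffel (g : BilinField n) (s p q : Fin n ⊕ Fin n) (u : Cn n) : ℝ :=
  (1 / 2) * ∑ m, cometric g u s m *
    (partialD p (fun w => gram g w q m) u + partialD q (fun w => gram g w p m) u
      - partialD m (fun w => gram g w p q) u)

/-- The Ricci tensor. -/
def ricci (g : BilinField n) (p q : Fin n ⊕ Fin n) (u : Cn n) : ℝ :=
  ∑ s, (partialD s (christoffel g s p q) u - partialD q (christoffel g s p s) u)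
    + ∑ s, ∑ m, (christoffel g s s m u * christoffel g m p q u
      - christoffel g s q m u * christoffel g m p s u)

/-- The Riemannian scalar curvature. -/
def scal (g : BilinField n) (u : Cn n) : ℝ := ∑ p, ∑ q, cometric g u p q * ricci g p q u

/-- The (nonnegative) Laplace operator `Δ f = δ d f = - div grad f`. -/
def laplacian (g : BilinField n) (f : Cn n → ℝ) (u : Cn n) : ℝ :=
  -(1 / volDensity g u) *
    ∑ p, partialD p (fun w => volDensity g w * ∑ q, cometric g w p q * partialD q f w) u

end BilinField

/-- A Kähler orbifold: a complex orbifold with a smooth Kähler metric `metric i` on every chart,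
preserved by all changes of charts (in particular by the groups `grp i`). The Kähler form is
`ω (v, w) = g (J v, w)`. -/
structure KahlerOrbifold (n : ℕ) (ι : Type*) (X : Type*) [TopologicalSpace X] extends
    ComplexOrbifold n ι X where
  metric : ι → BilinField n
  smooth : ∀ i, ContDiffOn ℝ ∞ (metric i) (dom i)
  symm : ∀ i, ∀ u ∈ dom i, ∀ v w, metric i u v w = metric i u w v
  pos : ∀ i, ∀ u ∈ dom i, ∀ v, v ≠ 0 → 0 < metric i u v v
  hermitian : ∀ i, ∀ u ∈ dom i, ∀ v w,
    metric i u (Complex.I • v) (Complex.I • w) = metric i u v w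
  /-- `d ω = 0`. -/
  closed : ∀ i, ∀ u ∈ dom i, ∀ x y z : Cn n,
    fderiv ℝ (metric i) u x (Complex.I • y) z + fderiv ℝ (metric i) u y (Complex.I • z) x
      + fderiv ℝ (metric i) u z (Complex.I • x) y = 0
  metric_compat : ∀ i j ψ, toComplexOrbifold.IsLift id i j ψ → ∀ z ∈ ψ.source, ∀ v w,
    metric j (ψ z) (fderiv ℝ ψ z v) (fderiv ℝ ψ z w) = metric i z v w

namespace KahlerOrbifold

variable {n : ℕ} {ι X : Type*} [TopologicalSpace X]

/-- The integral `∫_X f ω^[n]`, with `ω^[n] = ωⁿ / n!` the Riemannian volume, of a function given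
by its expressions `f i` in the charts: `X` is cut into finitely many Borel sets lying in chart
images, and on each of them the integral is `1 / |grp i|` times the integral upstairs. -/
def integral [CompactSpace X] (K : KahlerOrbifold n ι X) (f : ι → Cn n → ℝ) : ℝ :=
  ∑ k, (Nat.card (K.grp (K.compactCover.chart k)) : ℝ)⁻¹ *
    ∫ u in K.compactCover.piece k, f (K.compactCover.chart k) u *
      BilinField.volDensity (K.metric (K.compactCover.chart k)) u

/-- The compact torus of rank `r`; its Lie algebra `𝔱` and the dual `𝔱*` are `Fin r → ℝ`, with
the pairing `ξ ⬝ᵥ x`. -/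
abbrev Torus (r : ℕ) : Type := Fin r → Circle

/-- The exponential map of the torus. -/
def torusExp {r : ℕ} (ξ : Fin r → ℝ) : Torus r := fun a => Circle.exp (ξ a)

/-- `Z` (given in charts) is the vector field on `X` that generates the action of `exp (s ξ)`:
it is smooth, and its integral curves in charts cover the curves `s ↦ exp (s ξ) • x`. -/
def IsFundamentalField {r : ℕ} (K : KahlerOrbifold n ι X) [MulAction (Torus r) X]
    (ξ : Fin r → ℝ) (Z : ι → Cn n → Cn n) : Prop :=
  ∀ i, ContDiffOn ℝ ∞ (Z i) (K.dom i) ∧ ∀ u ∈ K.dom i, ∃ ε > 0, ∃ γ : ℝ → Cn n, γ 0 = u ∧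
    ∀ s, |s| < ε → γ s ∈ K.dom i ∧ HasDerivAt γ (Z i (γ s)) s ∧
      K.proj i (γ s) = torusExp (s • ξ) • K.proj i u

/-- The action of the torus on `X` is by holomorphic automorphisms that preserve the Kähler metric,
with fundamental vector fields `field ξ`, and it is Hamiltonian with momentum map
`moment : X → 𝔱*`, normalised by `d ⟨μ, ξ⟩ = - ω (ξ, ·)`. -/
structure HamiltonianAction (K : KahlerOrbifold n ι X) (r : ℕ) [MulAction (Torus r) X]
    [ContinuousSMul (Torus r) X] where
  exists_lift : ∀ t : Torus r, ∀ i j, ∀ u ∈ K.dom i, ∀ v ∈ K.dom j,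
    K.proj j v = t • K.proj i u → ∃ ψ, K.IsLift (fun x => t • x) i j ψ ∧ u ∈ ψ.source ∧ ψ u = v
  invariant : ∀ t : Torus r, ∀ i j ψ, K.IsLift (fun x => t • x) i j ψ → ∀ z ∈ ψ.source, ∀ v w,
    K.metric j (ψ z) (fderiv ℝ ψ z v) (fderiv ℝ ψ z w) = K.metric i z v w
  field : (Fin r → ℝ) → ι → Cn n → Cn n
  isFundamental : ∀ ξ, K.IsFundamentalField ξ (field ξ)
  moment : X → (Fin r → ℝ)
  moment_smooth : ∀ i, ContDiffOn ℝ ∞ (fun u => moment (K.proj i u)) (K.dom i)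
  moment_invariant : ∀ (t : Torus r) x, moment (t • x) = moment x
  moment_eq : ∀ ξ i, ∀ u ∈ K.dom i, ∀ w,
    fderiv ℝ (fun z => ξ ⬝ᵥ moment (K.proj i z)) u w =
      - K.metric i u (Complex.I • field ξ i u) w

/-- Affine-linear functions on `𝔱*`: the pair `(ξ, c)` is the function `x ↦ ⟨ξ, x⟩ + c`. -/
abbrev AffFun (r : ℕ) : Type := (Fin r → ℝ) × ℝ

/-- The value of an affine-linear function. -/
def AffFun.val {r : ℕ} (l : AffFun r) (x : Fin r → ℝ) : ℝ := l.1 ⬝ᵥ x + l.2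

/-- `F_k(a, t) = (1 + a t) ^ ((1 - k a) / a)`, extended by `F_k(0, t) = exp t`. -/
def weightF (k : ℕ) (a t : ℝ) : ℝ :=
  if a = 0 then Real.exp t else (1 + a * t) ^ ((1 - k * a) / a)

/-- The Hessian of a function on `𝔱*`. -/
def hess {r : ℕ} (v : (Fin r → ℝ) → ℝ) (x : Fin r → ℝ) (α β : Fin r) : ℝ :=
  fderiv ℝ (fun y => fderiv ℝ v y (Pi.single β 1)) x (Pi.single α 1)

namespace HamiltonianAction

variable {K : KahlerOrbifold n ι X} {r : ℕ} [MulAction (Torus r) X] [ContinuousSMul (Torus r) X]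

/-- The momentum polytope. -/
def polytope (H : K.HamiltonianAction r) : Set (Fin r → ℝ) := Set.range H.moment

/-- The momentum map in chart `i`. -/
def mu (H : K.HamiltonianAction r) (i : ι) (u : Cn n) : Fin r → ℝ := H.moment (K.proj i u)

/-- The scalar curvature of the Kähler metric, in charts. -/
def scal (_ : K.HamiltonianAction r) (i : ι) (u : Cn n) : ℝ := BilinField.scal (K.metric i) u

/-- The `v`-weighted scalar curvature
`Scal_v = v(μ) Scal + 2 Δ (v(μ)) + ⟨g, μ^* Hess v⟩`, in charts. -/
def weightedScal (H : K.HamiltonianAction r) (v : (Fin r → ℝ) → ℝ) (i : ι) (u : Cn n) : ℝ :=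
  v (H.mu i u) * H.scal i u
    + 2 * BilinField.laplacian (K.metric i) (fun w => v (H.mu i w)) u
    + ∑ α, ∑ β, hess v (H.mu i u) α β *
        K.metric i u (H.field (Pi.single α 1) i u) (H.field (Pi.single β 1) i u)

/-- The affine functions `l` with `0 < 1 + a l < 2` on the momentum polytope. -/
def admissible (H : K.HamiltonianAction r) (a : ℝ) : Set (AffFun r) :=
  {l | ∀ x ∈ H.polytope, 0 < 1 + a * l.val x ∧ 1 + a * l.val x < 2}

variable [CompactSpace X]

/-- The integral of `F_k(a, l(μ))`. -/
def intF (H : K.HamiltonianAction r) (k : ℕ) (a : ℝ) (l : AffFun r) : ℝ :=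
  K.integral fun i u => weightF k a (l.val (H.mu i u))

/-- The total weighted scalar curvature `S_a(l)`. -/
def S (H : K.HamiltonianAction r) (a : ℝ) (l : AffFun r) : ℝ :=
  K.integral fun i u =>
    H.weightedScal (fun x => weightF 1 a (l.val x)) i u * (1 + a * l.val (H.mu i u))

/-- The weighted volume `V_a(l)`. -/
def V (H : K.HamiltonianAction r) (a : ℝ) (l : AffFun r) : ℝ :=
  (H.intF 1 a l) ^ (1 / (1 - a))

/-- The Einstein–Hilbert functional `EH_{lam,a,b}`. -/
def EH (H : K.HamiltonianAction r) (lam a b : ℝ) (l : AffFun r) : ℝ :=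
  if a = 0 then
    H.S 0 l / H.V 0 l
      + lam * (-(K.integral fun i u => l.val (H.mu i u) * Real.exp (l.val (H.mu i u))) / H.V 0 l
          + Real.log (H.V 0 l))
      + b / H.V 0 l
  else
    H.S a l / H.V a l + lam * (-H.intF 0 a l / (a * H.V a l) + 1 / a) + b / H.V a l

/-- The constant `c_{lam,a}(l)`. -/
def cConst (H : K.HamiltonianAction r) (lam a : ℝ) (l : AffFun r) : ℝ :=
  if a = 0 then H.EH lam 0 0 l - lam * Real.log (H.V 0 l)
  else (H.V a l) ^ a * H.EH lam a 0 l - lam / a * ((H.V a l) ^ a - 1)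

/-- The weighted Futaki invariant `Fut_{lam,a,b,l}`, evaluated at `h`. -/
def Fut (H : K.HamiltonianAction r) (lam a b : ℝ) (l h : AffFun r) : ℝ :=
  if a = 0 then
    K.integral fun i u =>
      (H.weightedScal (fun x => Real.exp (l.val x)) i u
        - lam * l.val (H.mu i u) * Real.exp (l.val (H.mu i u))
        - Real.exp (l.val (H.mu i u)) * (H.cConst lam 0 l + b / H.V 0 l)) * h.val (H.mu i u)
  else
    (K.integral fun i u =>
      (H.weightedScal (fun x => weightF 1 a (l.val x)) i u
        - lam / a * (weightF 1 a (l.val (H.mu i u)) - weightF 2 a (l.val (H.mu i u))))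
        * h.val (H.mu i u))
    - K.integral fun i u =>
        (H.cConst lam a l + b / (H.V a l) ^ (1 - a)) * weightF 2 a (l.val (H.mu i u))
          * h.val (H.mu i u)

/-- Inoue's log-volume functional on `𝔱`:
`∫ e^{⟨ξ,μ⟩} (Scal + Δ ⟨ξ,μ⟩ - lam ⟨ξ,μ⟩) ω^[n] / ∫ e^{⟨ξ,μ⟩} ω^[n] + lam log ∫ e^{⟨ξ,μ⟩} ω^[n]`. -/
def logVol (H : K.HamiltonianAction r) (lam : ℝ) (ξ : Fin r → ℝ) : ℝ :=
  (K.integral fun i u => Real.exp (ξ ⬝ᵥ H.mu i u) *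
      (H.scal i u + BilinField.laplacian (K.metric i) (fun w => ξ ⬝ᵥ H.mu i w) u
        - lam * (ξ ⬝ᵥ H.mu i u)))
      / (K.integral fun i u => Real.exp (ξ ⬝ᵥ H.mu i u))
    + lam * Real.log (K.integral fun i u => Real.exp (ξ ⬝ᵥ H.mu i u))

end HamiltonianAction

end KahlerOrbifold

end

/-!
The functionals are built from integrals over `X` of `f * Φ (a, l, μ)`, where `f` is continuous and
`Φ` is an explicit function of the parameters and of the momentum map `μ`. Everything follows from
three facts about them.

*Regularity.* Since `log (1 + a t) / a = t * logQuot (a t)`, the weight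
`F_k(a, t) = exp ((1 - k a) t logQuot (a t))` is smooth in `(a, t)` for `1 + a t > 0`, across `a = 0`
(`contDiffAt_weightF`). The polytope is compact, so integrals with such weights can be
differentiated under the integral sign, jointly in `(a, l)` (`contDiffOn_integral`). The division by
`a` in the functional is apparent only: with `I = ∫ F_1` and `V = I ^ (1 / (1 - a))` one has
`∫ F_0 = I + a ∫ l F_1`, and `(V - I) / a` is a smooth function of `a` and `log I`, written with
`expQuot x = (exp x - 1) / x` (`EH_eq`). Hence the functional is `C²` jointly in `(a, b, l)`
(`contDiffOn_EH`), and on a compact set of `l` its derivatives in `l` converge uniformly with the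
parameters (`tendstoUniformlyOn_iteratedFDeriv_of_contDiffOn`).

*Integration by parts.* The weighted scalar curvature contains `Δ l(μ)`. Green's formula
(`integral_mul_lap`) together with `|d l(μ)|² = g (ξ, ξ)` for the linear part `ξ` of `l`, which is
where the moment map equation and the hermitian symmetry of `g` enter, gives
`S_a(l) = ∫ Scal F_0(l) + (1 - a) ∫ F_2(l) |d l|²` (`S_eq`). This is an expression of the kind above,
quadratic in the linear part of `l` apart from the weights. At `a = 0` the same identity, read
backwards, turns the functional into the logarithmic volume functional (`EH_zero_zero`).

*First variation.* Differentiating `S_eq` along `l + t h` and integrating by parts once more gives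
`d S (h) = ∫ Scal_{F_1(l)} h` (`hasDerivAt_S`). With `d ∫ F_k (h) = (1 - k a) ∫ F_{k+1} h` and
`d V (h) = V ^ a ∫ F_2 h`, the formula for the differential is algebra (`hasDerivAt_EH`).

Green's formula on the orbifold needs the integral, which is defined by one fixed partition into
pieces of charts, to be independent of that partition. The reason is that almost every point of a
chart has trivial isotropy, because the fixed points of a nontrivial holomorphic automorphism of a
connected domain form a null set (`volume_fixed_eq_zero`). Hence the fibre product of two charts
covers the charts with the right multiplicities almost everywhere
(`card_mul_setLIntegral_density`), and the integral of a continuous function on `X` is an integral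
for one measure (`riemannianMeasure`). Integrals of functions supported in a chart image can then be
computed in that chart, and a partition of unity finishes the proof. The Laplacian of `l(μ)`, defined
in charts, is a function on `X` because it is invariant under isometries
(`IsIsometry.laplacian_eq`).
-/

noncomputable section

section

open MeasureTheory Filter Set

/-! ### The weight functions and parametric integrals -/

theorem AnalyticAt.dslope {f : ℝ → ℝ} {a b : ℝ} (ha : AnalyticAt ℝ f a) (hb : AnalyticAt ℝ f b) :
    AnalyticAt ℝ (dslope f a) b := by
  rcases eq_or_ne b a with rfl | h
  · obtain ⟨p, hp⟩ := hb
    exact ⟨_, hp.has_fpower_series_dslope_fslope⟩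
  · have h1 : AnalyticAt ℝ (fun x => (x - a)⁻¹ * (f x - f a)) b :=
      ((analyticAt_id.sub analyticAt_const).inv (sub_ne_zero.2 h)).mul (hb.sub analyticAt_const)
    exact h1.congr (dslope_eventuallyEq_slope_of_ne f h).symm

/-- The function `(exp x - 1) / x`, extended by `1` at `x = 0`. -/
def expQuot : ℝ → ℝ := dslope Real.exp 0

/-- The function `log (1 + x) / x`, extended by `1` at `x = 0`. -/
def logQuot : ℝ → ℝ := dslope (fun x => Real.log (1 + x)) 0

theorem mul_expQuot (x : ℝ) : x * expQuot x = Real.exp x - 1 := by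
  simpa [expQuot] using sub_smul_dslope Real.exp 0 x

theorem expQuot_zero : expQuot 0 = 1 := by simp [expQuot]

theorem mul_logQuot (x : ℝ) : x * logQuot x = Real.log (1 + x) := by
  simpa [logQuot] using sub_smul_dslope (fun x => Real.log (1 + x)) 0 x

theorem logQuot_zero : logQuot 0 = 1 := by
  have h : HasDerivAt (fun x : ℝ => Real.log (1 + x)) 1 0 := by
    simpa using ((hasDerivAt_id (0 : ℝ)).const_add 1).log (by simp)
  simp [logQuot, h.deriv]

theorem contDiff_expQuot : ContDiff ℝ ∞ expQuot :=
  contDiff_iff_contDiffAt.2 fun _ =>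
    (AnalyticAt.dslope (by fun_prop) (by fun_prop)).contDiffAt

theorem contDiffAt_logQuot {x : ℝ} (hx : 0 < 1 + x) : ContDiffAt ℝ ∞ logQuot x := by
  have h : ∀ y : ℝ, 0 < 1 + y → AnalyticAt ℝ (fun x => Real.log (1 + x)) y := fun y hy =>
    (analyticAt_const.add analyticAt_id).log hy
  exact (AnalyticAt.dslope (h 0 (by simp)) (h x hx)).contDiffAt

namespace KahlerOrbifold

/-- The weights `F_k` have no singularity at `a = 0`: they are smooth functions of `(a, t)`. -/
theorem weightF_eq_exp (k : ℕ) {a t : ℝ} (h : 0 < 1 + a * t) :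
    weightF k a t = Real.exp ((1 - k * a) * (t * logQuot (a * t))) := by
  unfold weightF
  split_ifs with ha
  · simp [ha, logQuot_zero]
  · rw [Real.rpow_def_of_pos h, ← mul_logQuot]
    congr 1
    field_simp

theorem weightF_pos (k : ℕ) {a t : ℝ} (h : 0 < 1 + a * t) : 0 < weightF k a t := by
  rw [weightF_eq_exp k h]; positivity

theorem contDiffAt_weightF (k : ℕ) {q : ℝ × ℝ} (h : 0 < 1 + q.1 * q.2) :
    ContDiffAt ℝ ∞ (fun p : ℝ × ℝ => weightF k p.1 p.2) q := by
  have h1 : ContDiffAt ℝ ∞ (fun p : ℝ × ℝ =>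
      Real.exp ((1 - k * p.1) * (p.2 * logQuot (p.1 * p.2)))) q := by
    have h2 : ContDiffAt ℝ ∞ (fun p : ℝ × ℝ => logQuot (p.1 * p.2)) q :=
      ContDiffAt.comp q (g := logQuot) (f := fun p : ℝ × ℝ => p.1 * p.2) (contDiffAt_logQuot h)
        (by fun_prop)
    fun_prop
  refine h1.congr_of_eventuallyEq ?_
  have : ∀ᶠ p : ℝ × ℝ in 𝓝 q, 0 < 1 + p.1 * p.2 :=
    ContinuousAt.eventually_lt (by fun_prop) (by fun_prop) h
  filter_upwards [this] with p hp using weightF_eq_exp k hp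

theorem contDiffAt_weightF_right (k : ℕ) {a t : ℝ} (h : 0 < 1 + a * t) :
    ContDiffAt ℝ ∞ (weightF k a) t :=
  ContDiffAt.comp t (g := fun p : ℝ × ℝ => weightF k p.1 p.2) (f := fun s => (a, s))
    (contDiffAt_weightF k h) (by fun_prop)

theorem weightF_succ_mul {a t : ℝ} (k : ℕ) (h : 0 < 1 + a * t) :
    weightF k a t = (1 + a * t) * weightF (k + 1) a t := by
  unfold weightF
  split_ifs with ha
  · simp [ha]
  · rw [mul_comm (1 + a * t), ← Real.rpow_add_one h.ne']
    congr 1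
    push_cast
    field_simp
    ring

theorem hasDerivAt_weightF (k : ℕ) {a t : ℝ} (h : 0 < 1 + a * t) :
    HasDerivAt (weightF k a) ((1 - k * a) * weightF (k + 1) a t) t := by
  by_cases ha : a = 0
  · subst ha
    have h0 : ∀ j, weightF j 0 = Real.exp := fun j => by funext s; simp [weightF]
    simpa [h0] using Real.hasDerivAt_exp t
  · have h0 : ∀ j, weightF j a = fun s => (1 + a * s) ^ ((1 - j * a) / a) := fun j => by
      funext s; simp [weightF, ha]
    rw [h0, h0]
    have h1 : HasDerivAt (fun s : ℝ => 1 + a * s) a t := by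
      simpa using ((hasDerivAt_id t).const_mul a).const_add 1
    refine (h1.rpow_const (p := (1 - k * a) / a) (Or.inl h.ne')).congr_deriv ?_
    have h2 : (1 - ((k + 1 : ℕ) : ℝ) * a) / a = (1 - k * a) / a - 1 := by
      push_cast; field_simp; ring
    rw [h2]
    field_simp

end KahlerOrbifold

/-- A tube lemma: for `q` close to `q₀`, the compact slice stays in `Ω` and `Φ` has a common bound
there. -/
theorem IsCompact.exists_nhds_bound_of_continuousOn {Q Y E : Type*} [NormedAddCommGroup Q]
    [NormedAddCommGroup Y] [NormedAddCommGroup E] {P : Set Y} {Ω : Set (Q × Y)} {Φ : Q × Y → E}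
    {q₀ : Q} (hP : IsCompact P) (hΩ : IsOpen Ω) (hΦ : ContinuousOn Φ Ω) (hq : ∀ y ∈ P, (q₀, y) ∈ Ω) :
    ∃ C, ∀ᶠ q in 𝓝 q₀, ∀ y ∈ P, (q, y) ∈ Ω ∧ ‖Φ (q, y)‖ ≤ C := by
  have hc : ContinuousOn (fun y => Φ (q₀, y)) P :=
    hΦ.comp (by fun_prop) hq
  obtain ⟨C, hC⟩ := hP.exists_bound_of_continuousOn hc
  refine ⟨C + 1, hP.eventually_forall_of_forall_eventually fun y hy => ?_⟩
  have h1 : ContinuousAt Φ (q₀, y) := hΦ.continuousAt (hΩ.mem_nhds (hq y hy))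
  have h2 : ∀ᶠ z in 𝓝 (q₀, y), ‖Φ z‖ < C + 1 :=
    h1.norm.eventually_lt continuousAt_const (by linarith [hC y hy])
  filter_upwards [hΩ.mem_nhds (hq y hy), h2] with z hz hz2 using ⟨hz, hz2.le⟩

section Parametric

variable {T : Type*} [MeasurableSpace T] {m : Measure T}
  {Y : Type*} [NormedAddCommGroup Y] [MeasurableSpace Y] [BorelSpace Y]
  {x : T → Y} {P : Set Y} {h : T → ℝ}

theorem ContinuousOn.aestronglyMeasurable_comp_of_ae_mem {E : Type*} [NormedAddCommGroup E]
    {φ : Y → E} (hφ : ContinuousOn φ P) (hP : IsCompact P) (hx : AEMeasurable x m)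
    (hxP : ∀ᵐ τ ∂m, x τ ∈ P) : AEStronglyMeasurable (fun τ => φ (x τ)) m := by
  have h1 : AEStronglyMeasurable φ ((Measure.map x m).restrict P) :=
    hφ.aestronglyMeasurable_of_isCompact hP hP.isClosed.measurableSet
  have h2 : (Measure.map x m).restrict P = Measure.map x m := by
    apply Measure.restrict_eq_self_of_ae_mem
    exact (ae_map_iff hx hP.isClosed.measurableSet).2 hxP
  rw [h2] at h1
  exact h1.comp_aemeasurable hx

theorem integrable_smul_comp_of_ae_mem {E : Type*} [NormedAddCommGroup E] [NormedSpace ℝ E]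
    {φ : Y → E} (hφ : ContinuousOn φ P) (hP : IsCompact P) (hx : AEMeasurable x m)
    (hxP : ∀ᵐ τ ∂m, x τ ∈ P) (hh : Integrable h m) : Integrable (fun τ => h τ • φ (x τ)) m := by
  obtain ⟨C, hC⟩ := hP.exists_bound_of_continuousOn hφ
  have := hh.smul_bdd C (hφ.aestronglyMeasurable_comp_of_ae_mem hP hx hxP)
    (by filter_upwards [hxP] with τ hτ using hC _ hτ)
  exact this

variable [NormedSpace ℝ Y] {Q : Type*} [NormedAddCommGroup Q] [NormedSpace ℝ Q] {Ω : Set (Q × Y)}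
  {E : Type*} [NormedAddCommGroup E] [NormedSpace ℝ E] {Φ : Q × Y → E} {q₀ : Q}

theorem continuousAt_integral_smul_comp {Q Y : Type*} [NormedAddCommGroup Q]
    [NormedAddCommGroup Y] [MeasurableSpace Y] [BorelSpace Y] {x : T → Y} {P : Set Y}
    {Ω : Set (Q × Y)} {Φ : Q × Y → E} {q₀ : Q} (hP : IsCompact P) (hx : AEMeasurable x m)
    (hxP : ∀ᵐ τ ∂m, x τ ∈ P) (hh : Integrable h m) (hΩ : IsOpen Ω)
    (hΦ : ContinuousOn Φ Ω) (hq : ∀ y ∈ P, (q₀, y) ∈ Ω) :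
    ContinuousAt (fun q => ∫ τ, h τ • Φ (q, x τ) ∂m) q₀ := by
  obtain ⟨C, hC⟩ := hP.exists_nhds_bound_of_continuousOn hΩ hΦ hq
  refine continuousAt_of_dominated (bound := fun τ => ‖h τ‖ * C) ?_ ?_
    (hh.norm.mul_const C) ?_
  · filter_upwards [hC] with q hq'
    exact hh.1.smul (ContinuousOn.aestronglyMeasurable_comp_of_ae_mem
      (φ := fun y => Φ (q, y)) (hΦ.comp (by fun_prop) fun y hy => (hq' y hy).1) hP hx hxP)
  · filter_upwards [hC] with q hq'
    filter_upwards [hxP] with τ hτ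
    rw [norm_smul]
    exact mul_le_mul_of_nonneg_left (hq' _ hτ).2 (norm_nonneg _)
  · filter_upwards [hxP] with τ hτ
    have h1 : ContinuousAt Φ (q₀, x τ) := hΦ.continuousAt (hΩ.mem_nhds (hq _ hτ))
    exact continuousAt_const.smul
      (ContinuousAt.comp (f := fun q => (q, x τ)) (g := Φ) h1 (by fun_prop))

theorem hasFDerivAt_integral_smul_comp (hP : IsCompact P) (hx : AEMeasurable x m)
    (hxP : ∀ᵐ τ ∂m, x τ ∈ P) (hh : Integrable h m) (hΩ : IsOpen Ω)
    (hΦ : ContDiffOn ℝ 1 Φ Ω) (hq : ∀ y ∈ P, (q₀, y) ∈ Ω) :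
    HasFDerivAt (fun q => ∫ τ, h τ • Φ (q, x τ) ∂m)
      (∫ τ, h τ • (fderiv ℝ Φ (q₀, x τ)).comp (.inl ℝ Q Y) ∂m) q₀ := by
  have hd : ContinuousOn (fun z => (fderiv ℝ Φ z).comp (.inl ℝ Q Y)) Ω :=
    (hΦ.continuousOn_fderiv_of_isOpen hΩ le_rfl).clm_comp continuousOn_const
  obtain ⟨C, hC⟩ := hP.exists_nhds_bound_of_continuousOn hΩ hd hq
  have hslice : ∀ q, (∀ y ∈ P, (q, y) ∈ Ω) → ContinuousOn (fun y => Φ (q, y)) P := fun q h =>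
    hΦ.continuousOn.comp (by fun_prop) h
  refine hasFDerivAt_integral_of_dominated_of_fderiv_le
    (F' := fun q τ => h τ • (fderiv ℝ Φ (q, x τ)).comp (.inl ℝ Q Y))
    (bound := fun τ => ‖h τ‖ * C) hC ?_ ?_ ?_ ?_ (hh.norm.mul_const C) ?_
  · filter_upwards [hC] with q hq'
    exact hh.1.smul ((hslice q fun y hy => (hq' y hy).1).aestronglyMeasurable_comp_of_ae_mem
      hP hx hxP)
  · exact integrable_smul_comp_of_ae_mem (φ := fun y => Φ (q₀, y)) (hslice q₀ hq) hP hx hxP hh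
  · exact hh.1.smul (ContinuousOn.aestronglyMeasurable_comp_of_ae_mem
      (φ := fun y => (fderiv ℝ Φ (q₀, y)).comp (.inl ℝ Q Y)) (hd.comp (by fun_prop) hq) hP hx hxP)
  · filter_upwards [hxP] with τ hτ q hq'
    rw [norm_smul]
    exact mul_le_mul_of_nonneg_left (hq' _ hτ).2 (norm_nonneg _)
  · filter_upwards [hxP] with τ hτ q hq'
    have h1 : HasFDerivAt Φ (fderiv ℝ Φ (q, x τ)) (q, x τ) :=
      ((hΦ.differentiableOn one_ne_zero).differentiableAt (hΩ.mem_nhds (hq' _ hτ).1)).hasFDerivAt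
    have h2 : HasFDerivAt (fun q => (q, x τ)) (.inl ℝ Q Y) q := hasFDerivAt_prodMk_left q (x τ)
    exact (HasFDerivAt.comp (g := Φ) q h1 h2).const_smul (h τ)

end Parametric

/-- Differentiation under the integral sign, to any finite order, for an integrand which depends on
the integration variable through a map `x` with values in a compact set. The spaces lie in one
universe because the induction on the order replaces `E` by `Q →L[ℝ] E`. -/
theorem contDiffOn_integral_smul_comp {T : Type*} [MeasurableSpace T] {m : Measure T}
    {Y Q : Type} [NormedAddCommGroup Y] [NormedSpace ℝ Y] [MeasurableSpace Y] [BorelSpace Y]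
    [NormedAddCommGroup Q] [NormedSpace ℝ Q]
    {x : T → Y} {P : Set Y} {h : T → ℝ} (hP : IsCompact P) (hx : AEMeasurable x m)
    (hxP : ∀ᵐ τ ∂m, x τ ∈ P) (hh : Integrable h m) {Ω : Set (Q × Y)} (hΩ : IsOpen Ω)
    {U : Set Q} (hU : IsOpen U) (hq : ∀ q ∈ U, ∀ y ∈ P, (q, y) ∈ Ω) (n : ℕ) :
    ∀ {E : Type} [NormedAddCommGroup E] [NormedSpace ℝ E] {Φ : Q × Y → E},
      ContDiffOn ℝ n Φ Ω → ContDiffOn ℝ n (fun q => ∫ τ, h τ • Φ (q, x τ) ∂m) U := by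
  induction n with
  | zero =>
    intro E _ _ Φ hΦ
    refine contDiffOn_zero.2 fun q hqU => ContinuousAt.continuousWithinAt ?_
    exact continuousAt_integral_smul_comp hP hx hxP hh hΩ hΦ.continuousOn (hq q hqU)
  | succ n ih =>
    intro E _ _ Φ hΦ
    have h1 : ContDiffOn ℝ 1 Φ Ω := hΦ.of_le (by norm_cast; omega)
    have hd : ∀ q ∈ U, HasFDerivAt (fun q => ∫ τ, h τ • Φ (q, x τ) ∂m)
      (∫ τ, h τ • (fderiv ℝ Φ (q, x τ)).comp (.inl ℝ Q Y) ∂m) q := fun q hqU =>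
        hasFDerivAt_integral_smul_comp hP hx hxP hh hΩ h1 (hq q hqU)
    have h2 := (contDiffOn_succ_iff_fderiv_of_isOpen (n := (n : WithTop ℕ∞)) hΩ).1
      (by exact_mod_cast hΦ)
    have h3 := ih (Φ := fun z => (fderiv ℝ Φ z).comp (.inl ℝ Q Y))
      (h2.2.2.clm_comp contDiffOn_const)
    have := (contDiffOn_succ_iff_fderiv_of_isOpen (n := (n : WithTop ℕ∞)) hU
      (f := fun q => ∫ τ, h τ • Φ (q, x τ) ∂m)).2
      ⟨fun q hqU => (hd q hqU).differentiableAt.differentiableWithinAt, by simp,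
        h3.congr fun q hqU => (hd q hqU).fderiv⟩
    exact_mod_cast this

/-- A jointly `C^n` family has derivatives, in the second variable, that converge locally
uniformly as the parameter converges. -/
theorem tendstoUniformlyOn_iteratedFDeriv_of_contDiffOn {B A : Type*}
    [NormedAddCommGroup B] [NormedSpace ℝ B] [NormedAddCommGroup A] [NormedSpace ℝ A]
    {F : B → A → ℝ} {O : Set (B × A)} (hO : IsOpen O) {n m : ℕ} (hm : m ≤ n)
    (hF : ContDiffOn ℝ n (fun z : B × A => F z.1 z.2) O) {p₀ : B} {C : Set A} (hC : IsCompact C)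
    (hp : ∀ l ∈ C, (p₀, l) ∈ O) :
    TendstoUniformlyOn (fun p => iteratedFDeriv ℝ m (F p)) (iteratedFDeriv ℝ m (F p₀)) (𝓝 p₀) C := by
  -- the partial derivatives in the second variable are restrictions of the full derivatives
  set G : B × A → ℝ := fun z => F z.1 z.2 with hG
  have key : ∀ z ∈ O, iteratedFDeriv ℝ m (F z.1) z.2 =
      (iteratedFDeriv ℝ m G z).compContinuousLinearMap fun _ => .inr ℝ B A := by
    rintro ⟨p, l⟩ hz
    have h1 : F p = (fun w => G ((p, (0 : A)) + w)) ∘ (ContinuousLinearMap.inr ℝ B A) := by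
      funext l'; simp [hG]
    set O' : Set (B × A) := (fun w => (p, (0 : A)) + w) ⁻¹' O
    have hO' : IsOpen O' := hO.preimage (by fun_prop)
    have hG' : ContDiffOn ℝ n (fun w => G ((p, (0 : A)) + w)) O' :=
      hF.comp (by fun_prop) fun w hw => hw
    have hl : (ContinuousLinearMap.inr ℝ B A) l ∈ O' := by simpa [O'] using hz
    have h2 := (ContinuousLinearMap.inr ℝ B A).iteratedFDerivWithin_comp_right hG'
      hO'.uniqueDiffOn (hO'.preimage (ContinuousLinearMap.inr ℝ B A).continuous).uniqueDiffOn hl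
      (i := m) (by exact_mod_cast hm)
    rw [iteratedFDerivWithin_of_isOpen m hO' hl, iteratedFDerivWithin_of_isOpen m
      (hO'.preimage (ContinuousLinearMap.inr ℝ B A).continuous) hl] at h2
    rw [h1, h2, iteratedFDeriv_comp_add_left]
    simp
  have hcont : ContinuousOn (fun z : B × A => iteratedFDeriv ℝ m (F z.1) z.2) O := by
    have h1 : ContinuousOn (iteratedFDeriv ℝ m G) O :=
      (hF.continuousOn_iteratedFDerivWithin (m := m) (by exact_mod_cast hm) hO.uniqueDiffOn).congr
        fun z hz => (iteratedFDerivWithin_of_isOpen m hO hz).symm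
    refine ContinuousOn.congr (f := fun z => (ContinuousMultilinearMap.compContinuousLinearMapL
      (fun _ : Fin m => ContinuousLinearMap.inr ℝ B A)) (iteratedFDeriv ℝ m G z)) ?_ key
    exact (ContinuousLinearMap.continuous _).comp_continuousOn h1
  rw [Metric.tendstoUniformlyOn_iff]
  intro ε hε
  refine hC.eventually_forall_of_forall_eventually fun l hl => ?_
  have hz := hO.mem_nhds (hp l hl)
  have c1 : ContinuousAt (fun z : B × A => iteratedFDeriv ℝ m (F z.1) z.2) (p₀, l) :=
    hcont.continuousAt hz
  have c2 : ContinuousAt (fun z : B × A => iteratedFDeriv ℝ m (F p₀) z.2) (p₀, l) :=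
    ContinuousAt.comp (g := fun z : B × A => iteratedFDeriv ℝ m (F z.1) z.2)
      (f := fun z : B × A => (p₀, z.2)) c1 (by fun_prop)
  exact (c2.dist c1).eventually_lt continuousAt_const (by simpa using hε)

/-! ### Holomorphic maps of several variables -/

/-- By Cauchy's formula on complex lines, the derivative of a holomorphic map is continuous. -/
theorem DifferentiableOn.contDiffOn_one_of_complex {E F : Type*} [NormedAddCommGroup E]
    [NormedSpace ℂ E] [FiniteDimensional ℂ E] [NormedAddCommGroup F] [NormedSpace ℂ F]
    [CompleteSpace F] {f : E → F} {U : Set E} (hf : DifferentiableOn ℂ f U) (hU : IsOpen U) :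
    ContDiffOn ℝ 1 f U := by
  have hcont : ContinuousOn (fderiv ℂ f) U := by
    rw [continuousOn_clm_apply]
    intro v z₀ hz₀
    apply ContinuousAt.continuousWithinAt
    have hmap : Continuous fun p : E × ℂ => p.1 + p.2 • v := by fun_prop
    have hnear : ∀ᶠ p : E × ℂ in 𝓝 (z₀, 0), p.1 + p.2 • v ∈ U :=
      hmap.continuousAt.eventually_mem (by simpa using hU.mem_nhds hz₀)
    rw [nhds_prod_eq, eventually_prod_iff] at hnear
    obtain ⟨pa, hpa, pb, hpb, hab⟩ := hnear
    obtain ⟨r, hr, hrb⟩ := Metric.eventually_nhds_iff_ball.1 hpb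
    have hr2 : Metric.closedBall (0 : ℂ) (r / 2) ⊆ Metric.ball 0 r :=
      Metric.closedBall_subset_ball (by linarith)
    have hunif : TendstoUniformlyOn (fun z ζ => f (z + ζ • v)) (fun ζ => f (z₀ + ζ • v)) (𝓝 z₀)
        (Metric.closedBall (0 : ℂ) (r / 2)) := by
      rw [Metric.tendstoUniformlyOn_iff]
      intro ε hε
      refine (isCompact_closedBall (0 : ℂ) (r / 2)).eventually_forall_of_forall_eventually
        fun ζ hζ => ?_
      have hin : z₀ + ζ • v ∈ U := hab hpa.self_of_nhds (hrb _ (hr2 hζ))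
      have c0 : ContinuousAt f (z₀ + ζ • v) := hf.continuousOn.continuousAt (hU.mem_nhds hin)
      have c1 : ContinuousAt (fun p : E × ℂ => f (p.1 + p.2 • v)) (z₀, ζ) :=
        ContinuousAt.comp (g := f) (f := fun p : E × ℂ => p.1 + p.2 • v) c0 hmap.continuousAt
      have c2 : ContinuousAt (fun p : E × ℂ => f (z₀ + p.2 • v)) (z₀, ζ) :=
        ContinuousAt.comp (g := f) (f := fun p : E × ℂ => z₀ + p.2 • v) c0 (by fun_prop)
      exact (c2.dist c1).eventually_lt continuousAt_const (by simpa using hε)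
    have hline : ∀ z, pa z → ∀ ζ ∈ Metric.ball (0 : ℂ) r,
        HasDerivAt (fun ζ : ℂ => f (z + ζ • v)) (fderiv ℂ f (z + ζ • v) v) ζ := by
      intro z hz ζ hζ
      have h1 := (hf.differentiableAt (hU.mem_nhds (hab hz (hrb _ hζ)))).hasFDerivAt
      have h2 : HasDerivAt (fun ζ : ℂ => z + ζ • v) v ζ := by
        simpa using ((hasDerivAt_id ζ).smul_const v).const_add z
      exact h1.comp_hasDerivAt ζ h2
    have hsub : Metric.ball (0 : ℂ) (r / 2) ⊆ Metric.ball 0 r :=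
      Metric.ball_subset_ball (by linarith)
    -- locally uniform convergence on a disc in the line `z + ℂ v` passes to the derivative
    have hderiv := (hunif.mono Metric.ball_subset_closedBall).tendstoLocallyUniformlyOn.deriv
      (by filter_upwards [hpa] with z hz ζ hζ using
        (hline z hz ζ (hsub hζ)).differentiableAt.differentiableWithinAt) Metric.isOpen_ball
    have h0 := hderiv.tendsto_at (Metric.mem_ball_self (by linarith : 0 < r / 2))
    have e : ∀ z, pa z → _root_.deriv (fun ζ : ℂ => f (z + ζ • v)) 0 = fderiv ℂ f z v := fun z hz => by
      simpa using (hline z hz 0 (Metric.mem_ball_self hr)).deriv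
    rw [e z₀ hpa.self_of_nhds] at h0
    refine Tendsto.congr' ?_ h0
    filter_upwards [hpa] with z hz using e z hz
  have h1 : ContDiffOn ℂ 1 f U := by
    have := (contDiffOn_succ_iff_fderiv_of_isOpen (n := (0 : WithTop ℕ∞)) (𝕜 := ℂ) hU (f := f)).2
      ⟨hf, by simp, contDiffOn_zero.2 hcont⟩
    simpa using this
  exact h1.restrict_scalars ℝ

/-- Near a point where it does not vanish, a holomorphic map has a null zero set: on every complex
line through that point the zeros are isolated, and Tonelli's theorem applies to dilations. -/
theorem volume_zeros_inter_ball_eq_zero {n : ℕ} {g : Cn n → Cn n} {u : Cn n} {ε : ℝ}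
    (hg : DifferentiableOn ℂ g (Metric.ball u ε)) (hε : 0 < ε) (hu : g u ≠ 0) :
    volume {z | z ∈ Metric.ball u ε ∧ g z = 0} = 0 := by
  set S : Set (Cn n) := {w | w ∈ Metric.ball 0 ε ∧ g (u + w) = 0} with hS
  have hadd : ∀ w, u + w ∈ Metric.ball u ε ↔ w ∈ Metric.ball 0 ε := fun w => by simp
  have hcont : ContinuousOn (fun w => g (u + w)) (Metric.ball 0 ε) :=
    hg.continuousOn.comp (by fun_prop) fun w hw => (hadd w).2 hw
  have hSm : MeasurableSet S := by
    have h1 : IsOpen (Metric.ball 0 ε ∩ (fun w => g (u + w)) ⁻¹' {0}ᶜ) :=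
      hcont.isOpen_inter_preimage Metric.isOpen_ball isOpen_compl_singleton
    have h2 : S = Metric.ball 0 ε \ (Metric.ball 0 ε ∩ (fun w => g (u + w)) ⁻¹' {0}ᶜ) := by
      ext w; by_cases hw : w ∈ Metric.ball 0 ε <;> simp_all
    rw [h2]
    exact measurableSet_ball.diff h1.measurableSet
  -- the zeros on the complex line `ℂ w` are isolated, hence countable
  have hline : ∀ w, volume {t : ℝ | t • w ∈ S} = 0 := by
    intro w
    set V : Set ℂ := (fun ζ : ℂ => ζ • w) ⁻¹' Metric.ball 0 ε with hV
    have hVo : IsOpen V := Metric.isOpen_ball.preimage (by fun_prop)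
    have hVc : IsPreconnected V := by
      have h1 : Convex ℝ V := by
        have h2 := (convex_ball (0 : Cn n) ε).linear_preimage
          ((LinearMap.toSpanSingleton ℂ (Cn n) w).restrictScalars ℝ)
        exact h2
      exact h1.isPreconnected
    have h0V : (0 : ℂ) ∈ V := by simp [hV, hε]
    have hd : DifferentiableOn ℂ (fun ζ : ℂ => g (u + ζ • w)) V :=
      hg.comp (by fun_prop) fun ζ hζ => (hadd _).2 hζ
    have ha : AnalyticOnNhd ℂ (fun ζ : ℂ => g (u + ζ • w)) V := hd.analyticOnNhd hVo
    have hcount : {ζ ∈ V | g (u + ζ • w) = 0}.Countable := by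
      have h1 := ha.preimage_zero_mem_codiscreteWithin (x := 0) (by simpa using hu) h0V
        ⟨⟨0, h0V⟩, hVc⟩
      have h2 : DiscreteTopology ↑(((fun ζ : ℂ => g (u + ζ • w)) ⁻¹' {0}ᶜ)ᶜ ∩ V) :=
        isDiscrete_iff_discreteTopology.mp
          (isDiscrete_of_codiscreteWithin (by rwa [compl_compl]))
      have h3 : (((fun ζ : ℂ => g (u + ζ • w)) ⁻¹' {0}ᶜ)ᶜ ∩ V).Countable :=
        TopologicalSpace.separableSpace_iff_countable.1 inferInstance
      exact h3.mono fun ζ hζ => And.intro (by simpa using hζ.2) hζ.1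
    refine Countable.measure_zero ((hcount.preimage Complex.ofReal_injective).mono ?_) _
    intro t ht
    have e : ((t : ℂ) • w) = t • w := by ext j; simp
    exact ⟨by simpa [hV, e] using ht.1, by simpa [e] using ht.2⟩
  have hA : MeasurableSet {p : ℝ × Cn n | p.1 ∈ Icc (1 : ℝ) 2 ∧ p.1 • p.2 ∈ S} :=
    (measurable_fst measurableSet_Icc).inter
      ((by fun_prop : Measurable fun p : ℝ × Cn n => p.1 • p.2) hSm)
  have hprod : (volume.prod volume : Measure (Cn n × ℝ))
      (Prod.swap ⁻¹' {p : ℝ × Cn n | p.1 ∈ Icc (1 : ℝ) 2 ∧ p.1 • p.2 ∈ S}) = 0 := by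
    rw [Measure.measure_prod_null (measurable_swap hA)]
    exact ae_of_all _ fun w => measure_mono_null (fun t ht => ht.2) (hline w)
  have hprod' : (volume.prod volume : Measure (ℝ × Cn n))
      {p : ℝ × Cn n | p.1 ∈ Icc (1 : ℝ) 2 ∧ p.1 • p.2 ∈ S} = 0 := by
    rw [← Measure.prod_swap, Measure.map_apply measurable_swap hA]
    exact hprod
  have hae := (Measure.measure_prod_null hA).1 hprod'
  -- some dilation of `S` by a factor in `[1/2, 1]` is null, hence so is `S`
  obtain ⟨t, ht, ht0⟩ : ∃ t ∈ Icc (1 : ℝ) 2, volume {w : Cn n | t • w ∈ S} = 0 := by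
    by_contra! hcon
    have h1 : volume (Icc (1 : ℝ) 2) = 0 := by
      refine measure_mono_null (fun t ht => ?_) hae
      intro h
      refine hcon t ht (measure_mono_null (fun w hw => ?_) h)
      exact ⟨ht, hw⟩
    norm_num at h1
  have hS0 : volume S = 0 := by
    have h1 := Measure.addHaar_preimage_smul (volume : Measure (Cn n))
      (by linarith [ht.1] : t ≠ 0) S
    rw [show (t • ·) ⁻¹' S = {w : Cn n | t • w ∈ S} from rfl, ht0] at h1
    rcases mul_eq_zero.1 h1.symm with h | h
    · have : (0 : ℝ) < |(t ^ Module.finrank ℝ (Cn n))⁻¹| := by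
        have := ht.1; positivity
      exact absurd (ENNReal.ofReal_eq_zero.1 h) (not_le.2 this)
    · exact h
  have h2 : {z | z ∈ Metric.ball u ε ∧ g z = 0} = (fun z => -u + z) ⁻¹' S := by
    ext z
    simp [hS, dist_eq_norm, neg_add_eq_sub]
  rw [h2, measure_preimage_add]
  exact hS0

/-- A holomorphic map on a connected open set is zero or has a null zero set. -/
theorem volume_zeros_eq_zero {n : ℕ} {g : Cn n → Cn n} {D : Set (Cn n)}
    (hg : DifferentiableOn ℂ g D) (hD : IsOpen D) (hDc : IsPreconnected D)
    (hne : ∃ u ∈ D, g u ≠ 0) : volume {z | z ∈ D ∧ g z = 0} = 0 := by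
  set S : Set (Cn n) := {z | z ∈ D ∧ g z = 0} with hS
  have hstar : ∀ u ε, 0 < ε → Metric.ball u ε ⊆ D → g u ≠ 0 → volume (S ∩ Metric.ball u ε) = 0 :=
    fun u ε hε hsub hu => measure_mono_null (fun z hz => And.intro hz.2 hz.1.2)
      (volume_zeros_inter_ball_eq_zero (hg.mono hsub) hε hu)
  have hball : ∀ w ∈ D, ∃ ε > 0, Metric.ball w (2 * ε) ⊆ D := by
    intro w hw
    obtain ⟨ε, hε, h⟩ := Metric.isOpen_iff.1 hD w hw
    exact ⟨ε / 2, by linarith, by simpa [mul_div_cancel₀] using h⟩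
  have hshift : ∀ {w u : Cn n} {ε : ℝ}, u ∈ Metric.ball w ε →
      Metric.ball u ε ⊆ Metric.ball w (2 * ε) := by
    intro w u ε hu
    refine Metric.ball_subset_ball' ?_
    have := Metric.mem_ball.1 hu
    linarith
  -- the interior of the zero set is open and relatively closed in `D`
  have hint : interior S = ∅ := by
    by_contra hcon
    obtain ⟨z₀, hz₀⟩ := nonempty_iff_ne_empty.2 hcon
    have hDS : D ⊆ interior S := by
      refine hDc.subset_of_closure_inter_subset isOpen_interior
        ⟨z₀, (interior_subset hz₀).1, hz₀⟩ ?_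
      rintro w ⟨hwc, hwD⟩
      obtain ⟨ε, hε, hsub⟩ := hball w hwD
      obtain ⟨z, hz, hzw⟩ := Metric.mem_closure_iff.1 hwc (ε / 2) (by linarith)
      refine mem_interior.2 ⟨Metric.ball w (ε / 2), fun u hu => ?_, Metric.isOpen_ball,
        Metric.mem_ball_self (by linarith)⟩
      have hu' : u ∈ Metric.ball w ε := Metric.ball_subset_ball (by linarith) hu
      have huD : Metric.ball u ε ⊆ D := (hshift hu').trans hsub
      refine ⟨huD (Metric.mem_ball_self hε), by_contra fun hgu => ?_⟩
      have h0 := hstar u ε hε huD hgu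
      have hpos : 0 < volume (interior S ∩ Metric.ball u ε) := by
        refine (isOpen_interior.inter Metric.isOpen_ball).measure_pos _ ⟨z, hz, ?_⟩
        have h1 := Metric.mem_ball.1 hu
        have h2 := dist_triangle z w u
        rw [Metric.mem_ball]
        rw [dist_comm] at hzw
        rw [dist_comm] at h1
        linarith
      exact hpos.ne' (measure_mono_null (inter_subset_inter_left _ interior_subset) h0)
    obtain ⟨u, huD, hu⟩ := hne
    exact hu (interior_subset (hDS huD)).2
  refine measure_null_of_locally_null S fun w hw => ?_
  obtain ⟨ε, hε, hsub⟩ := hball w hw.1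
  obtain ⟨u, hu, hgu⟩ : ∃ u ∈ Metric.ball w ε, g u ≠ 0 := by
    by_contra! hcon
    have : w ∈ interior S := mem_interior.2 ⟨Metric.ball w ε, fun u hu =>
      ⟨hsub (Metric.ball_subset_ball (by linarith) hu), hcon u hu⟩, Metric.isOpen_ball,
      Metric.mem_ball_self hε⟩
    simp [hint] at this
  refine ⟨S ∩ Metric.ball u ε, inter_mem_nhdsWithin _ (Metric.isOpen_ball.mem_nhds ?_),
    hstar u ε hε ((hshift hu).trans hsub) hgu⟩
  rw [Metric.mem_ball, dist_comm]
  exact hu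

/-- The points with nontrivial isotropy in an orbifold chart form a null set. -/
theorem ComplexOrbifold.volume_fixed_eq_zero {n : ℕ} {ι X : Type*} [TopologicalSpace X]
    (A : ComplexOrbifold n ι X) (i : ι) {γ : A.dom i ≃ₜ A.dom i} (hγ : γ ∈ A.grp i) (h1 : γ ≠ 1) :
    volume {u : Cn n | ∃ h : u ∈ A.dom i, γ ⟨u, h⟩ = ⟨u, h⟩} = 0 := by
  obtain ⟨f, hf, hfγ⟩ := A.holo_grp i γ hγ
  have h2 : ∃ u ∈ A.dom i, f u - u ≠ 0 := by
    by_contra! hcon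
    refine h1 (Homeomorph.ext fun u => Subtype.ext ?_)
    rw [← hfγ u]
    exact sub_eq_zero.1 (hcon u u.2)
  refine measure_mono_null (fun u hu => ?_) (volume_zeros_eq_zero (g := fun u => f u - u)
    (hf.sub differentiableOn_id) (A.isOpen_dom i) (A.isConnected_dom i).isPreconnected h2)
  obtain ⟨h, hu⟩ := hu
  refine ⟨h, ?_⟩
  have := hfγ ⟨u, h⟩
  rw [hu] at this
  exact sub_eq_zero.2 this

/-! ### A Riemannian metric on an open subset of `ℂⁿ` -/

/-- `g` is a smooth Riemannian metric on the set `D`. -/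
structure BilinField.IsMetricOn {n : ℕ} (g : BilinField n) (D : Set (Cn n)) : Prop where
  smooth : ContDiffOn ℝ ∞ g D
  symm : ∀ u ∈ D, ∀ v w, g u v w = g u w v
  pos : ∀ u ∈ D, ∀ v, v ≠ 0 → 0 < g u v v

theorem KahlerOrbifold.isMetricOn {n : ℕ} {ι X : Type*} [TopologicalSpace X]
    (K : KahlerOrbifold n ι X) (i : ι) : (K.metric i).IsMetricOn (K.dom i) :=
  ⟨K.smooth i, K.symm i, K.pos i⟩

namespace BilinField

variable {n : ℕ}

/-- `BilinField.basis` as a basis of the real vector space `ℂⁿ`. -/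
def realBasis (n : ℕ) : Module.Basis (Fin n ⊕ Fin n) ℝ (Cn n) :=
  Module.Basis.ofEquivFun
    { toFun := fun z => Sum.elim (fun j => (z j).re) (fun j => (z j).im)
      invFun := fun c j => ⟨c (.inl j), c (.inr j)⟩
      map_add' := fun z w => by ext (j | j) <;> simp
      map_smul' := fun t z => by ext (j | j) <;> simp
      left_inv := fun z => by ext j; simp
      right_inv := fun c => by ext (j | j) <;> simp }

theorem coe_realBasis : ⇑(realBasis n) = basis := by
  funext p
  rw [realBasis, Module.Basis.coe_ofEquivFun]
  rcases p with j | j <;> ext k <;>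
    by_cases h : k = j <;> simp [basis, h, Complex.ext_iff]

theorem sum_repr_smul_basis (v : Cn n) : ∑ p, (realBasis n).repr v p • basis p = v := by
  rw [← coe_realBasis]; exact (realBasis n).sum_repr v

/-- The gradient `∇ f` with respect to `g`. -/
def grad (g : BilinField n) (f : Cn n → ℝ) (u : Cn n) : Cn n :=
  ∑ p, (∑ q, cometric g u p q * partialD q f u) • basis p

namespace IsMetricOn

variable {g : BilinField n} {D : Set (Cn n)} (hg : g.IsMetricOn D)
include hg

theorem posDef_gram {u : Cn n} (hu : u ∈ D) : (gram g u).PosDef := by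
  refine Matrix.PosDef.of_dotProduct_mulVec_pos ?_ ?_
  · ext p q
    simp [gram, Matrix.conjTranspose_apply, hg.symm u hu (basis p) (basis q)]
  · intro x hx
    set v : Cn n := ∑ p, x p • basis p with hv
    have hv0 : v ≠ 0 := by
      intro h0
      apply hx
      have h1 := (realBasis n).linearIndependent
      rw [coe_realBasis] at h1
      exact funext (Fintype.linearIndependent_iff.1 h1 x (by rw [← hv, h0]))
    have h2 : g u v v = star x ⬝ᵥ ((gram g u).mulVec x) := by
      simp only [hv, map_sum, map_smul, dotProduct, Matrix.mulVec, gram, Matrix.of_apply,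
        _root_.sum_apply, _root_.smul_apply, smul_eq_mul, star_trivial,
        Finset.mul_sum]
      rw [Finset.sum_comm]
      refine Finset.sum_congr rfl fun p _ => Finset.sum_congr rfl fun q _ => by ring
    rw [← h2]
    exact hg.pos u hu v hv0

theorem det_gram_pos {u : Cn n} (hu : u ∈ D) : 0 < (gram g u).det := (hg.posDef_gram hu).det_pos

theorem volDensity_pos {u : Cn n} (hu : u ∈ D) : 0 < volDensity g u :=
  Real.sqrt_pos.2 (hg.det_gram_pos hu)

theorem contDiffOn_gram (p q : Fin n ⊕ Fin n) : ContDiffOn ℝ ∞ (fun u => gram g u p q) D :=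
  (hg.smooth.clm_apply contDiffOn_const).clm_apply contDiffOn_const

omit hg in
theorem contDiffOn_det {A : Cn n → Matrix (Fin n ⊕ Fin n) (Fin n ⊕ Fin n) ℝ}
    (hA : ∀ p q, ContDiffOn ℝ ∞ (fun u => A u p q) D) :
    ContDiffOn ℝ ∞ (fun u => (A u).det) D := by
  simp only [Matrix.det_apply']
  exact ContDiffOn.sum fun σ _ => contDiffOn_const.mul (contDiffOn_prod fun p _ => hA _ _)

theorem contDiffOn_volDensity : ContDiffOn ℝ ∞ (volDensity g) D :=
  (contDiffOn_det hg.contDiffOn_gram).sqrt fun _ hu => (hg.det_gram_pos hu).ne'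

theorem contDiffOn_cometric (p q : Fin n ⊕ Fin n) :
    ContDiffOn ℝ ∞ (fun u => cometric g u p q) D := by
  -- Cramer's rule
  have h : ∀ u, cometric g u p q =
      (gram g u).det⁻¹ * ((gram g u).updateRow q (Pi.single p 1)).det := fun u => by
    rw [cometric, Matrix.inv_def, Matrix.smul_apply, Matrix.adjugate_apply, Ring.inverse_eq_inv',
      smul_eq_mul]
  simp only [h]
  refine ((contDiffOn_det hg.contDiffOn_gram).inv fun u hu => (hg.det_gram_pos hu).ne').mul
    (contDiffOn_det fun s t => ?_)
  by_cases hs : s = q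
  · subst hs
    simpa using contDiffOn_const
  · simpa [Matrix.updateRow_ne hs] using hg.contDiffOn_gram s t

/-- The gradient represents the differential. -/
theorem metric_grad {u : Cn n} (hu : u ∈ D) (f : Cn n → ℝ) (w : Cn n) :
    g u (grad g f u) w = fderiv ℝ f u w := by
  have key : ∀ s, g u (grad g f u) (basis s) = fderiv ℝ f u (basis s) := by
    intro s
    have hs : ∀ p, g u (basis p) (basis s) = gram g u s p := fun p => hg.symm u hu _ _
    have hdet : IsUnit (gram g u).det := (hg.det_gram_pos hu).ne'.isUnit
    have h1 : ((gram g u).mulVec ((cometric g u).mulVec fun q => partialD q f u)) s =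
        partialD s f u := by
      rw [Matrix.mulVec_mulVec, cometric, Matrix.mul_nonsing_inv _ hdet, Matrix.one_mulVec]
    rw [show fderiv ℝ f u (basis s) = partialD s f u from rfl, ← h1]
    simp only [grad, map_sum, map_smul, _root_.sum_apply,
      _root_.smul_apply, smul_eq_mul, hs, Matrix.mulVec, dotProduct]
    exact Finset.sum_congr rfl fun p _ => mul_comm _ _
  rw [← sum_repr_smul_basis w]
  simp only [map_sum, map_smul, key]

theorem eq_grad {u : Cn n} (hu : u ∈ D) {f : Cn n → ℝ} {G : Cn n}
    (hG : ∀ w, g u G w = fderiv ℝ f u w) : G = grad g f u := by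
  by_contra hne
  have h1 := hg.pos u hu (G - grad g f u) (sub_ne_zero.2 hne)
  have h2 : g u (G - grad g f u) = 0 := by
    ext w
    simp [hG, hg.metric_grad hu]
  simp [h2] at h1

omit hg in
theorem fderiv_grad (f h : Cn n → ℝ) (u : Cn n) : fderiv ℝ h u (grad g f u) =
    ∑ p, partialD p h u * ∑ q, cometric g u p q * partialD q f u := by
  simp only [grad, map_sum, map_smul, smul_eq_mul, partialD]
  exact Finset.sum_congr rfl fun p _ => mul_comm _ _

end IsMetricOn

theorem _root_.ContDiffOn.partialD {D : Set (Cn n)} {f : Cn n → ℝ} (hf : ContDiffOn ℝ ∞ f D)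
    (hD : IsOpen D) (p : Fin n ⊕ Fin n) : ContDiffOn ℝ ∞ (partialD p f) D :=
  (hf.fderiv_of_isOpen hD (m := ∞) (by simp)).clm_apply contDiffOn_const

/-- The components of `volDensity g • grad g f`, whose divergence is the Laplacian. -/
def flux (g : BilinField n) (f : Cn n → ℝ) (p : Fin n ⊕ Fin n) (u : Cn n) : ℝ :=
  volDensity g u * ∑ q, cometric g u p q * partialD q f u

theorem laplacian_eq (g : BilinField n) (f : Cn n → ℝ) (u : Cn n) :
    laplacian g f u = -(1 / volDensity g u) * ∑ p, partialD p (flux g f p) u := rfl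

namespace IsMetricOn

variable {g : BilinField n} {D : Set (Cn n)} (hg : g.IsMetricOn D) (hD : IsOpen D)
include hg hD

theorem contDiffOn_flux {f : Cn n → ℝ} (hf : ContDiffOn ℝ ∞ f D) (p : Fin n ⊕ Fin n) :
    ContDiffOn ℝ ∞ (flux g f p) D :=
  hg.contDiffOn_volDensity.mul
    (ContDiffOn.sum fun q _ => (hg.contDiffOn_cometric p q).mul (hf.partialD hD q))

theorem continuousOn_laplacian {f : Cn n → ℝ} (hf : ContDiffOn ℝ ∞ f D) :
    ContinuousOn (laplacian g f) D := by
  have h : ContDiffOn ℝ ∞ (fun u => -(1 / volDensity g u) * ∑ p, partialD p (flux g f p) u) D :=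
    (contDiffOn_const.div hg.contDiffOn_volDensity fun u hu => (hg.volDensity_pos hu).ne').neg.mul
      (ContDiffOn.sum fun p _ => (hg.contDiffOn_flux hD hf p).partialD hD p)
  exact h.continuousOn

theorem contDiffOn_grad {f : Cn n → ℝ} (hf : ContDiffOn ℝ ∞ f D) :
    ContDiffOn ℝ ∞ (grad g f) D :=
  ContDiffOn.sum fun p _ => ContDiffOn.smul (f := fun u => ∑ q, cometric g u p q * partialD q f u)
    (g := fun _ => basis p)
    (ContDiffOn.sum fun q _ => (hg.contDiffOn_cometric p q).mul (hf.partialD hD q)) contDiffOn_const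

theorem continuousOn_scal : ContinuousOn (scal g) D := by
  have h1 : ∀ s p q, ContDiffOn ℝ ∞ (christoffel g s p q) D := fun s p q =>
    contDiffOn_const.mul (ContDiffOn.sum fun m _ => (hg.contDiffOn_cometric s m).mul
      ((((hg.contDiffOn_gram q m).partialD hD p).add ((hg.contDiffOn_gram p m).partialD hD q)).sub
        ((hg.contDiffOn_gram p q).partialD hD m)))
  have h2 : ∀ p q, ContDiffOn ℝ ∞ (ricci g p q) D := fun p q =>
    (ContDiffOn.sum fun s _ => ((h1 s p q).partialD hD s).sub ((h1 s p s).partialD hD q)).add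
      (ContDiffOn.sum fun s _ => ContDiffOn.sum fun m _ =>
        ((h1 s s m).mul (h1 m p q)).sub ((h1 s q m).mul (h1 m p s)))
  have h3 : ContDiffOn ℝ ∞ (scal g) D :=
    ContDiffOn.sum fun p _ => ContDiffOn.sum fun q _ => (hg.contDiffOn_cometric p q).mul (h2 p q)
  exact h3.continuousOn

/-- The chain rule `Δ (φ ∘ f) = φ'(f) Δ f - φ''(f) |d f|²`. -/
theorem laplacian_comp {f : Cn n → ℝ} (hf : ContDiffOn ℝ ∞ f D) {φ φ' : ℝ → ℝ} {φ'' : ℝ}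
    {u : Cn n} (hu : u ∈ D) (hφ : ∀ᶠ t in 𝓝 (f u), HasDerivAt φ (φ' t) t)
    (hφ' : HasDerivAt φ' φ'' (f u)) :
    laplacian g (fun w => φ (f w)) u =
      φ' (f u) * laplacian g f u - φ'' * fderiv ℝ f u (grad g f u) := by
  have hfd : ∀ w ∈ D, DifferentiableAt ℝ f w := fun w hw =>
    (hf.contDiffAt (hD.mem_nhds hw)).differentiableAt (by simp)
  have hev : ∀ᶠ w in 𝓝 u, ∀ q, partialD q (fun w => φ (f w)) w = φ' (f w) * partialD q f w := by
    filter_upwards [(hfd u hu).continuousAt.eventually hφ, hD.mem_nhds hu] with w hw hwD q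
    have := hw.comp_hasFDerivAt w (hfd w hwD).hasFDerivAt
    simp [partialD, show fderiv ℝ (fun w => φ (f w)) w = φ' (f w) • fderiv ℝ f w from this.fderiv]
  have hflux : ∀ p, partialD p (flux g (fun w => φ (f w)) p) u =
      φ' (f u) * partialD p (flux g f p) u + φ'' * partialD p f u * flux g f p u := by
    intro p
    have e : flux g (fun w => φ (f w)) p =ᶠ[𝓝 u] fun w => φ' (f w) * flux g f p w := by
      filter_upwards [hev] with w hw
      simp only [flux, hw, Finset.mul_sum]
      exact Finset.sum_congr rfl fun q _ => by ring
    have h1 : HasFDerivAt (fun w => φ' (f w)) (φ'' • fderiv ℝ f u) u :=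
      hφ'.comp_hasFDerivAt u (hfd u hu).hasFDerivAt
    have h2 : HasFDerivAt (flux g f p) (fderiv ℝ (flux g f p) u) u :=
      (((hg.contDiffOn_flux hD hf p).contDiffAt (hD.mem_nhds hu)).differentiableAt
        (by simp)).hasFDerivAt
    have h3 : fderiv ℝ (fun w => φ' (f w) * flux g f p w) u = _ := (h1.mul h2).fderiv
    rw [partialD, e.fderiv_eq, h3]
    simp [partialD]
    ring
  have hv := (hg.volDensity_pos hu).ne'
  rw [laplacian_eq, laplacian_eq, fderiv_grad, Finset.sum_congr rfl fun p _ => hflux p,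
    Finset.sum_add_distrib, ← Finset.mul_sum, mul_add, sub_eq_add_neg]
  congr 1
  · ring
  · have : ∑ p, φ'' * partialD p f u * flux g f p u =
        volDensity g u * (φ'' * ∑ p, partialD p f u * ∑ q, cometric g u p q * partialD q f u) := by
      simp only [flux, Finset.mul_sum]
      exact Finset.sum_congr rfl fun p _ => Finset.sum_congr rfl fun q _ => by ring
    rw [this]
    field_simp

end IsMetricOn

end BilinField

/-! ### Integration by parts and changes of charts -/

section CompactSupport

variable {E F : Type*} [NormedAddCommGroup E] [NormedAddCommGroup F] {D C : Set E} {f : E → F}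

theorem ContinuousOn.continuous_of_eq_zero_of_notMem (hf : ContinuousOn f D) (hD : IsOpen D)
    (hC : IsClosed C) (hCD : C ⊆ D) (h0 : ∀ u, u ∉ C → f u = 0) : Continuous f := by
  refine continuous_iff_continuousAt.2 fun u => ?_
  by_cases hu : u ∈ C
  · exact hf.continuousAt (hD.mem_nhds (hCD hu))
  · refine (continuousAt_const (y := (0 : F))).congr ?_
    filter_upwards [hC.isOpen_compl.mem_nhds hu] with w hw using (h0 w hw).symm

theorem ContDiffOn.contDiff_of_eq_zero_of_notMem [NormedSpace ℝ E] [NormedSpace ℝ F]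
    {k : WithTop ℕ∞} (hf : ContDiffOn ℝ k f D) (hD : IsOpen D)
    (hC : IsClosed C) (hCD : C ⊆ D) (h0 : ∀ u, u ∉ C → f u = 0) : ContDiff ℝ k f := by
  refine contDiff_iff_contDiffAt.2 fun u => ?_
  by_cases hu : u ∈ C
  · exact hf.contDiffAt (hD.mem_nhds (hCD hu))
  · refine (contDiffAt_const (c := (0 : F))).congr_of_eventuallyEq ?_
    filter_upwards [hC.isOpen_compl.mem_nhds hu] with w hw using h0 w hw

theorem ContinuousOn.integrable_of_eq_zero_of_notMem [MeasurableSpace E] [BorelSpace E]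
    {μ : Measure E} [IsFiniteMeasureOnCompacts μ] (hf : ContinuousOn f D) (hD : IsOpen D)
    (hC : IsCompact C) (hCD : C ⊆ D) (h0 : ∀ u, u ∉ C → f u = 0) : Integrable f μ :=
  (hf.continuous_of_eq_zero_of_notMem hD hC.isClosed hCD h0).integrable_of_hasCompactSupport
    (HasCompactSupport.intro hC fun u hu => h0 u hu)

theorem fderiv_eq_zero_of_eq_zero_of_notMem [NormedSpace ℝ E] [NormedSpace ℝ F] (hC : IsClosed C)
    (h0 : ∀ u, u ∉ C → f u = 0) {u : E} (hu : u ∉ C) : fderiv ℝ f u = 0 := by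
  have : f =ᶠ[𝓝 u] fun _ => 0 := by
    filter_upwards [hC.isOpen_compl.mem_nhds hu] with w hw using h0 w hw
  rw [this.fderiv_eq]
  simp

end CompactSupport

namespace BilinField

variable {n : ℕ}

namespace IsMetricOn

variable {g : BilinField n} {D : Set (Cn n)}

/-- Green's formula for a function `χ` with compact support in a chart. -/
theorem setIntegral_mul_laplacian (hg : g.IsMetricOn D) (hD : IsOpen D) {f χ : Cn n → ℝ}
    {C : Set (Cn n)} (hf : ContDiffOn ℝ ∞ f D) (hχ : ContDiffOn ℝ 1 χ D) (hC : IsCompact C)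
    (hCD : C ⊆ D) (h0 : ∀ u, u ∉ C → χ u = 0) :
    ∫ u in D, χ u * laplacian g f u * volDensity g u =
      ∫ u in D, fderiv ℝ χ u (grad g f u) * volDensity g u := by
  have hχ1 : ContDiff ℝ 1 χ := hχ.contDiff_of_eq_zero_of_notMem hD hC.isClosed hCD h0
  have hd0 : ∀ u, u ∉ C → fderiv ℝ χ u = 0 := fun u hu =>
    fderiv_eq_zero_of_eq_zero_of_notMem hC.isClosed h0 hu
  have hflux := hg.contDiffOn_flux hD hf
  have hi1 : ∀ p, Integrable (fun u => χ u * partialD p (flux g f p) u) := fun p =>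
    (hχ.continuousOn.mul ((hflux p).partialD hD p).continuousOn).integrable_of_eq_zero_of_notMem
      hD hC hCD fun u hu => by simp [h0 u hu]
  have hi2 : ∀ p, Integrable (fun u => partialD p χ u * flux g f p u) := fun p =>
    (((hχ1.continuous_fderiv one_ne_zero).clm_apply continuous_const).continuousOn.mul
      (hflux p).continuousOn).integrable_of_eq_zero_of_notMem hD hC hCD
        fun u hu => by simp [hd0 u hu]
  -- integration by parts in each coordinate direction
  have hparts : ∀ p, ∫ u, χ u * partialD p (flux g f p) u =
      -∫ u, partialD p χ u * flux g f p u := by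
    intro p
    refine integral_mul_fderiv_eq_neg_fderiv_mul_of_integrable (hi2 p) (hi1 p) ?_ ?_ ?_
    · exact (hχ.continuousOn.mul (hflux p).continuousOn).integrable_of_eq_zero_of_notMem
        hD hC hCD fun u hu => by simp [h0 u hu]
    · exact fun u _ => (hχ1.differentiable one_ne_zero) u
    · intro u hu
      have hsub : tsupport χ ⊆ C := closure_minimal
        (fun w hw => by_contra fun hwC => hw (h0 w hwC)) hC.isClosed
      exact ((hflux p).contDiffAt (hD.mem_nhds (hCD (hsub hu)))).differentiableAt (by simp)
  have hL : ∫ u in D, χ u * laplacian g f u * volDensity g u =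
      ∫ u in D, -∑ p, χ u * partialD p (flux g f p) u := by
    refine setIntegral_congr_fun hD.measurableSet fun u hu => ?_
    have := (hg.volDensity_pos hu).ne'
    simp only [laplacian_eq, ← Finset.mul_sum]
    field_simp
  have hR : ∫ u in D, fderiv ℝ χ u (grad g f u) * volDensity g u =
      ∫ u in D, ∑ p, partialD p χ u * flux g f p u := by
    refine setIntegral_congr_fun hD.measurableSet fun u hu => ?_
    simp only [fderiv_grad, flux, Finset.sum_mul]
    exact Finset.sum_congr rfl fun p _ => by ring
  rw [hL, hR, setIntegral_eq_integral_of_forall_compl_eq_zero,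
    setIntegral_eq_integral_of_forall_compl_eq_zero, integral_neg, integral_finsetSum,
    integral_finsetSum, Finset.sum_congr rfl fun p _ => hparts p, Finset.sum_neg_distrib, neg_neg]
  · exact fun p _ => hi2 p
  · exact fun p _ => hi1 p
  · intro u hu
    simp [partialD, hd0 u fun h => hu (hCD h)]
  · intro u hu
    simp [h0 u fun h => hu (hCD h)]

end IsMetricOn

/-- `ψ` is a `C¹` isometry between the open sets `ψ.source` and `ψ.target`. -/
structure IsIsometry (g₁ g₂ : BilinField n) (ψ : OpenPartialHomeomorph (Cn n) (Cn n)) : Prop where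
  contDiffOn : ContDiffOn ℝ 1 ψ ψ.source
  contDiffOn_symm : ContDiffOn ℝ 1 ψ.symm ψ.target
  isometry : ∀ z ∈ ψ.source, ∀ v w, g₂ (ψ z) (fderiv ℝ ψ z v) (fderiv ℝ ψ z w) = g₁ z v w

namespace IsIsometry

variable {g₁ g₂ : BilinField n} {ψ : OpenPartialHomeomorph (Cn n) (Cn n)} {D₁ D₂ : Set (Cn n)}
  (h : IsIsometry g₁ g₂ ψ)
include h

theorem differentiableAt {z : Cn n} (hz : z ∈ ψ.source) : DifferentiableAt ℝ ψ z :=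
  (h.contDiffOn.contDiffAt (ψ.open_source.mem_nhds hz)).differentiableAt one_ne_zero

/-- The Riemannian density is multiplied by the Jacobian, since
`det (Aᵀ G A) = (det A)² det G`. -/
theorem volDensity_eq {z : Cn n} (hz : z ∈ ψ.source) :
    |(fderiv ℝ ψ z).det| * volDensity g₂ (ψ z) = volDensity g₁ z := by
  set A := LinearMap.toMatrix (realBasis n) (realBasis n) (fderiv ℝ ψ z : Cn n →ₗ[ℝ] Cn n) with hA
  have hcol : ∀ p, fderiv ℝ ψ z (basis p) = ∑ s, A s p • basis s := by
    intro p
    rw [← sum_repr_smul_basis (fderiv ℝ ψ z (basis p))]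
    refine Finset.sum_congr rfl fun s _ => ?_
    rw [hA, LinearMap.toMatrix_apply, coe_realBasis]
    rfl
  have hgram : gram g₁ z = A.transpose * gram g₂ (ψ z) * A := by
    ext p q
    rw [show gram g₁ z p q = g₁ z (basis p) (basis q) from rfl, ← h.isometry z hz, hcol, hcol]
    simp only [map_sum, map_smul, _root_.sum_apply, _root_.smul_apply, smul_eq_mul,
      Matrix.mul_apply, Matrix.transpose_apply, Finset.sum_mul, gram, Matrix.of_apply,
      Finset.mul_sum]
    refine Finset.sum_congr rfl fun s _ => Finset.sum_congr rfl fun t _ => by ring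
  have hdet : A.det = (fderiv ℝ ψ z).det := LinearMap.det_toMatrix _ _
  rw [volDensity, volDensity, hgram, Matrix.det_mul, Matrix.det_mul, Matrix.det_transpose, hdet,
    mul_right_comm, ← sq, Real.sqrt_mul (sq_nonneg _), Real.sqrt_sq_eq_abs]

theorem setLIntegral_image {E : Set (Cn n)} (hE : MeasurableSet E) (hEs : E ⊆ ψ.source)
    (f : Cn n → ENNReal) :
    ∫⁻ v in ψ '' E, f v * ENNReal.ofReal (volDensity g₂ v) =
      ∫⁻ u in E, f (ψ u) * ENNReal.ofReal (volDensity g₁ u) := by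
  rw [lintegral_image_eq_lintegral_abs_det_fderiv_mul volume hE
    (fun u hu => (h.differentiableAt (hEs hu)).hasFDerivAt.hasFDerivWithinAt)
    (ψ.injOn.mono hEs)]
  refine setLIntegral_congr_fun hE fun u hu => ?_
  rw [← h.volDensity_eq (hEs hu), ENNReal.ofReal_mul (abs_nonneg _)]
  ring

theorem setIntegral_target (f : Cn n → ℝ) :
    ∫ v in ψ.target, f v * volDensity g₂ v = ∫ u in ψ.source, f (ψ u) * volDensity g₁ u := by
  rw [← ψ.image_source_eq_target,
    integral_image_eq_integral_abs_det_fderiv_smul volume ψ.open_source.measurableSet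
    (fun u hu => (h.differentiableAt hu).hasFDerivAt.hasFDerivWithinAt) ψ.injOn]
  refine setIntegral_congr_fun ψ.open_source.measurableSet fun u hu => ?_
  rw [← h.volDensity_eq hu, smul_eq_mul]
  ring

theorem fderiv_eq {f₁ f₂ : Cn n → ℝ} (hf : ∀ z ∈ ψ.source, f₂ (ψ z) = f₁ z) {z : Cn n}
    (hz : z ∈ ψ.source) (hd : DifferentiableAt ℝ f₂ (ψ z)) (v : Cn n) :
    fderiv ℝ f₁ z v = fderiv ℝ f₂ (ψ z) (fderiv ℝ ψ z v) := by
  have h1 : f₁ =ᶠ[𝓝 z] f₂ ∘ ψ := by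
    filter_upwards [ψ.open_source.mem_nhds hz] with w hw using (hf w hw).symm
  rw [h1.fderiv_eq, fderiv_comp z hd (h.differentiableAt hz)]
  rfl

theorem surjective_fderiv {z : Cn n} (hz : z ∈ ψ.source) :
    Function.Surjective (fderiv ℝ ψ z) := by
  have hs : DifferentiableAt ℝ ψ.symm (ψ z) :=
    (h.contDiffOn_symm.contDiffAt (ψ.open_target.mem_nhds (ψ.map_source hz))).differentiableAt
      one_ne_zero
  have hd := h.differentiableAt hz
  have h1 : HasFDerivAt (ψ ∘ ψ.symm) ((fderiv ℝ ψ z).comp (fderiv ℝ ψ.symm (ψ z))) (ψ z) := by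
    refine HasFDerivAt.comp (ψ z) ?_ hs.hasFDerivAt
    rw [ψ.left_inv hz]
    exact hd.hasFDerivAt
  have h2 : HasFDerivAt (ψ ∘ ψ.symm) (ContinuousLinearMap.id ℝ (Cn n)) (ψ z) := by
    refine (hasFDerivAt_id (ψ z)).congr_of_eventuallyEq ?_
    filter_upwards [ψ.open_target.mem_nhds (ψ.map_source hz)] with w hw using ψ.right_inv hw
  intro v
  refine ⟨fderiv ℝ ψ.symm (ψ z) v, ?_⟩
  have := h1.unique h2
  exact congrArg (fun L => L v) this

theorem fderiv_grad (h₂ : g₂.IsMetricOn D₂) (h₁ : g₁.IsMetricOn D₁) (hs : ψ.source ⊆ D₁)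
    (ht : ψ.target ⊆ D₂) {f₁ f₂ : Cn n → ℝ} (hf : ∀ z ∈ ψ.source, f₂ (ψ z) = f₁ z) {z : Cn n}
    (hz : z ∈ ψ.source) (hd : DifferentiableAt ℝ f₂ (ψ z)) :
    fderiv ℝ ψ z (grad g₁ f₁ z) = grad g₂ f₂ (ψ z) := by
  refine h₂.eq_grad (ht (ψ.map_source hz)) fun w => ?_
  obtain ⟨v, rfl⟩ := h.surjective_fderiv hz w
  rw [h.isometry z hz, h₁.metric_grad (hs hz), h.fderiv_eq hf hz hd]

/-- The Laplacian is invariant under isometries. By Green's formula both sides have the same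
integrals against test functions, so that no second derivatives of `ψ` are needed. -/
theorem laplacian_eq (h₂ : g₂.IsMetricOn D₂) (h₁ : g₁.IsMetricOn D₁) (hD₁ : IsOpen D₁)
    (hD₂ : IsOpen D₂) (hs : ψ.source ⊆ D₁) (ht : ψ.target ⊆ D₂) {f₁ f₂ : Cn n → ℝ}
    (hf : ∀ z ∈ ψ.source, f₂ (ψ z) = f₁ z) (hf₁ : ContDiffOn ℝ ∞ f₁ D₁)
    (hf₂ : ContDiffOn ℝ ∞ f₂ D₂) {z : Cn n} (hz : z ∈ ψ.source) :
    laplacian g₁ f₁ z = laplacian g₂ f₂ (ψ z) := by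
  have hmap : MapsTo ψ ψ.source D₂ := fun w hw => ht (ψ.map_source hw)
  set R : Cn n → ℝ := fun w => (laplacian g₁ f₁ w - laplacian g₂ f₂ (ψ w)) * volDensity g₁ w with hR
  have hc1 : ContinuousOn (laplacian g₁ f₁) ψ.source := (h₁.continuousOn_laplacian hD₁ hf₁).mono hs
  have hc2 : ContinuousOn (fun w => laplacian g₂ f₂ (ψ w)) ψ.source :=
    (h₂.continuousOn_laplacian hD₂ hf₂).comp ψ.continuousOn hmap
  have hcv : ContinuousOn (volDensity g₁) ψ.source := h₁.contDiffOn_volDensity.continuousOn.mono hs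
  have hRc : ContinuousOn R ψ.source := (hc1.sub hc2).mul hcv
  have hd₂ : ∀ w ∈ ψ.source, DifferentiableAt ℝ f₂ (ψ w) := fun w hw =>
    (hf₂.contDiffAt (hD₂.mem_nhds (hmap hw))).differentiableAt (by simp)
  have htest : ∀ η : Cn n → ℝ, ContDiff ℝ ∞ η → HasCompactSupport η → tsupport η ⊆ ψ.source →
      ∫ w, η w • R w = 0 := by
    intro η hη hηc hηs
    have hη0 : ∀ w, w ∉ tsupport η → η w = 0 := fun w hw => image_eq_zero_of_notMem_tsupport hw
    -- the test function transported to the target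
    set χ : Cn n → ℝ := ψ.target.indicator (η ∘ ψ.symm) with hχ
    have hχψ : ∀ w ∈ ψ.source, χ (ψ w) = η w := fun w hw => by
      simp [hχ, indicator_of_mem (ψ.map_source hw), ψ.left_inv hw]
    have hCt : ψ '' tsupport η ⊆ ψ.target := by
      rintro _ ⟨w, hw, rfl⟩
      exact ψ.map_source (hηs hw)
    have hC : IsCompact (ψ '' tsupport η) :=
      IsCompact.image_of_continuousOn hηc (ψ.continuousOn.mono hηs)
    have hχ0 : ∀ v, v ∉ ψ '' tsupport η → χ v = 0 := by
      intro v hv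
      by_cases hvt : v ∈ ψ.target
      · rw [hχ, indicator_of_mem hvt]
        refine hη0 _ fun hcon => hv ⟨_, hcon, ψ.right_inv hvt⟩
      · exact indicator_of_notMem hvt _
    have hχt : ContDiffOn ℝ 1 χ ψ.target :=
      ((hη.of_le (by simp)).comp_contDiffOn h.contDiffOn_symm).congr fun v hv =>
        indicator_of_mem hv _
    have hχ1 : ContDiff ℝ 1 χ :=
      hχt.contDiff_of_eq_zero_of_notMem ψ.open_target hC.isClosed hCt hχ0
    have e1 := (IsMetricOn.mk (h₁.smooth.mono hs) (fun u hu => h₁.symm u (hs hu))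
      fun u hu => h₁.pos u (hs hu)).setIntegral_mul_laplacian ψ.open_source (hf₁.mono hs)
      (hη.of_le (by simp)).contDiffOn hηc hηs hη0
    have e2 := (IsMetricOn.mk (h₂.smooth.mono ht) (fun u hu => h₂.symm u (ht hu))
      fun u hu => h₂.pos u (ht hu)).setIntegral_mul_laplacian ψ.open_target (hf₂.mono ht)
      hχt hC hCt hχ0
    rw [h.setIntegral_target, h.setIntegral_target] at e2
    have e3 : ∫ u in ψ.source, fderiv ℝ χ (ψ u) (grad g₂ f₂ (ψ u)) * volDensity g₁ u =
        ∫ u in ψ.source, fderiv ℝ η u (grad g₁ f₁ u) * volDensity g₁ u := by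
      refine setIntegral_congr_fun ψ.open_source.measurableSet fun u hu => ?_
      rw [h.fderiv_eq hχψ hu (hχ1.differentiable one_ne_zero _),
        h.fderiv_grad h₂ h₁ hs ht hf hu (hd₂ u hu)]
    rw [e3, ← e1] at e2
    have hi1 : IntegrableOn (fun u => η u * laplacian g₁ f₁ u * volDensity g₁ u) ψ.source :=
      (((hη.continuous.continuousOn.mul hc1).mul hcv).integrable_of_eq_zero_of_notMem
        ψ.open_source hηc hηs fun u hu => by simp [hη0 u hu]).integrableOn
    have hi2 : IntegrableOn (fun u => χ (ψ u) * laplacian g₂ f₂ (ψ u) * volDensity g₁ u)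
        ψ.source := by
      have : IntegrableOn (fun u => η u * laplacian g₂ f₂ (ψ u) * volDensity g₁ u) ψ.source :=
        (((hη.continuous.continuousOn.mul hc2).mul hcv).integrable_of_eq_zero_of_notMem
        ψ.open_source hηc hηs fun u hu => by simp [hη0 u hu]).integrableOn
      exact this.congr_fun (fun u hu => by simp only [hχψ u hu]) ψ.open_source.measurableSet
    rw [← setIntegral_eq_integral_of_forall_compl_eq_zero (s := ψ.source)]
    · rw [← sub_eq_zero, ← integral_sub hi2 hi1] at e2
      rw [← neg_eq_zero, ← integral_neg, ← e2]
      refine setIntegral_congr_fun ψ.open_source.measurableSet fun u hu => ?_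
      simp only [hχψ u hu, hR, smul_eq_mul]
      ring
    · intro u hu
      simp [hη0 u fun hcon => hu (hηs hcon)]
  have hae := ψ.open_source.ae_eq_zero_of_integral_contDiff_smul_eq_zero
    (hRc.locallyIntegrableOn ψ.open_source.measurableSet) htest
  have hzero : EqOn R (fun _ => 0) ψ.source :=
    Measure.eqOn_open_of_ae_eq ((ae_restrict_iff' ψ.open_source.measurableSet).2 hae)
      ψ.open_source hRc continuousOn_const
  have := hzero hz
  simp only [hR, mul_eq_zero, (h₁.volDensity_pos (hs hz)).ne', or_false] at this
  exact sub_eq_zero.1 this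

end IsIsometry

end BilinField

/-! ### The Riemannian measure of a Kähler orbifold -/

namespace ComplexOrbifold

variable {n : ℕ} {ι X : Type*} [TopologicalSpace X] (A : ComplexOrbifold n ι X)

theorem isOpen_image_proj (i : ι) {U : Set (Cn n)} (hU : IsOpen U) (hUd : U ⊆ A.dom i) :
    IsOpen (A.proj i '' U) := by
  have h := A.isOpenMap_proj i _ (hU.preimage continuous_subtype_val)
  rwa [image_domRestrict, inter_eq_left.2 hUd] at h

/-- A function on `X` is continuous if its expressions in the charts are. -/
theorem continuous_of_continuousOn_charts {Y : Type*} [TopologicalSpace Y] {F : X → Y}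
    (hF : ∀ i, ContinuousOn (fun u => F (A.proj i u)) (A.dom i)) : Continuous F := by
  refine continuous_def.2 fun V hV => ?_
  have h1 : F ⁻¹' V = ⋃ i, A.proj i '' (A.dom i ∩ (fun u => F (A.proj i u)) ⁻¹' V) := by
    ext x
    simp only [mem_preimage, mem_iUnion, mem_image, mem_inter_iff]
    constructor
    · intro hx
      obtain ⟨i, u, hu, rfl⟩ := A.cover x
      exact ⟨i, u, ⟨hu, hx⟩, rfl⟩
    · rintro ⟨i, u, ⟨-, hu⟩, rfl⟩
      exact hu
  rw [h1]
  exact isOpen_iUnion fun i => A.isOpen_image_proj i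
    ((hF i).isOpen_inter_preimage (A.isOpen_dom i) hV) inter_subset_left

/-- An element of the group of a chart, as a partial homeomorphism of `ℂⁿ` with source and target
`dom i`. -/
def groupLift (i : ι) (γ : A.dom i ≃ₜ A.dom i) : OpenPartialHomeomorph (Cn n) (Cn n) := by
  classical exact
  { toFun := fun u => if h : u ∈ A.dom i then γ ⟨u, h⟩ else u
    invFun := fun u => if h : u ∈ A.dom i then γ.symm ⟨u, h⟩ else u
    source := A.dom i
    target := A.dom i
    map_source' := fun u hu => by simp [hu]
    map_target' := fun u hu => by simp [hu]
    left_inv' := fun u hu => by simp [hu]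
    right_inv' := fun u hu => by simp [hu]
    open_source := A.isOpen_dom i
    open_target := A.isOpen_dom i
    continuousOn_toFun := by
      rw [continuousOn_iff_continuous_domRestrict]
      refine (continuous_subtype_val.comp γ.continuous).congr fun u => ?_
      simp [Set.domRestrict, u.2]
    continuousOn_invFun := by
      rw [continuousOn_iff_continuous_domRestrict]
      refine (continuous_subtype_val.comp γ.symm.continuous).congr fun u => ?_
      simp [Set.domRestrict, u.2] }

theorem groupLift_apply (i : ι) (γ : A.dom i ≃ₜ A.dom i) (u : A.dom i) :
    A.groupLift i γ u = γ u := by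
  classical
  change (if h : (u : Cn n) ∈ A.dom i then ((γ ⟨u, h⟩ : A.dom i) : Cn n) else u) = γ u
  simp

theorem groupLift_symm_apply (i : ι) (γ : A.dom i ≃ₜ A.dom i) (u : A.dom i) :
    (A.groupLift i γ).symm u = γ.symm u := by
  classical
  change (if h : (u : Cn n) ∈ A.dom i then ((γ.symm ⟨u, h⟩ : A.dom i) : Cn n) else u) = γ.symm u
  simp

theorem isLift_groupLift (i : ι) {γ : A.dom i ≃ₜ A.dom i} (hγ : γ ∈ A.grp i) :
    A.IsLift id i i (A.groupLift i γ) := by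
  refine ⟨subset_rfl, subset_rfl, ?_, ?_, fun z hz => ?_⟩
  · obtain ⟨f, hf, h⟩ := A.holo_grp i γ hγ
    exact hf.congr fun u hu => by rw [A.groupLift_apply i γ ⟨u, hu⟩, h ⟨u, hu⟩]
  · obtain ⟨f, hf, h⟩ := A.holo_grp i γ⁻¹ (inv_mem hγ)
    exact hf.congr fun u hu => by rw [A.groupLift_symm_apply i γ ⟨u, hu⟩, h ⟨u, hu⟩]; rfl
  · rw [A.groupLift_apply i γ ⟨z, hz⟩]
    exact ((A.fiber i ⟨z, hz⟩ (γ ⟨z, hz⟩)).2 ⟨γ, hγ, rfl⟩).symm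

instance (i : ι) : Finite (A.grp i) := A.finite_grp i

/-- Over the intersection of two chart images, chart `i` is covered by countably many lifts of the
identity to chart `j`. -/
theorem exists_lifts (i j : ι) {u₀ : Cn n} (hu₀ : u₀ ∈ A.dom i)
    (hj : A.proj i u₀ ∈ A.proj j '' A.dom j) :
    ∃ ψ : ℕ → OpenPartialHomeomorph (Cn n) (Cn n), (∀ s, A.IsLift id i j (ψ s)) ∧
      ⋃ s, (ψ s).source = A.dom i ∩ A.proj i ⁻¹' (A.proj j '' A.dom j) := by
  set D := A.dom i ∩ A.proj i ⁻¹' (A.proj j '' A.dom j) with hD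
  have h1 : ∀ u : D, ∃ ψ, A.IsLift id i j ψ ∧ (u : Cn n) ∈ ψ.source := by
    rintro ⟨u, hu, v, hv, huv⟩
    obtain ⟨ψ, hus, -, hs, ht, hd, hd', hp⟩ := A.compat i j u hu v hv huv.symm
    exact ⟨ψ, ⟨hs, ht, hd, hd', hp⟩, hus⟩
  choose ψ hψ hmem using h1
  have hcov : ⋃ u : D, (ψ u).source = D := by
    refine subset_antisymm (iUnion_subset fun u z hz => ?_) fun u hu =>
      mem_iUnion.2 ⟨⟨u, hu⟩, hmem ⟨u, hu⟩⟩
    exact ⟨(hψ u).1 hz, ψ u z, (hψ u).2.1 ((ψ u).map_source hz), (hψ u).2.2.2.2 z hz⟩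
  obtain ⟨T, hT, hTc⟩ := TopologicalSpace.isOpen_iUnion_countable (fun u : D => (ψ u).source)
    fun u => (ψ u).open_source
  have hTne : T.Nonempty := by
    by_contra hcon
    rw [not_nonempty_iff_eq_empty.1 hcon, hcov] at hTc
    have : u₀ ∈ D := ⟨hu₀, hj⟩
    rw [← hTc] at this
    simp at this
  obtain ⟨e, he⟩ := hT.exists_eq_range hTne
  refine ⟨fun s => ψ (e s), fun s => hψ _, ?_⟩
  rw [← hcov, ← hTc, he, biUnion_range]

/-- The points of a chart with nontrivial isotropy group. -/
def isotropy (i : ι) : Set (Cn n) :=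
  {u | ∃ h : u ∈ A.dom i, ∃ γ ∈ A.grp i, γ ≠ 1 ∧ γ ⟨u, h⟩ = ⟨u, h⟩}

theorem volume_isotropy (i : ι) : volume (A.isotropy i) = 0 := by
  have h1 : A.isotropy i ⊆ ⋃ γ : A.grp i, {u | ∃ h : u ∈ A.dom i,
      (γ : A.dom i ≃ₜ A.dom i) ≠ 1 ∧ (γ : A.dom i ≃ₜ A.dom i) ⟨u, h⟩ = ⟨u, h⟩} := by
    rintro u ⟨h, γ, hγ, h1, h2⟩
    exact mem_iUnion.2 ⟨⟨γ, hγ⟩, h, h1, h2⟩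
  refine measure_mono_null h1 (measure_iUnion_null fun γ => ?_)
  by_cases h : (γ : A.dom i ≃ₜ A.dom i) = 1
  · simp [h]
  · exact measure_mono_null (fun u ⟨hu, _, h2⟩ => Exists.intro hu h2) (A.volume_fixed_eq_zero i γ.2 h)

theorem eq_of_apply_eq_of_notMem_isotropy {i : ι} {u : A.dom i} (hu : (u : Cn n) ∉ A.isotropy i)
    {γ δ : A.dom i ≃ₜ A.dom i} (hγ : γ ∈ A.grp i) (hδ : δ ∈ A.grp i) (h : γ u = δ u) : γ = δ := by
  by_contra hne
  refine hu ⟨u.2, δ⁻¹ * γ, mul_mem (inv_mem hδ) hγ, fun h1 => hne (inv_mul_eq_one.1 h1).symm, ?_⟩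
  change δ.symm (γ u) = u
  rw [h, Homeomorph.symm_apply_apply]

end ComplexOrbifold

namespace KahlerOrbifold

variable {n : ℕ} {ι X : Type*} [TopologicalSpace X] (K : KahlerOrbifold n ι X)

/-- Changes of charts are isometries; they are `C¹` because they are holomorphic. -/
theorem isIsometry_of_isLift {i j : ι} {ψ : OpenPartialHomeomorph (Cn n) (Cn n)}
    (h : K.IsLift id i j ψ) : BilinField.IsIsometry (K.metric i) (K.metric j) ψ :=
  ⟨h.2.2.1.contDiffOn_one_of_complex ψ.open_source,
    h.2.2.2.1.contDiffOn_one_of_complex ψ.open_target, K.metric_compat i j ψ h⟩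

/-- The density of the Riemannian volume in chart `i`, as a weight for measures. -/
def density (i : ι) (u : Cn n) : ENNReal := ENNReal.ofReal (BilinField.volDensity (K.metric i) u)

theorem setLIntegral_image_lift {i j : ι} {ψ : OpenPartialHomeomorph (Cn n) (Cn n)}
    (h : K.IsLift id i j ψ) {E : Set (Cn n)} (hE : MeasurableSet E) (hEs : E ⊆ ψ.source) :
    ∫⁻ v in ψ '' E, K.density j v = ∫⁻ u in E, K.density i u := by
  simpa [density] using (K.isIsometry_of_isLift h).setLIntegral_image hE hEs fun _ => 1

theorem volume_image_lift {i j : ι} {ψ : OpenPartialHomeomorph (Cn n) (Cn n)}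
    (h : K.IsLift id i j ψ) {E : Set (Cn n)} (hE : volume E = 0) (hEs : E ⊆ ψ.source) :
    volume (ψ '' E) = 0 :=
  addHaar_image_eq_zero_of_differentiableOn_of_addHaar_eq_zero volume
    (((K.isIsometry_of_isLift h).contDiffOn.differentiableOn one_ne_zero).mono hEs) hE

theorem measurableSet_dom (i : ι) : MeasurableSet (K.dom i) := (K.isOpen_dom i).measurableSet

theorem continuousOn_volDensity (i : ι) :
    ContinuousOn (BilinField.volDensity (K.metric i)) (K.dom i) :=
  (K.isMetricOn i).contDiffOn_volDensity.continuousOn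

theorem aemeasurable_density (i : ι) : AEMeasurable (K.density i) (volume.restrict (K.dom i)) :=
  ((K.continuousOn_volDensity i).aemeasurable (K.measurableSet_dom i)).ennreal_ofReal

theorem measurableSet_image_lift {ψ : OpenPartialHomeomorph (Cn n) (Cn n)} {E : Set (Cn n)}
    (hE : MeasurableSet E) (hEs : E ⊆ ψ.source) : MeasurableSet (ψ '' E) :=
  hE.image_of_continuousOn_injOn (ψ.continuousOn.mono hEs) (ψ.injOn.mono hEs)

variable [MeasurableSpace X] [BorelSpace X]

theorem measurableSet_preimage_proj (i : ι) {B : Set X} (hB : MeasurableSet B) :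
    MeasurableSet (K.dom i ∩ K.proj i ⁻¹' B) := by
  have h1 := (continuousOn_iff_continuous_domRestrict.1 (K.continuousOn_proj i)).measurable hB
  have h2 := (MeasurableEmbedding.subtype_coe (K.measurableSet_dom i)).measurableSet_image' h1
  convert h2 using 1
  ext u
  simp [Set.domRestrict, and_comm]

/-- The two charts contribute equally, after division by the orders of the groups, to a set in both
of their images: the fibre product of the two charts over the set maps to chart `i` with
`|grp j|` points in almost every fibre, and to chart `j` with `|grp i|` points. -/
theorem card_mul_setLIntegral_density (i j : ι) {B : Set X} (hB : MeasurableSet B)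
    (hBi : B ⊆ K.proj i '' K.dom i) (hBj : B ⊆ K.proj j '' K.dom j) :
    (Nat.card (K.grp j) : ENNReal) * ∫⁻ u in K.dom i ∩ K.proj i ⁻¹' B, K.density i u =
      (Nat.card (K.grp i) : ENNReal) * ∫⁻ v in K.dom j ∩ K.proj j ⁻¹' B, K.density j v := by
  classical
  rcases B.eq_empty_or_nonempty with rfl | ⟨x₀, hx₀⟩
  · simp
  obtain ⟨u₀, hu₀, rfl⟩ := hBi hx₀
  obtain ⟨ψ, hψ, hcov⟩ := K.exists_lifts i j hu₀ (hBj hx₀)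
  have := Fintype.ofFinite (K.grp i)
  have := Fintype.ofFinite (K.grp j)
  set Bi := K.dom i ∩ K.proj i ⁻¹' B with hBi'
  set Bj := K.dom j ∩ K.proj j ⁻¹' B with hBj'
  have hBim : MeasurableSet Bi := K.measurableSet_preimage_proj i hB
  have hBjm : MeasurableSet Bj := K.measurableSet_preimage_proj j hB
  -- a measurable partition of `Bi` into sets on which a lift is given
  set E : ℕ → Set (Cn n) := fun s => disjointed (fun s => (ψ s).source) s ∩ Bi with hE
  have hEm : ∀ s, MeasurableSet (E s) := fun s =>
    (MeasurableSet.disjointed (fun s => (ψ s).open_source.measurableSet) s).inter hBim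
  have hEs : ∀ s, E s ⊆ (ψ s).source := fun s =>
    inter_subset_left.trans (disjointed_subset _ s)
  have hEd : Pairwise (Function.onFun Disjoint E) := fun s t hst =>
    (disjoint_disjointed (fun s => (ψ s).source) hst).mono inter_subset_left inter_subset_left
  have hEU : ⋃ s, E s = Bi := by
    rw [hE, ← iUnion_inter, iUnion_disjointed, hcov]
    refine inter_eq_right.2 fun u hu => ⟨hu.1, hBj hu.2⟩
  -- the sets `M s γ` below cover `Bj`, almost every point `|grp i|` times
  set L : K.grp j → OpenPartialHomeomorph (Cn n) (Cn n) := fun γ => K.groupLift j γ with hL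
  have hLl : ∀ γ, K.IsLift id j j (L γ) := fun γ => K.isLift_groupLift j γ.2
  have hψt : ∀ s, ψ s '' E s ⊆ K.dom j := by
    rintro s _ ⟨u, hu, rfl⟩
    exact (hψ s).2.1 ((ψ s).map_source (hEs s hu))
  set M : ℕ → K.grp j → Set (Cn n) := fun s γ => L γ '' (ψ s '' E s) with hM
  have hψm : ∀ s, MeasurableSet (ψ s '' E s) := fun s => measurableSet_image_lift (hEm s) (hEs s)
  have hMm : ∀ s γ, MeasurableSet (M s γ) := fun s γ => measurableSet_image_lift (hψm s) (hψt s)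
  have hMint : ∀ s γ, ∫⁻ v in M s γ, K.density j v = ∫⁻ u in E s, K.density i u := fun s γ => by
    rw [hM, K.setLIntegral_image_lift (hLl γ) (hψm s) (hψt s),
      K.setLIntegral_image_lift (hψ s) (hEm s) (hEs s)]
  have hMsub : ∀ s γ, M s γ ⊆ Bj := by
    rintro s γ _ ⟨_, ⟨u, hu, rfl⟩, rfl⟩
    have h1 : ψ s u ∈ K.dom j := hψt s ⟨u, hu, rfl⟩
    refine ⟨(hLl γ).2.1 ((L γ).map_source h1), ?_⟩
    rw [mem_preimage, (hLl γ).2.2.2.2 _ h1, id, (hψ s).2.2.2.2 u (hEs s hu), id]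
    exact hu.2.2
  -- the points where the number of preimages may be wrong
  have hbad : volume (K.isotropy j ∪ ⋃ s, ⋃ γ, L γ '' (ψ s '' (K.isotropy i ∩ E s))) = 0 := by
    refine measure_union_null (K.volume_isotropy j)
      (measure_iUnion_null fun s => measure_iUnion_null fun γ => ?_)
    refine K.volume_image_lift (hLl γ) (K.volume_image_lift (hψ s)
      (measure_mono_null inter_subset_left (K.volume_isotropy i))
      (inter_subset_right.trans (hEs s))) ?_
    exact (image_mono inter_subset_right).trans (hψt s)
  have hcount : ∀ v, v ∉ K.isotropy j ∪ ⋃ s, ⋃ γ, L γ '' (ψ s '' (K.isotropy i ∩ E s)) →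
      v ∈ Bj → ∑' s, ∑ γ, (M s γ).indicator (fun _ => (1 : ENNReal)) v = Nat.card (K.grp i) := by
    intro v hv hvB
    simp only [mem_union, mem_iUnion, not_or, not_exists] at hv
    obtain ⟨hvj, hvi⟩ := hv
    obtain ⟨u, hu, huv⟩ := hBi hvB.2
    have huB : ∀ δ : K.grp i, ((δ : K.dom i ≃ₜ K.dom i) ⟨u, hu⟩ : Cn n) ∈ Bi := fun δ => by
      refine ⟨Subtype.coe_prop _, ?_⟩
      rw [mem_preimage, ← (K.fiber i ⟨u, hu⟩ _).2 ⟨δ, δ.2, rfl⟩]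
      simpa [huv] using hvB.2
    have hex : ∀ w ∈ Bi, K.proj i w = K.proj j v → ∀ s, w ∈ E s → ∃ γ : K.grp j, L γ (ψ s w) = v := by
      intro w hw hwv s hws
      have h1 : ψ s w ∈ K.dom j := hψt s ⟨w, hws, rfl⟩
      have h2 : K.proj j (ψ s w) = K.proj j v := by
        rw [(hψ s).2.2.2.2 w (hEs s hws), id, hwv]
      obtain ⟨γ, hγ, hγv⟩ := (K.fiber j ⟨_, h1⟩ ⟨v, hvB.1⟩).1 h2
      refine ⟨⟨γ, hγ⟩, ?_⟩
      rw [hL, K.groupLift_apply j γ ⟨_, h1⟩, hγv]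
    have huiso : u ∉ K.isotropy i := by
      intro hcon
      have huB' : u ∈ Bi := huB 1
      rw [← hEU] at huB'
      obtain ⟨s, hs⟩ := mem_iUnion.1 huB'
      obtain ⟨γ, hγ⟩ := hex u (huB 1) huv s hs
      exact hvi s γ ⟨_, ⟨u, ⟨hcon, hs⟩, rfl⟩, hγ⟩
    -- the pairs `(s, γ)` with `v ∈ M s γ` are enumerated by the points `δ u` of the fibre
    have hind : ∀ s γ, (M s γ).indicator (fun _ => (1 : ENNReal)) v =
        ∑ δ : K.grp i, if ((δ : K.dom i ≃ₜ K.dom i) ⟨u, hu⟩ : Cn n) ∈ E s ∧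
          L γ (ψ s ((δ : K.dom i ≃ₜ K.dom i) ⟨u, hu⟩)) = v then 1 else 0 := by
      intro s γ
      by_cases hvM : v ∈ M s γ
      · rw [indicator_of_mem hvM]
        obtain ⟨_, ⟨w, hw, rfl⟩, hwv⟩ := hvM
        have hwd : w ∈ K.dom i := hw.2.1
        have h1 : ψ s w ∈ K.dom j := hψt s ⟨w, hw, rfl⟩
        have hwp : K.proj i w = K.proj i u := by
          rw [huv, ← hwv, (hLl γ).2.2.2.2 _ h1, id, (hψ s).2.2.2.2 w (hEs s hw), id]
        obtain ⟨δ, hδ, hδw⟩ := (K.fiber i ⟨u, hu⟩ ⟨w, hwd⟩).1 hwp.symm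
        rw [Finset.sum_eq_single (⟨δ, hδ⟩ : K.grp i)]
        · rw [if_pos]
          simp only [hδw]
          exact ⟨hw, hwv⟩
        · intro δ' _ hne
          rw [if_neg]
          rintro ⟨hδs, hδv⟩
          refine hne (Subtype.ext (K.eq_of_apply_eq_of_notMem_isotropy (u := ⟨u, hu⟩) huiso δ'.2 hδ
            (Subtype.ext ?_)))
          have h2 : ψ s ((δ' : K.dom i ≃ₜ K.dom i) ⟨u, hu⟩) = ψ s w :=
            (L γ).injOn (hψt s ⟨_, hδs, rfl⟩) h1 (hδv.trans hwv.symm)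
          rw [hδw]
          exact (ψ s).injOn (hEs s hδs) (hEs s hw) h2
        · simp
      · rw [indicator_of_notMem hvM, Finset.sum_eq_zero]
        intro δ _
        rw [if_neg]
        rintro ⟨h1, h2⟩
        exact hvM ⟨_, ⟨_, h1, rfl⟩, h2⟩
    have hδ : ∀ δ : K.grp i, ∑' s, ∑ γ, (if ((δ : K.dom i ≃ₜ K.dom i) ⟨u, hu⟩ : Cn n) ∈ E s ∧
          L γ (ψ s ((δ : K.dom i ≃ₜ K.dom i) ⟨u, hu⟩)) = v then (1 : ENNReal) else 0) = 1 := by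
      intro δ
      have h0 := huB δ
      rw [← hEU] at h0
      obtain ⟨s, hs⟩ := mem_iUnion.1 h0
      have hp : K.proj i ((δ : K.dom i ≃ₜ K.dom i) ⟨u, hu⟩) = K.proj j v := by
        rw [← huv]
        exact ((K.fiber i ⟨u, hu⟩ _).2 ⟨δ, δ.2, rfl⟩).symm
      obtain ⟨γ, hγ⟩ := hex _ (huB δ) hp s hs
      rw [tsum_eq_single s, Finset.sum_eq_single γ]
      · rw [if_pos ⟨hs, hγ⟩]
      · intro γ' _ hne
        rw [if_neg]
        rintro ⟨-, h2⟩
        apply hne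
        -- `γ' γ⁻¹` fixes `v`
        have h1 : ψ s ((δ : K.dom i ≃ₜ K.dom i) ⟨u, hu⟩) ∈ K.dom j := hψt s ⟨_, hs, rfl⟩
        rw [hL] at h2 hγ
        simp only [K.groupLift_apply j _ ⟨_, h1⟩] at h2 hγ
        by_contra hne'
        refine hvj ⟨hvB.1, γ' * γ⁻¹, mul_mem γ'.2 (inv_mem γ.2),
          fun h3 => hne' (Subtype.ext (mul_inv_eq_one.1 h3)), ?_⟩
        have h4 : (γ : K.dom j ≃ₜ K.dom j).symm ⟨v, hvB.1⟩ = ⟨_, h1⟩ := by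
          rw [Homeomorph.symm_apply_eq]
          exact Subtype.ext hγ.symm
        change (γ' : K.dom j ≃ₜ K.dom j) ((γ : K.dom j ≃ₜ K.dom j).symm ⟨v, hvB.1⟩) = _
        rw [h4]
        exact Subtype.ext h2
      · simp
      · intro t hts
        refine Finset.sum_eq_zero fun γ _ => if_neg ?_
        rintro ⟨h1, -⟩
        exact (disjoint_left.1 (hEd hts) h1) hs
    simp only [hind]
    calc _ = ∑' s, ∑ δ : K.grp i, ∑ γ : K.grp j, _ := by
            exact tsum_congr fun s => Finset.sum_comm
      _ = ∑ δ : K.grp i, ∑' s, ∑ γ : K.grp j, _ :=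
            Summable.tsum_finsetSum fun δ _ => ENNReal.summable
      _ = _ := by
            rw [Finset.sum_congr rfl fun δ _ => hδ δ]
            simp [Nat.card_eq_fintype_card]
  have hI : ∫⁻ u in Bi, K.density i u = ∑' s, ∫⁻ u in E s, K.density i u := by
    rw [← hEU, lintegral_iUnion hEm hEd]
  have hdm : AEMeasurable (K.density j) (volume.restrict Bj) :=
    (K.aemeasurable_density j).mono_measure (Measure.restrict_mono inter_subset_left le_rfl)
  have hindm : ∀ s γ, Measurable ((M s γ).indicator fun _ => (1 : ENNReal)) := fun s γ =>
    measurable_const.indicator (hMm s γ)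
  calc (Nat.card (K.grp j) : ENNReal) * ∫⁻ u in Bi, K.density i u
      = ∑' s, ∑ γ : K.grp j, ∫⁻ v in M s γ, K.density j v := by
        rw [hI, ← ENNReal.tsum_mul_left]
        refine tsum_congr fun s => ?_
        simp [hMint, Nat.card_eq_fintype_card]
    _ = ∑' s, ∑ γ : K.grp j, ∫⁻ v in Bj, (M s γ).indicator (fun _ => 1) v * K.density j v := by
        refine tsum_congr fun s => Finset.sum_congr rfl fun γ _ => ?_
        rw [← inter_eq_left.2 (hMsub s γ), ← Measure.restrict_restrict (hMm s γ),
          inter_eq_left.2 (hMsub s γ), ← lintegral_indicator (hMm s γ)]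
        refine lintegral_congr fun v => ?_
        by_cases h : v ∈ M s γ <;> simp [h]
    _ = ∫⁻ v in Bj, (∑' s, ∑ γ : K.grp j, (M s γ).indicator (fun _ => 1) v) * K.density j v := by
        simp only [← ENNReal.tsum_mul_right, Finset.sum_mul]
        rw [lintegral_tsum]
        · refine tsum_congr fun s => ?_
          rw [lintegral_finsetSum']
          exact fun γ _ => (hindm s γ).aemeasurable.mul hdm
        · exact fun s => Finset.aemeasurable_fun_sum _ fun γ _ => (hindm s γ).aemeasurable.mul hdm
    _ = ∫⁻ v in Bj, (Nat.card (K.grp i) : ENNReal) * K.density j v := by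
        refine lintegral_congr_ae ((ae_restrict_iff' hBjm).2 ?_)
        filter_upwards [measure_eq_zero_iff_ae_notMem.1 hbad] with v hv hvB
        rw [hcount v hv hvB]
    _ = _ := lintegral_const_mul' _ _ (ENNReal.natCast_ne_top _)

end KahlerOrbifold

namespace ComplexOrbifold

variable {n : ℕ} {ι X : Type*} [TopologicalSpace X] {A : ComplexOrbifold n ι X}

/-- The part of `X` whose preimage in its chart is `Q.piece k`. -/
def CompactCover.part (Q : A.CompactCover) (k : Fin Q.N) : Set X :=
  (A.proj (Q.chart k) '' Q.core k) \ ⋃ j < k, A.proj (Q.chart j) '' Q.core j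

theorem CompactCover.core_subset (Q : A.CompactCover) (k : Fin Q.N) :
    Q.core k ⊆ A.dom (Q.chart k) := by
  obtain ⟨C, -, h1, h2⟩ := Q.relCompact k
  exact h1.trans h2

theorem CompactCover.piece_eq (Q : A.CompactCover) (k : Fin Q.N) :
    Q.piece k = A.dom (Q.chart k) ∩ A.proj (Q.chart k) ⁻¹' Q.part k := by
  ext u
  simp only [CompactCover.piece, CompactCover.part, mem_inter_iff, mem_preimage, Set.mem_sdiff,
    mem_iUnion, not_exists, exists_prop, not_and]
  rfl

theorem CompactCover.part_subset (Q : A.CompactCover) (k : Fin Q.N) :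
    Q.part k ⊆ A.proj (Q.chart k) '' A.dom (Q.chart k) :=
  sdiff_subset.trans (image_mono (Q.core_subset k))

theorem CompactCover.measurableSet_part [MeasurableSpace X] [BorelSpace X] (Q : A.CompactCover)
    (k : Fin Q.N) : MeasurableSet (Q.part k) := by
  have h : ∀ j, MeasurableSet (A.proj (Q.chart j) '' Q.core j) := fun j =>
    (A.isOpen_image_proj _ (Q.isOpen_core j) (Q.core_subset j)).measurableSet
  exact (h k).diff (MeasurableSet.iUnion fun j => MeasurableSet.iUnion fun _ => h j)

theorem CompactCover.disjoint_part (Q : A.CompactCover) :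
    Pairwise (Function.onFun Disjoint Q.part) := by
  have h : ∀ j k, j < k → Disjoint (Q.part j) (Q.part k) := fun j k hjk =>
    disjoint_left.2 fun x hx hx' => hx'.2 (mem_iUnion₂.2 ⟨j, hjk, hx.1⟩)
  intro j k hjk
  rcases lt_or_gt_of_ne hjk with h1 | h1
  · exact h j k h1
  · exact (h k j h1).symm

theorem CompactCover.iUnion_part (Q : A.CompactCover) : ⋃ k, Q.part k = univ := by
  refine eq_univ_of_forall fun x => ?_
  classical
  have hex : ∃ k, x ∈ A.proj (Q.chart k) '' Q.core k := by
    obtain ⟨k, u, hu, hx⟩ := Q.cover x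
    exact ⟨k, u, hu, hx⟩
  obtain ⟨k, hk, hmin⟩ := WellFounded.has_min (wellFounded_lt (α := Fin Q.N))
    {k | x ∈ A.proj (Q.chart k) '' Q.core k} hex
  refine mem_iUnion.2 ⟨k, hk, fun hx => ?_⟩
  obtain ⟨j, hj, hxj⟩ := mem_iUnion₂.1 hx
  exact hmin j hxj hj

/-- The pieces are relatively compact in their charts. -/
theorem CompactCover.exists_compact_piece (Q : A.CompactCover) (k : Fin Q.N) :
    ∃ C, IsCompact C ∧ Q.piece k ⊆ C ∧ C ⊆ A.dom (Q.chart k) := by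
  obtain ⟨C, hC, h1, h2⟩ := Q.relCompact k
  -- a piece is saturated, so the translates of a compact set that contains the core are needed
  refine ⟨⋃ γ : A.grp (Q.chart k), A.groupLift (Q.chart k) γ '' C, ?_, ?_, ?_⟩
  · exact isCompact_iUnion fun γ => hC.image_of_continuousOn
      ((A.groupLift (Q.chart k) γ).continuousOn.mono h2)
  · rintro u ⟨hu, ⟨w, hw, hwu⟩, -⟩
    obtain ⟨γ, hγ, hγu⟩ := (A.fiber _ ⟨w, h2 (h1 hw)⟩ ⟨u, hu⟩).1 hwu
    refine mem_iUnion.2 ⟨⟨γ, hγ⟩, w, h1 hw, ?_⟩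
    rw [A.groupLift_apply _ γ ⟨w, h2 (h1 hw)⟩, hγu]
  · refine iUnion_subset fun γ => ?_
    rintro _ ⟨w, hw, rfl⟩
    exact (A.groupLift (Q.chart k) γ).map_source (h2 hw)

theorem CompactCover.measurableSet_piece (Q : A.CompactCover) (k : Fin Q.N) :
    MeasurableSet (Q.piece k) := by
  have hd := (A.isOpen_dom (Q.chart k)).measurableSet
  have h : ∀ j, MeasurableSet (A.dom (Q.chart k) ∩
      A.proj (Q.chart k) ⁻¹' (A.proj (Q.chart j) '' Q.core j)) := fun j =>
    ((A.continuousOn_proj _).isOpen_inter_preimage (A.isOpen_dom _)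
      (A.isOpen_image_proj _ (Q.isOpen_core j) (Q.core_subset j))).measurableSet
  have e : Q.piece k = (A.dom (Q.chart k) ∩
      A.proj (Q.chart k) ⁻¹' (A.proj (Q.chart k) '' Q.core k)) \ ⋃ j, ⋃ _ : j < k,
        (A.dom (Q.chart k) ∩ A.proj (Q.chart k) ⁻¹' (A.proj (Q.chart j) '' Q.core j)) := by
    rw [CompactCover.piece_eq, CompactCover.part]
    ext u
    simp only [mem_inter_iff, mem_preimage, Set.mem_sdiff, mem_iUnion, not_exists, not_and]
    tauto
  rw [e]
  exact (h k).diff (MeasurableSet.iUnion fun j => MeasurableSet.iUnion fun _ => h j)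

end ComplexOrbifold

namespace KahlerOrbifold

variable {n : ℕ} {ι X : Type*} [TopologicalSpace X] (K : KahlerOrbifold n ι X)

theorem card_grp_ne_zero (i : ι) : (Nat.card (K.grp i) : ENNReal) ≠ 0 := by
  simpa using Nat.card_pos.ne'

theorem setLIntegral_density_piece_lt_top [CompactSpace X] (k : Fin K.compactCover.N) :
    ∫⁻ u in K.compactCover.piece k, K.density (K.compactCover.chart k) u < ⊤ := by
  obtain ⟨C, hC, hSC, hCd⟩ := K.compactCover.exists_compact_piece k
  obtain ⟨M, hM⟩ := hC.exists_bound_of_continuousOn ((K.continuousOn_volDensity _).mono hCd)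
  refine setLIntegral_lt_top_of_le_nnreal ((measure_mono hSC).trans_lt hC.measure_lt_top).ne
    ⟨M.toNNReal, fun u hu => ?_⟩
  exact ENNReal.ofReal_le_ofReal ((le_abs_self _).trans (hM u (hSC hu)))

section Borel

variable [MeasurableSpace X] [BorelSpace X]

/-- The Riemannian measure on the image of chart `i`. -/
def chartMeasure (i : ι) : Measure X :=
  (Nat.card (K.grp i) : ENNReal)⁻¹ •
    ((volume.restrict (K.dom i)).withDensity (K.density i)).map (K.proj i)

theorem aemeasurable_proj (i : ι) :
    AEMeasurable (K.proj i) ((volume.restrict (K.dom i)).withDensity (K.density i)) :=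
  ((K.continuousOn_proj i).aemeasurable (K.measurableSet_dom i)).mono_ac
    (withDensity_absolutelyContinuous _ _)

theorem chartMeasure_apply (i : ι) {B : Set X} (hB : MeasurableSet B) : K.chartMeasure i B =
    (Nat.card (K.grp i) : ENNReal)⁻¹ * ∫⁻ u in K.dom i ∩ K.proj i ⁻¹' B, K.density i u := by
  rw [chartMeasure, Measure.smul_apply, Measure.map_apply_of_aemeasurable (K.aemeasurable_proj i) hB,
    withDensity_apply', Measure.restrict_restrict' (K.measurableSet_dom i), inter_comm, smul_eq_mul]

/-- The measures of two charts agree on the intersection of their images. -/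
theorem chartMeasure_eq (i j : ι) {B : Set X} (hB : MeasurableSet B)
    (hBi : B ⊆ K.proj i '' K.dom i) (hBj : B ⊆ K.proj j '' K.dom j) :
    K.chartMeasure i B = K.chartMeasure j B := by
  have h := K.card_mul_setLIntegral_density i j hB hBi hBj
  have hi := K.card_grp_ne_zero i
  have hj := K.card_grp_ne_zero j
  have hi' : (Nat.card (K.grp i) : ENNReal) ≠ ⊤ := ENNReal.natCast_ne_top _
  have hj' : (Nat.card (K.grp j) : ENNReal) ≠ ⊤ := ENNReal.natCast_ne_top _
  rw [chartMeasure_apply _ _ hB, chartMeasure_apply _ _ hB]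
  set I := ∫⁻ u in K.dom i ∩ K.proj i ⁻¹' B, K.density i u
  set J := ∫⁻ u in K.dom j ∩ K.proj j ⁻¹' B, K.density j u
  set a := (Nat.card (K.grp i) : ENNReal)
  set b := (Nat.card (K.grp j) : ENNReal)
  calc a⁻¹ * I = a⁻¹ * (b⁻¹ * b) * I := by rw [ENNReal.inv_mul_cancel hj hj', mul_one]
    _ = a⁻¹ * b⁻¹ * (b * I) := by ring
    _ = (a⁻¹ * a) * (b⁻¹ * J) := by rw [h]; ring
    _ = b⁻¹ * J := by rw [ENNReal.inv_mul_cancel hi hi', one_mul]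

theorem setIntegral_chartMeasure (i : ι) {B : Set X} (hB : MeasurableSet B) {F : X → ℝ}
    (hF : Continuous F) : ∫ x in B, F x ∂K.chartMeasure i =
      (Nat.card (K.grp i) : ℝ)⁻¹ * ∫ u in K.dom i ∩ K.proj i ⁻¹' B,
        F (K.proj i u) * BilinField.volDensity (K.metric i) u := by
  have hBm := K.measurableSet_preimage_proj i hB
  have h1 : ((volume.restrict (K.dom i)).withDensity (K.density i)).restrict (K.proj i ⁻¹' B) =
      (volume.restrict (K.dom i ∩ K.proj i ⁻¹' B)).withDensity (K.density i) := by
    rw [restrict_withDensity', Measure.restrict_restrict' (K.measurableSet_dom i), inter_comm]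
  rw [chartMeasure, Measure.restrict_smul, integral_smul_measure,
    setIntegral_map hB hF.aestronglyMeasurable (K.aemeasurable_proj i), h1,
    integral_withDensity_eq_integral_toReal_smul₀
      ((K.aemeasurable_density i).mono_measure (Measure.restrict_mono inter_subset_left le_rfl))
      (ae_of_all _ fun u => ENNReal.ofReal_lt_top)]
  simp only [smul_eq_mul, ENNReal.toReal_inv, ENNReal.toReal_natCast]
  congr 1
  refine setIntegral_congr_fun hBm fun u hu => ?_
  simp only [density, ENNReal.toReal_ofReal ((K.isMetricOn i).volDensity_pos hu.1).le]
  ring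

variable [CompactSpace X]

/-- The Riemannian measure of a compact Kähler orbifold, glued from the measures of the charts along
the partition that defines the orbifold integral; by `riemannianMeasure_apply` it does not depend on
that partition. -/
def riemannianMeasure : Measure X :=
  ∑ k, (K.chartMeasure (K.compactCover.chart k)).restrict (K.compactCover.part k)

theorem riemannianMeasure_apply (i : ι) {B : Set X} (hB : MeasurableSet B)
    (hBi : B ⊆ K.proj i '' K.dom i) : K.riemannianMeasure B = K.chartMeasure i B := by
  set Q := K.compactCover
  have h1 : ∀ k, (K.chartMeasure (Q.chart k)).restrict (Q.part k) B =
      K.chartMeasure i (B ∩ Q.part k) := fun k => by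
    rw [Measure.restrict_apply hB]
    exact K.chartMeasure_eq _ _ (hB.inter (Q.measurableSet_part k))
      (inter_subset_right.trans (Q.part_subset k)) (inter_subset_left.trans hBi)
  rw [riemannianMeasure, Measure.finsetSum_apply, Finset.sum_congr rfl fun k _ => h1 k,
    ← tsum_fintype (L := .unconditional _), ← measure_iUnion, ← inter_iUnion, Q.iUnion_part,
    inter_univ]
  · exact fun j k hjk => (Q.disjoint_part hjk).mono inter_subset_right inter_subset_right
  · exact fun k => hB.inter (Q.measurableSet_part k)

instance isFiniteMeasure_riemannianMeasure : IsFiniteMeasure K.riemannianMeasure := by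
  refine ⟨?_⟩
  rw [riemannianMeasure, Measure.finsetSum_apply]
  refine ENNReal.sum_lt_top.2 fun k _ => ?_
  rw [Measure.restrict_apply_univ, K.chartMeasure_apply _ (K.compactCover.measurableSet_part k),
    ← K.compactCover.piece_eq]
  exact ENNReal.mul_lt_top (ENNReal.inv_lt_top.2 (pos_iff_ne_zero.2 (K.card_grp_ne_zero _)))
    (K.setLIntegral_density_piece_lt_top k)

theorem integrable_riemannianMeasure {F : X → ℝ} (hF : Continuous F) :
    Integrable F K.riemannianMeasure :=
  hF.integrable_of_hasCompactSupport (HasCompactSupport.of_compactSpace F)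

/-- The orbifold integral of a continuous function on `X` is its integral for the Riemannian
measure. -/
theorem integral_eq_integral_riemannianMeasure {F : X → ℝ} (hF : Continuous F)
    {f : ι → Cn n → ℝ} (hf : ∀ i, ∀ u ∈ K.dom i, f i u = F (K.proj i u)) :
    K.integral f = ∫ x, F x ∂K.riemannianMeasure := by
  have h1 := K.integrable_riemannianMeasure hF
  rw [riemannianMeasure, integrable_finsetSum_measure] at h1
  rw [riemannianMeasure, integral_finsetSum_measure h1, KahlerOrbifold.integral]
  refine Finset.sum_congr rfl fun k _ => ?_
  rw [K.setIntegral_chartMeasure _ (K.compactCover.measurableSet_part k) hF,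
    ← K.compactCover.piece_eq]
  congr 1
  refine setIntegral_congr_fun (K.compactCover.measurableSet_piece k) fun u hu => ?_
  simp only [hf _ u hu.1]

/-- The integral over `X` of a function supported in the image of chart `i` can be computed in
that chart. -/
theorem integral_riemannianMeasure_eq_of_support (i : ι) {F : X → ℝ} (hF : Continuous F)
    (h0 : ∀ x, x ∉ K.proj i '' K.dom i → F x = 0) :
    ∫ x, F x ∂K.riemannianMeasure = (Nat.card (K.grp i) : ℝ)⁻¹ * ∫ u in K.dom i,
        F (K.proj i u) * BilinField.volDensity (K.metric i) u := by
  have hW : MeasurableSet (K.proj i '' K.dom i) :=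
    (K.isOpen_image_proj i (K.isOpen_dom i) subset_rfl).measurableSet
  have h1 : K.riemannianMeasure.restrict (K.proj i '' K.dom i) =
      (K.chartMeasure i).restrict (K.proj i '' K.dom i) := by
    ext B hB
    rw [Measure.restrict_apply hB, Measure.restrict_apply hB]
    exact K.riemannianMeasure_apply i (hB.inter hW) inter_subset_right
  rw [← setIntegral_eq_integral_of_forall_compl_eq_zero h0, h1,
    K.setIntegral_chartMeasure i hW hF, inter_eq_left.2 (subset_preimage_image _ _)]

end Borel

end KahlerOrbifold

/-! ### Partitions of unity and Green's formula on a compact Kähler orbifold -/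

namespace ComplexOrbifold

variable {n : ℕ} {ι X : Type*} [TopologicalSpace X] (A : ComplexOrbifold n ι X)

/-- A function on `X` is `C¹` if its expressions in the charts are. -/
def IsC1 (F : X → ℝ) : Prop := ∀ i, ContDiffOn ℝ 1 (fun u => F (A.proj i u)) (A.dom i)

variable {A} in
theorem IsC1.continuous {F : X → ℝ} (hF : A.IsC1 F) : Continuous F :=
  A.continuous_of_continuousOn_charts fun i => (hF i).continuousOn

/-- Expressions in the charts that agree under all lifts of the identity define a function on
`X`. -/
theorem exists_descend {f : ι → Cn n → ℝ} (hf : ∀ i j ψ, A.IsLift id i j ψ → ∀ z ∈ ψ.source,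
    f i z = f j (ψ z)) : ∃ F : X → ℝ, ∀ i, ∀ u ∈ A.dom i, f i u = F (A.proj i u) := by
  choose c w hw hx using A.cover
  refine ⟨fun x => f (c x) (w x), fun i u hu => ?_⟩
  obtain ⟨ψ, hus, hψu, hs, ht, hd, hd', hp⟩ := A.compat i (c (A.proj i u)) u hu _ (hw _) (hx _).symm
  rw [hf i _ ψ ⟨hs, ht, hd, hd', hp⟩ u hus, hψu]

/-- A `C¹` bump function on `X`, supported in the image of a compact subset of a chart. It is the
sum of a bump function in the chart over the orbits of the group. -/
theorem exists_bump [T2Space X] (i : ι) {u₀ : Cn n} (hu₀ : u₀ ∈ A.dom i) :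
    ∃ (ρ : X → ℝ) (C : Set (Cn n)), IsCompact C ∧ C ⊆ A.dom i ∧ A.IsC1 ρ ∧ (∀ x, 0 ≤ ρ x) ∧
      0 < ρ (A.proj i u₀) ∧ (∀ x, x ∉ A.proj i '' C → ρ x = 0) ∧
      ∀ u ∈ A.dom i, u ∉ C → ρ (A.proj i u) = 0 := by
  classical
  have := Fintype.ofFinite (A.grp i)
  obtain ⟨ε, hε, hsub⟩ := Metric.isOpen_iff.1 (A.isOpen_dom i) u₀ hu₀
  let β : ContDiffBump u₀ := ⟨ε / 3, ε / 2, by linarith, by linarith⟩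
  have hβ : tsupport β ⊆ A.dom i := by
    rw [β.tsupport_eq]
    exact (Metric.closedBall_subset_ball (by change ε / 2 < ε; linarith)).trans hsub
  set L : A.grp i → OpenPartialHomeomorph (Cn n) (Cn n) := fun γ => A.groupLift i γ with hL
  set C : Set (Cn n) := ⋃ γ, L γ '' tsupport β with hC
  have hCc : IsCompact C := isCompact_iUnion fun γ =>
    IsCompact.image_of_continuousOn β.hasCompactSupport ((L γ).continuousOn.mono hβ)
  have hCd : C ⊆ A.dom i := by
    refine iUnion_subset fun γ => ?_
    rintro _ ⟨w, hw, rfl⟩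
    exact (L γ).map_source (hβ hw)
  -- the sum over the orbit does not depend on the point chosen in the fibre
  let ρ : X → ℝ := fun x => if h : ∃ u, u ∈ A.dom i ∧ A.proj i u = x then
    ∑ γ, β (L γ h.choose) else 0
  have hρ : ∀ u ∈ A.dom i, ρ (A.proj i u) = ∑ γ, β (L γ u) := by
    intro u hu
    have h : ∃ w, w ∈ A.dom i ∧ A.proj i w = A.proj i u := ⟨u, hu, rfl⟩
    obtain ⟨δ, hδ, hδu⟩ := (A.fiber i ⟨u, hu⟩ ⟨_, h.choose_spec.1⟩).1 h.choose_spec.2.symm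
    simp only [ρ, dif_pos h]
    refine Fintype.sum_equiv (Equiv.mulRight ⟨δ, hδ⟩) _ _ fun γ => ?_
    rw [hL]
    dsimp only
    rw [A.groupLift_apply i _ ⟨_, h.choose_spec.1⟩, A.groupLift_apply i _ ⟨u, hu⟩, ← hδu]
    rfl
  have hC0 : ∀ u ∈ A.dom i, u ∉ C → ρ (A.proj i u) = 0 := by
    intro u hu huC
    rw [hρ u hu]
    refine Finset.sum_eq_zero fun γ _ => by_contra fun hne => huC ?_
    have h1 : L γ u ∈ tsupport β := subset_tsupport _ hne
    refine mem_iUnion.2 ⟨γ⁻¹, L γ u, h1, ?_⟩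
    have h2 : L γ u = (γ : A.dom i ≃ₜ A.dom i) ⟨u, hu⟩ := A.groupLift_apply i γ ⟨u, hu⟩
    rw [h2, hL]
    dsimp only
    rw [A.groupLift_apply i]
    change ((γ : A.dom i ≃ₜ A.dom i).symm ((γ : A.dom i ≃ₜ A.dom i) ⟨u, hu⟩) : Cn n) = u
    simp
  have hX0 : ∀ x, x ∉ A.proj i '' C → ρ x = 0 := by
    intro x hx
    by_cases h : ∃ u, u ∈ A.dom i ∧ A.proj i u = x
    · obtain ⟨u, hu, rfl⟩ := h
      exact hC0 u hu fun hcon => hx ⟨u, hcon, rfl⟩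
    · simp only [ρ, dif_neg h]
  have hdiff : ∀ γ, ContDiffOn ℝ 1 (L γ) (A.dom i) := fun γ =>
    (A.isLift_groupLift i γ.2).2.2.1.contDiffOn_one_of_complex (A.isOpen_dom i)
  refine ⟨ρ, C, hCc, hCd, fun j v hv => ContDiffAt.contDiffWithinAt ?_, fun x => ?_, ?_, hX0, hC0⟩
  · by_cases hvC : A.proj j v ∈ A.proj i '' C
    · obtain ⟨u, huC, huv⟩ := hvC
      obtain ⟨ψ, hvs, hψv, hs, ht, hd, hd', hp⟩ := A.compat j i v hv u (hCd huC) huv.symm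
      have h1 : (fun w => ρ (A.proj j w)) =ᶠ[𝓝 v] fun w => ∑ γ, β (L γ (ψ w)) := by
        filter_upwards [ψ.open_source.mem_nhds hvs] with w hw
        rw [← hp w hw, hρ _ (ht (ψ.map_source hw))]
      refine ContDiffAt.congr_of_eventuallyEq (ContDiffAt.sum fun γ _ => ?_) h1
      have h2 : ContDiffAt ℝ 1 ψ v :=
        (hd.contDiffOn_one_of_complex ψ.open_source).contDiffAt (ψ.open_source.mem_nhds hvs)
      have h3 : ContDiffAt ℝ 1 (L γ) (ψ v) :=
        (hdiff γ).contDiffAt ((A.isOpen_dom i).mem_nhds (by rw [hψv]; exact hCd huC))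
      exact β.contDiff.contDiffAt.comp v (h3.comp v h2)
    · have hclosed : IsClosed (A.proj i '' C) :=
        (hCc.image_of_continuousOn ((A.continuousOn_proj i).mono hCd)).isClosed
      have h1 : ∀ᶠ w in 𝓝 v, A.proj j w ∉ A.proj i '' C :=
        ((A.continuousOn_proj j).continuousAt ((A.isOpen_dom j).mem_nhds hv)).eventually
          (hclosed.isOpen_compl.mem_nhds hvC)
      refine (contDiffAt_const (c := (0 : ℝ))).congr_of_eventuallyEq ?_
      filter_upwards [h1] with w hw using hX0 _ hw
  · simp only [ρ]
    split_ifs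
    · exact Finset.sum_nonneg fun γ _ => β.nonneg
    · exact le_rfl
  · rw [hρ u₀ hu₀]
    refine Finset.sum_pos' (fun γ _ => β.nonneg) ⟨1, Finset.mem_univ _, ?_⟩
    have : L 1 u₀ = u₀ := A.groupLift_apply i 1 ⟨u₀, hu₀⟩
    rw [this]
    exact β.pos_of_mem_ball (Metric.mem_ball_self β.rOut_pos)

/-- A `C¹` partition of unity subordinate to charts. -/
theorem exists_partition [T2Space X] [CompactSpace X] :
    ∃ (t : Finset X) (c : X → ι) (C : X → Set (Cn n)) (σ : X → X → ℝ),
      (∀ y, IsCompact (C y)) ∧ (∀ y, C y ⊆ A.dom (c y)) ∧ (∀ y, A.IsC1 (σ y)) ∧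
      (∀ y x, x ∉ A.proj (c y) '' C y → σ y x = 0) ∧
      (∀ y, ∀ u ∈ A.dom (c y), u ∉ C y → σ y (A.proj (c y) u) = 0) ∧
      ∀ x, ∑ y ∈ t, σ y x = 1 := by
  choose c w hw hx using A.cover
  choose ρ C hC hCd hρ1 hρ0 hρpos hρX hρC using fun y => A.exists_bump (c y) (hw y)
  obtain ⟨t, ht⟩ := isCompact_univ.elim_finite_subcover (fun y => {x | 0 < ρ y x})
    (fun y => isOpen_lt continuous_const (hρ1 y).continuous)
    (fun x _ => mem_iUnion.2 ⟨x, by simpa [hx] using hρpos x⟩)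
  have hR : ∀ x, 0 < ∑ y ∈ t, ρ y x := by
    intro x
    obtain ⟨y, hy, hxy⟩ := mem_iUnion₂.1 (ht (mem_univ x))
    exact Finset.sum_pos' (fun y _ => hρ0 y x) ⟨y, hy, hxy⟩
  refine ⟨t, c, C, fun y x => ρ y x / ∑ z ∈ t, ρ z x, hC, hCd, fun y i => ?_, fun y x hxy => ?_,
    fun y u hu huC => ?_, fun x => ?_⟩
  · exact (hρ1 y i).div (ContDiffOn.sum fun z _ => hρ1 z i) fun u _ => (hR _).ne'
  · simp [hρX y x hxy]
  · simp [hρC y u hu huC]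
  · rw [← Finset.sum_div, div_self (hR x).ne']

end ComplexOrbifold

namespace KahlerOrbifold

variable {n : ℕ} {ι X : Type*} [TopologicalSpace X] (K : KahlerOrbifold n ι X)

/-- The Laplacian of a function on `X`, in charts. -/
def lap (l : X → ℝ) (i : ι) (u : Cn n) : ℝ :=
  BilinField.laplacian (K.metric i) (fun w => l (K.proj i w)) u

/-- The pairing `⟨d f, d l⟩` of functions on `X`, in charts. -/
def gradPairing (f l : X → ℝ) (i : ι) (u : Cn n) : ℝ :=
  fderiv ℝ (fun w => f (K.proj i w)) u
    (BilinField.grad (K.metric i) (fun w => l (K.proj i w)) u)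

variable {K} {f l : X → ℝ}

theorem exists_lap_eq (hl : ∀ i, ContDiffOn ℝ ∞ (fun u => l (K.proj i u)) (K.dom i)) :
    ∃ F : X → ℝ, Continuous F ∧ ∀ i, ∀ u ∈ K.dom i, K.lap l i u = F (K.proj i u) := by
  obtain ⟨F, hF⟩ := K.exists_descend (f := K.lap l) fun i j ψ hψ z hz =>
    (K.isIsometry_of_isLift hψ).laplacian_eq (K.isMetricOn j) (K.isMetricOn i) (K.isOpen_dom i)
      (K.isOpen_dom j) hψ.1 hψ.2.1 (fun w hw => by rw [hψ.2.2.2.2 w hw]; rfl) (hl i) (hl j) hz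
  refine ⟨F, K.continuous_of_continuousOn_charts fun i => ?_, hF⟩
  exact ((K.isMetricOn i).continuousOn_laplacian (K.isOpen_dom i) (hl i)).congr fun u hu =>
    (hF i u hu).symm

theorem exists_gradPairing_eq (hf : K.IsC1 f)
    (hl : ∀ i, ContDiffOn ℝ ∞ (fun u => l (K.proj i u)) (K.dom i)) :
    ∃ F : X → ℝ, Continuous F ∧ ∀ i, ∀ u ∈ K.dom i, K.gradPairing f l i u = F (K.proj i u) := by
  obtain ⟨F, hF⟩ := K.exists_descend (f := K.gradPairing f l) fun i j ψ hψ z hz => by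
    have hiso := K.isIsometry_of_isLift hψ
    have hz2 := (K.isOpen_dom j).mem_nhds (hψ.2.1 (ψ.map_source hz))
    rw [gradPairing, hiso.fderiv_eq (f₂ := fun w => f (K.proj j w))
      (fun w hw => by rw [hψ.2.2.2.2 w hw]; rfl) hz
      (((hf j).contDiffAt hz2).differentiableAt one_ne_zero),
      hiso.fderiv_grad (K.isMetricOn j) (K.isMetricOn i) hψ.1 hψ.2.1
        (f₂ := fun w => l (K.proj j w)) (fun w hw => by rw [hψ.2.2.2.2 w hw]; rfl) hz
      (((hl j).contDiffAt hz2).differentiableAt (by simp))]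
    rfl
  refine ⟨F, K.continuous_of_continuousOn_charts fun i => ?_, hF⟩
  refine ContinuousOn.congr (f := K.gradPairing f l i) ?_ fun u hu => (hF i u hu).symm
  exact ((hf i).continuousOn_fderiv_of_isOpen (K.isOpen_dom i) le_rfl).clm_apply
    ((K.isMetricOn i).contDiffOn_grad (K.isOpen_dom i) (hl i)).continuousOn

/-- Green's formula on a compact Kähler orbifold. For a function supported in a chart the integrals
are computed there, and a partition of unity reduces to that case. -/
theorem integral_mul_lap [T2Space X] [CompactSpace X] (hf : K.IsC1 f)
    (hl : ∀ i, ContDiffOn ℝ ∞ (fun u => l (K.proj i u)) (K.dom i)) :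
    K.integral (fun i u => f (K.proj i u) * K.lap l i u) = K.integral (K.gradPairing f l) := by
  let _ : MeasurableSpace X := borel X
  have : BorelSpace X := ⟨rfl⟩
  obtain ⟨t, c, C, σ, hC, hCd, hσ1, hσX, hσC, hσsum⟩ := K.exists_partition
  obtain ⟨F, hFc, hF⟩ := exists_lap_eq hl
  have hσf : ∀ y, K.IsC1 fun x => σ y x * f x := fun y i => (hσ1 y i).mul (hf i)
  choose G hGc hG using fun y => exists_gradPairing_eq (hσf y) hl
  -- the `C¹` functions `σ_y f` sum to `f`
  have hGsum : ∀ i, ∀ u ∈ K.dom i, K.gradPairing f l i u = ∑ y ∈ t, G y (K.proj i u) := by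
    intro i u hu
    simp only [← hG _ i u hu, gradPairing]
    rw [← _root_.sum_apply, ← fderiv_fun_sum]
    · congr 2
      funext w
      rw [← Finset.sum_mul, hσsum, one_mul]
    · exact fun y _ => ((hσf y i).contDiffAt ((K.isOpen_dom i).mem_nhds hu)).differentiableAt
        one_ne_zero
  have hclosed : ∀ y, IsClosed (K.proj (c y) '' C y) := fun y =>
    ((hC y).image_of_continuousOn ((K.continuousOn_proj _).mono (hCd y))).isClosed
  -- `⟨d (σ_y f), d l⟩` is supported where `σ_y` is
  have hGX : ∀ y x, x ∉ K.proj (c y) '' C y → G y x = 0 := by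
    intro y x hx
    obtain ⟨i, u, hu, rfl⟩ := K.cover x
    have h1 : ∀ᶠ w in 𝓝 u, K.proj i w ∉ K.proj (c y) '' C y :=
      ((K.continuousOn_proj i).continuousAt ((K.isOpen_dom i).mem_nhds hu)).eventually
        ((hclosed y).isOpen_compl.mem_nhds hx)
    have h2 : (fun w => σ y (K.proj i w) * f (K.proj i w)) =ᶠ[𝓝 u] fun _ => 0 := by
      filter_upwards [h1] with w hw
      rw [hσX y _ hw, zero_mul]
    rw [← hG y i u hu, gradPairing, h2.fderiv_eq]
    simp
  have hchart : ∀ y, ∫ x, σ y x * f x * F x ∂K.riemannianMeasure =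
      ∫ x, G y x ∂K.riemannianMeasure := by
    intro y
    have hWC : ∀ x, x ∉ K.proj (c y) '' K.dom (c y) → x ∉ K.proj (c y) '' C y := fun x hx hcon =>
      hx (image_mono (hCd y) hcon)
    rw [K.integral_riemannianMeasure_eq_of_support (c y)
      (F := fun x => σ y x * f x * F x) ((hσf y).continuous.mul hFc)
      fun x hx => by rw [hσX y x (hWC x hx), zero_mul, zero_mul],
      K.integral_riemannianMeasure_eq_of_support (c y) (hGc y) fun x hx => hGX y x (hWC x hx)]
    congr 1
    -- extension by zero: outside the chart domain `proj` has no meaning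
    set χ : Cn n → ℝ := (K.dom (c y)).indicator
      fun u => σ y (K.proj (c y) u) * f (K.proj (c y) u) with hχ
    have hχeq : ∀ u ∈ K.dom (c y), χ u = σ y (K.proj (c y) u) * f (K.proj (c y) u) := fun u hu =>
      indicator_of_mem hu _
    have hχ0 : ∀ u, u ∉ C y → χ u = 0 := by
      intro u hu
      by_cases hud : u ∈ K.dom (c y)
      · rw [hχeq u hud, hσC y u hud hu, zero_mul]
      · exact indicator_of_notMem hud _
    have h := (K.isMetricOn (c y)).setIntegral_mul_laplacian (K.isOpen_dom _) (hl (c y))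
      ((hσf y (c y)).congr hχeq) (hC y) (hCd y) hχ0
    calc _ = _ := setIntegral_congr_fun (K.measurableSet_dom _) fun u hu => by
            simp only [← hF _ u hu, ← hχeq u hu]; rfl
      _ = _ := h
      _ = _ := setIntegral_congr_fun (K.measurableSet_dom _) fun u hu => by
            have h2 : χ =ᶠ[𝓝 u] fun u => σ y (K.proj (c y) u) * f (K.proj (c y) u) := by
              filter_upwards [(K.isOpen_dom _).mem_nhds hu] with w hw using hχeq w hw
            simp only [← hG y _ u hu, gradPairing, h2.fderiv_eq]
  rw [K.integral_eq_integral_riemannianMeasure (F := fun x => ∑ y ∈ t, σ y x * f x * F x)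
    (continuous_finsetSum _ fun y _ => (hσf y).continuous.mul hFc),
    K.integral_eq_integral_riemannianMeasure (F := fun x => ∑ y ∈ t, G y x)
    (continuous_finsetSum _ fun y _ => hGc y) hGsum, integral_finsetSum, integral_finsetSum]
  · exact Finset.sum_congr rfl fun y _ => hchart y
  · exact fun y _ => K.integrable_riemannianMeasure (hGc y)
  · exact fun y _ => K.integrable_riemannianMeasure ((hσf y).continuous.mul hFc)
  · intro i u hu
    rw [hF i u hu, ← Finset.sum_mul, ← Finset.sum_mul, hσsum, one_mul]

end KahlerOrbifold

/-! ### Calculus of orbifold integrals -/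

namespace KahlerOrbifold

variable {n : ℕ} {ι X : Type*} [TopologicalSpace X] (K : KahlerOrbifold n ι X)

/-- The expressions of an integrand in the charts are continuous. -/
def IsCont {Y : Type*} [TopologicalSpace Y] (f : ι → Cn n → Y) : Prop :=
  ∀ i, ContinuousOn (f i) (K.dom i)

namespace IsCont

variable {K} {f g : ι → Cn n → ℝ}

theorem const (c : ℝ) : K.IsCont fun _ _ => c := fun _ => continuousOn_const

theorem add (hf : K.IsCont f) (hg : K.IsCont g) : K.IsCont fun i u => f i u + g i u :=
  fun i => (hf i).add (hg i)

theorem sub (hf : K.IsCont f) (hg : K.IsCont g) : K.IsCont fun i u => f i u - g i u :=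
  fun i => (hf i).sub (hg i)

theorem mul (hf : K.IsCont f) (hg : K.IsCont g) : K.IsCont fun i u => f i u * g i u :=
  fun i => (hf i).mul (hg i)

theorem sum {J : Type*} {s : Finset J} {f : J → ι → Cn n → ℝ} (hf : ∀ j ∈ s, K.IsCont (f j)) :
    K.IsCont fun i u => ∑ j ∈ s, f j i u :=
  fun i => continuousOn_finsetSum _ fun j hj => hf j hj i

theorem congr (hf : K.IsCont f) (h : ∀ i, ∀ u ∈ K.dom i, g i u = f i u) : K.IsCont g :=
  fun i => (hf i).congr (h i)

end IsCont

variable [CompactSpace X]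

theorem integral_congr {f g : ι → Cn n → ℝ} (h : ∀ i, ∀ u ∈ K.dom i, f i u = g i u) :
    K.integral f = K.integral g := by
  unfold KahlerOrbifold.integral
  refine Finset.sum_congr rfl fun k _ => ?_
  congr 1
  refine setIntegral_congr_fun (K.compactCover.measurableSet_piece k) fun u hu => ?_
  simp only [h _ u hu.1]

/-- The values of `f` on the disjoint union of the pieces. -/
def onPieces {Y : Type*} (f : ι → Cn n → Y) (τ : Fin K.compactCover.N × Cn n) : Y :=
  f (K.compactCover.chart τ.1) τ.2

/-- The measure on the `k`-th piece that enters the orbifold integral. -/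
def pieceMeasure (k : Fin K.compactCover.N) : Measure (Cn n) :=
  (Nat.card (K.grp (K.compactCover.chart k)) : ENNReal)⁻¹ •
    (volume.restrict (K.compactCover.piece k)).withDensity (K.density (K.compactCover.chart k))

/-- The measure on the disjoint union of the pieces for which the orbifold integral is an
ordinary integral, also for integrands that are not known to descend to `X`. -/
def upperMeasure : Measure (Fin K.compactCover.N × Cn n) :=
  ∑ k, (K.pieceMeasure k).map (Prod.mk k)

instance (k : Fin K.compactCover.N) : IsFiniteMeasure (K.pieceMeasure k) := by
  refine ⟨?_⟩
  rw [pieceMeasure, Measure.smul_apply, withDensity_apply _ MeasurableSet.univ,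
    Measure.restrict_univ]
  exact ENNReal.mul_lt_top (ENNReal.inv_lt_top.2 (pos_iff_ne_zero.2 (K.card_grp_ne_zero _)))
    (K.setLIntegral_density_piece_lt_top k)

theorem pieceMeasure_absolutelyContinuous (k : Fin K.compactCover.N) :
    K.pieceMeasure k ≪ volume.restrict (K.compactCover.piece k) :=
  (withDensity_absolutelyContinuous _ _).smul_left _

variable {K}

theorem IsCont.aestronglyMeasurable_piece {Y : Type*} [NormedAddCommGroup Y]
    [SecondCountableTopology Y] {f : ι → Cn n → Y} (hf : K.IsCont f) (k : Fin K.compactCover.N) :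
    AEStronglyMeasurable (f (K.compactCover.chart k)) (K.pieceMeasure k) :=
  (((hf _).aestronglyMeasurable (K.measurableSet_dom _)).mono_measure
    (Measure.restrict_mono (fun _ hu => hu.1) le_rfl)).mono_ac
      (K.pieceMeasure_absolutelyContinuous k)

theorem IsCont.integrable_piece {f : ι → Cn n → ℝ} (hf : K.IsCont f) (k : Fin K.compactCover.N) :
    Integrable (f (K.compactCover.chart k)) (K.pieceMeasure k) := by
  obtain ⟨C, hC, hSC, hCd⟩ := K.compactCover.exists_compact_piece k
  obtain ⟨M, hM⟩ := hC.exists_bound_of_continuousOn ((hf _).mono hCd)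
  refine Integrable.of_bound (hf.aestronglyMeasurable_piece k) M ?_
  refine (K.pieceMeasure_absolutelyContinuous k).ae_le ?_
  exact (ae_restrict_iff' (K.compactCover.measurableSet_piece k)).2
    (ae_of_all _ fun u hu => hM u (hSC hu))

theorem IsCont.aestronglyMeasurable {Y : Type*} [NormedAddCommGroup Y]
    [SecondCountableTopology Y] {f : ι → Cn n → Y} (hf : K.IsCont f) :
    AEStronglyMeasurable (K.onPieces f) K.upperMeasure := by
  rw [upperMeasure, ← Measure.sum_fintype, aestronglyMeasurable_sum_measure_iff]
  intro k
  rw [(measurableEmbedding_prodMk_left k).aestronglyMeasurable_map_iff]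
  exact hf.aestronglyMeasurable_piece k

theorem IsCont.integrable {f : ι → Cn n → ℝ} (hf : K.IsCont f) :
    Integrable (K.onPieces f) K.upperMeasure := by
  rw [upperMeasure, integrable_finsetSum_measure]
  intro k _
  rw [(measurableEmbedding_prodMk_left k).integrable_map_iff]
  exact hf.integrable_piece k

theorem IsCont.integral_eq {f : ι → Cn n → ℝ} (hf : K.IsCont f) :
    K.integral f = ∫ τ, K.onPieces f τ ∂K.upperMeasure := by
  have h := hf.integrable
  rw [upperMeasure, integrable_finsetSum_measure] at h
  rw [upperMeasure, integral_finsetSum_measure h, KahlerOrbifold.integral]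
  refine Finset.sum_congr rfl fun k _ => ?_
  rw [(measurableEmbedding_prodMk_left k).integral_map, pieceMeasure, integral_smul_measure,
    integral_withDensity_eq_integral_toReal_smul₀
      ((K.aemeasurable_density _).mono_measure (Measure.restrict_mono (fun _ hu => hu.1) le_rfl))
      (ae_of_all _ fun u => ENNReal.ofReal_lt_top)]
  simp only [smul_eq_mul, ENNReal.toReal_inv, ENNReal.toReal_natCast]
  congr 1
  refine setIntegral_congr_fun (K.compactCover.measurableSet_piece k) fun u hu => ?_
  simp only [density, ENNReal.toReal_ofReal ((K.isMetricOn _).volDensity_pos hu.1).le, onPieces]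
  ring

section Linear

variable {f g : ι → Cn n → ℝ}

theorem integral_add (hf : K.IsCont f) (hg : K.IsCont g) :
    K.integral (fun i u => f i u + g i u) = K.integral f + K.integral g := by
  rw [(hf.add hg).integral_eq, hf.integral_eq, hg.integral_eq]
  exact MeasureTheory.integral_add hf.integrable hg.integrable

theorem integral_sub (hf : K.IsCont f) (hg : K.IsCont g) :
    K.integral (fun i u => f i u - g i u) = K.integral f - K.integral g := by
  rw [(hf.sub hg).integral_eq, hf.integral_eq, hg.integral_eq]
  exact MeasureTheory.integral_sub hf.integrable hg.integrable

theorem integral_const_mul (c : ℝ) (hf : K.IsCont f) :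
    K.integral (fun i u => c * f i u) = c * K.integral f := by
  rw [((IsCont.const c).mul hf).integral_eq, hf.integral_eq]
  exact MeasureTheory.integral_const_mul c _

theorem integral_sum {J : Type*} {s : Finset J} {f : J → ι → Cn n → ℝ}
    (hf : ∀ j ∈ s, K.IsCont (f j)) :
    K.integral (fun i u => ∑ j ∈ s, f j i u) = ∑ j ∈ s, K.integral (f j) := by
  rw [(IsCont.sum hf).integral_eq, Finset.sum_congr rfl fun j hj => (hf j hj).integral_eq]
  exact integral_finsetSum s fun j hj => (hf j hj).integrable

end Linear

theorem integral_pos [Nonempty X] {f : ι → Cn n → ℝ} (hf : K.IsCont f)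
    (hpos : ∀ i, ∀ u ∈ K.dom i, 0 < f i u) : 0 < K.integral f := by
  set Q := K.compactCover
  -- the first nonempty core is contained in its piece
  obtain ⟨k, hk, hmin⟩ := WellFounded.has_min (wellFounded_lt (α := Fin Q.N))
    {k | (Q.core k).Nonempty} (by
      obtain ⟨k, u, hu, -⟩ := Q.cover (Classical.arbitrary X)
      exact ⟨k, u, hu⟩)
  have hsub : Q.core k ⊆ Q.piece k := by
    intro u hu
    refine ⟨Q.core_subset k hu, ⟨u, hu, rfl⟩, fun j hj => ?_⟩
    rintro ⟨w, hw, -⟩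
    exact hmin j ⟨w, hw⟩ hj
  have hfpos : ∀ j, ∀ u ∈ Q.piece j, 0 < f (Q.chart j) u *
      BilinField.volDensity (K.metric (Q.chart j)) u := fun j u hu =>
    mul_pos (hpos _ u hu.1) ((K.isMetricOn _).volDensity_pos hu.1)
  have hcard : ∀ j, 0 < (Nat.card (K.grp (Q.chart j)) : ℝ)⁻¹ := fun j =>
    inv_pos.2 (Nat.cast_pos.2 Nat.card_pos)
  have hint : IntegrableOn (fun u => f (Q.chart k) u *
      BilinField.volDensity (K.metric (Q.chart k)) u) (Q.piece k) := by
    obtain ⟨C, hC, hSC, hCd⟩ := Q.exists_compact_piece k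
    exact ((((hf _).mul (K.continuousOn_volDensity _)).mono hCd).integrableOn_compact hC).mono_set
      hSC
  refine Finset.sum_pos' (fun j _ => mul_nonneg (hcard j).le
    (setIntegral_nonneg (Q.measurableSet_piece j) fun u hu => (hfpos j u hu).le))
    ⟨k, Finset.mem_univ _, mul_pos (hcard k) ?_⟩
  rw [setIntegral_pos_iff_support_of_nonneg_ae
    ((ae_restrict_iff' (Q.measurableSet_piece k)).2 (ae_of_all _ fun u hu => (hfpos k u hu).le))
    hint]
  refine ((Q.isOpen_core k).measure_pos volume hk).trans_le (measure_mono fun u hu => ?_)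
  exact ⟨(hfpos k u (hsub hu)).ne', hsub hu⟩

namespace HamiltonianAction

variable {r : ℕ} [MulAction (Torus r) X] [ContinuousSMul (Torus r) X] (H : K.HamiltonianAction r)

omit [CompactSpace X] in
theorem continuous_moment : Continuous H.moment :=
  K.continuous_of_continuousOn_charts fun i => (H.moment_smooth i).continuousOn

theorem isCompact_polytope : IsCompact H.polytope := isCompact_range H.continuous_moment

omit [CompactSpace X] in
theorem mu_mem_polytope (i : ι) (u : Cn n) : H.mu i u ∈ H.polytope := ⟨_, rfl⟩

omit [CompactSpace X] in
theorem isCont_mu : K.IsCont H.mu := fun i => (H.moment_smooth i).continuousOn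

omit [CompactSpace X] in
theorem isCont_comp_mu {φ : (Fin r → ℝ) → ℝ} (hφ : ContinuousOn φ H.polytope) :
    K.IsCont fun i u => φ (H.mu i u) :=
  fun i => hφ.comp (H.isCont_mu i) fun u _ => H.mu_mem_polytope i u

theorem integral_mul_comp_mu {φ : (Fin r → ℝ) → ℝ} {f : ι → Cn n → ℝ} (hf : K.IsCont f)
    (hφ : ContinuousOn φ H.polytope) : K.integral (fun i u => f i u * φ (H.mu i u)) =
      ∫ τ, K.onPieces f τ • φ (K.onPieces H.mu τ) ∂K.upperMeasure :=
  (hf.mul (H.isCont_comp_mu hφ)).integral_eq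

/-- Smooth dependence on parameters of integrals of functions of the momentum map. -/
theorem contDiffOn_integral {Q : Type} [NormedAddCommGroup Q] [NormedSpace ℝ Q]
    {Φ : Q × (Fin r → ℝ) → ℝ} {Ω : Set (Q × (Fin r → ℝ))} (hΩ : IsOpen Ω) {m : ℕ}
    (hΦ : ContDiffOn ℝ m Φ Ω) {U : Set Q} (hU : IsOpen U)
    (hq : ∀ q ∈ U, ∀ x ∈ H.polytope, (q, x) ∈ Ω) {f : ι → Cn n → ℝ} (hf : K.IsCont f) :
    ContDiffOn ℝ m (fun q => K.integral fun i u => f i u * Φ (q, H.mu i u)) U := by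
  refine (contDiffOn_integral_smul_comp H.isCompact_polytope
    H.isCont_mu.aestronglyMeasurable.aemeasurable
    (ae_of_all _ fun τ => H.mu_mem_polytope _ _) hf.integrable hΩ hU hq m hΦ).congr fun q hqU => ?_
  exact H.integral_mul_comp_mu (φ := fun x => Φ (q, x)) hf
    (hΦ.continuousOn.comp (by fun_prop) fun x hx => hq q hqU x hx)

/-- Differentiation under the orbifold integral along a curve of functions of the momentum map. -/
theorem hasDerivAt_integral {Φ : ℝ × (Fin r → ℝ) → ℝ} {Φ' : (Fin r → ℝ) → ℝ}
    {Ω : Set (ℝ × (Fin r → ℝ))} (hΩ : IsOpen Ω) (hΦ : ContDiffOn ℝ 1 Φ Ω)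
    (hq : ∀ x ∈ H.polytope, ((0 : ℝ), x) ∈ Ω)
    (hd : ∀ x ∈ H.polytope, HasDerivAt (fun t => Φ (t, x)) (Φ' x) 0)
    {f : ι → Cn n → ℝ} (hf : K.IsCont f) :
    HasDerivAt (fun t => K.integral fun i u => f i u * Φ (t, H.mu i u))
      (K.integral fun i u => f i u * Φ' (H.mu i u)) 0 := by
  have hx := H.isCont_mu.aestronglyMeasurable.aemeasurable
  have hxP : ∀ᵐ τ ∂K.upperMeasure, K.onPieces H.mu τ ∈ H.polytope :=
    ae_of_all _ fun τ => H.mu_mem_polytope _ _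
  have h1 := hasFDerivAt_integral_smul_comp H.isCompact_polytope hx hxP hf.integrable hΩ hΦ hq
  have hΦ' : ∀ x ∈ H.polytope, (fderiv ℝ Φ ((0 : ℝ), x)).comp (.inl ℝ ℝ (Fin r → ℝ)) 1 = Φ' x := by
    intro x hx
    have h2 : HasFDerivAt Φ (fderiv ℝ Φ ((0 : ℝ), x)) ((0 : ℝ), x) :=
      ((hΦ.differentiableOn one_ne_zero).differentiableAt (hΩ.mem_nhds (hq x hx))).hasFDerivAt
    have h3 : HasDerivAt (fun t : ℝ => (t, x)) ((1 : ℝ), (0 : Fin r → ℝ)) 0 :=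
      (hasDerivAt_id (0 : ℝ)).prodMk (hasDerivAt_const _ _)
    simpa using (h2.comp_hasDerivAt (0 : ℝ) h3).unique (hd x hx)
  have hcl : ContinuousOn (fun x => (fderiv ℝ Φ ((0 : ℝ), x)).comp (.inl ℝ ℝ (Fin r → ℝ)))
      H.polytope :=
    ((hΦ.continuousOn_fderiv_of_isOpen hΩ le_rfl).comp (by fun_prop) hq).clm_comp
      continuousOn_const
  have hc : ContinuousOn Φ' H.polytope :=
    (hcl.clm_apply (continuousOn_const (c := (1 : ℝ)))).congr fun x hx => (hΦ' x hx).symm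
  have h4 : K.integral (fun i u => f i u * Φ' (H.mu i u)) =
      (∫ τ, K.onPieces f τ • (fderiv ℝ Φ ((0 : ℝ), K.onPieces H.mu τ)).comp
        (.inl ℝ ℝ (Fin r → ℝ)) ∂K.upperMeasure) 1 := by
    rw [ContinuousLinearMap.integral_apply
      (integrable_smul_comp_of_ae_mem hcl H.isCompact_polytope hx hxP hf.integrable),
      H.integral_mul_comp_mu hf hc]
    refine integral_congr_ae (hxP.mono fun τ hτ => ?_)
    simp only [_root_.smul_apply, hΦ' _ hτ]
  rw [h4]
  refine h1.hasDerivAt.congr_of_eventuallyEq ?_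
  obtain ⟨_, hC⟩ := H.isCompact_polytope.exists_nhds_bound_of_continuousOn hΩ hΦ.continuousOn hq
  filter_upwards [hC] with t ht
  exact H.integral_mul_comp_mu (φ := fun x => Φ (t, x)) hf
    (hΦ.continuousOn.comp (by fun_prop) fun x hx => (ht x hx).1)

end HamiltonianAction

end KahlerOrbifold

/-! ### Weighted scalar curvature and the total weighted scalar curvature -/

namespace KahlerOrbifold

variable {n r : ℕ} {ι X : Type*} [TopologicalSpace X] {K : KahlerOrbifold n ι X}

theorem AffFun.val_add_smul (l h : AffFun r) (t : ℝ) (x : Fin r → ℝ) :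
    AffFun.val (l + t • h) x = l.val x + t * h.val x := by
  simp [AffFun.val, add_dotProduct, smul_dotProduct]
  ring

theorem AffFun.contDiff_val {m : WithTop ℕ∞} :
    ContDiff ℝ m (fun p : AffFun r × (Fin r → ℝ) => p.1.val p.2) := by
  unfold AffFun.val dotProduct
  fun_prop

theorem AffFun.contDiff_val_right {m : WithTop ℕ∞} (l : AffFun r) : ContDiff ℝ m l.val := by
  unfold AffFun.val dotProduct
  fun_prop

theorem AffFun.continuous_val (l : AffFun r) : Continuous l.val :=
  (l.contDiff_val_right (m := 0)).continuous

theorem AffFun.hasFDerivAt_val (l : AffFun r) (x : Fin r → ℝ) :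
    HasFDerivAt l.val (∑ α, l.1 α • ContinuousLinearMap.proj (R := ℝ) (φ := fun _ => ℝ) α) x := by
  unfold AffFun.val dotProduct
  refine HasFDerivAt.add_const _ ?_
  exact HasFDerivAt.fun_sum fun α _ => (hasFDerivAt_apply α x).const_mul (l.1 α)

theorem fderiv_comp_val {ψ : ℝ → ℝ} {ψ' : ℝ} {l : AffFun r} {x : Fin r → ℝ}
    (hψ : HasDerivAt ψ ψ' (l.val x)) (v : Fin r → ℝ) :
    fderiv ℝ (fun y => ψ (l.val y)) x v = ψ' * (l.1 ⬝ᵥ v) := by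
  have h : fderiv ℝ (fun y => ψ (l.val y)) x = _ :=
    (hψ.comp_hasFDerivAt x (l.hasFDerivAt_val x)).fderiv
  rw [h]
  simp [dotProduct, _root_.sum_apply]

theorem hess_comp_val {ψ ψ' : ℝ → ℝ} {ψ'' : ℝ} {l : AffFun r} {x : Fin r → ℝ}
    (hψ : ∀ᶠ t in 𝓝 (l.val x), HasDerivAt ψ (ψ' t) t) (hψ' : HasDerivAt ψ' ψ'' (l.val x))
    (α β : Fin r) : hess (fun y => ψ (l.val y)) x α β = ψ'' * (l.1 α * l.1 β) := by
  have h1 : (fun y => fderiv ℝ (fun y => ψ (l.val y)) y (Pi.single β 1)) =ᶠ[𝓝 x]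
      fun y => ψ' (l.val y) * l.1 β := by
    filter_upwards [l.continuous_val.continuousAt.eventually hψ] with y hy
    rw [fderiv_comp_val hy]
    simp
  have h2 : fderiv ℝ (fun y => ψ' (l.val y) * l.1 β) x = _ :=
    ((hψ'.comp_hasFDerivAt x (l.hasFDerivAt_val x)).mul_const (l.1 β)).fderiv
  rw [hess, h1.fderiv_eq, h2]
  simp [_root_.sum_apply, Pi.single_apply]
  ring

namespace HamiltonianAction

variable [MulAction (Torus r) X] [ContinuousSMul (Torus r) X] (H : K.HamiltonianAction r)

/-- The inner products `g (ξ_α, ξ_β)` of the basic fundamental vector fields. -/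
def fieldGram (α β : Fin r) (i : ι) (u : Cn n) : ℝ :=
  K.metric i u (H.field (Pi.single α 1) i u) (H.field (Pi.single β 1) i u)

/-- The vector `(⟨d μ_α, d l(μ)⟩)_α`, written through `fieldGram`; see `fderiv_mu_grad`. -/
def pairMu (l : AffFun r) (i : ι) (u : Cn n) : Fin r → ℝ :=
  fun α => ∑ β, H.fieldGram α β i u * l.1 β

/-- The square `|d l(μ)|²`, which is also `⟨g, μ^* (d l ⊗ d l)⟩`. -/
def normSq (l : AffFun r) (i : ι) (u : Cn n) : ℝ := l.1 ⬝ᵥ H.pairMu l i u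

theorem isCont_fieldGram (α β : Fin r) : K.IsCont (H.fieldGram α β) := fun i =>
  ((K.smooth i).continuousOn.clm_apply (H.isFundamental _ i).1.continuousOn).clm_apply
    (H.isFundamental _ i).1.continuousOn

theorem isCont_pairMu (l : AffFun r) (α : Fin r) : K.IsCont fun i u => H.pairMu l i u α :=
  IsCont.sum fun β _ => (H.isCont_fieldGram α β).mul (IsCont.const _)

theorem isCont_dotProduct_pairMu (l : AffFun r) (ξ : Fin r → ℝ) :
    K.IsCont fun i u => ξ ⬝ᵥ H.pairMu l i u := by
  unfold dotProduct
  exact IsCont.sum fun α _ => (IsCont.const _).mul (H.isCont_pairMu l α)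

theorem isCont_normSq (l : AffFun r) : K.IsCont (H.normSq l) := H.isCont_dotProduct_pairMu l l.1

theorem isCont_scal : K.IsCont H.scal := fun i =>
  (K.isMetricOn i).continuousOn_scal (K.isOpen_dom i)

theorem contDiffOn_val_moment (l : AffFun r) (i : ι) :
    ContDiffOn ℝ ∞ (fun u => l.val (H.moment (K.proj i u))) (K.dom i) :=
  l.contDiff_val_right.comp_contDiffOn (H.moment_smooth i)

theorem isCont_lap (l : AffFun r) : K.IsCont (K.lap fun x => l.val (H.moment x)) := fun i =>
  (K.isMetricOn i).continuousOn_laplacian (K.isOpen_dom i) (H.contDiffOn_val_moment l i)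

theorem differentiableAt_mu {i : ι} {u : Cn n} (hu : u ∈ K.dom i) :
    DifferentiableAt ℝ (H.mu i) u :=
  ((H.moment_smooth i).contDiffAt ((K.isOpen_dom i).mem_nhds hu)).differentiableAt (by simp)

/-- `∇ ⟨μ, ξ⟩ = - J ξ`. -/
theorem grad_moment (ξ : Fin r → ℝ) {i : ι} {u : Cn n} (hu : u ∈ K.dom i) :
    BilinField.grad (K.metric i) (fun w => ξ ⬝ᵥ H.mu i w) u = -(Complex.I • H.field ξ i u) := by
  refine ((K.isMetricOn i).eq_grad hu fun w => ?_).symm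
  rw [map_neg, _root_.neg_apply]
  exact (H.moment_eq ξ i u hu w).symm

theorem fderiv_dotProduct_mu (ξ : Fin r → ℝ) {i : ι} {u : Cn n} (hu : u ∈ K.dom i) (v : Cn n) :
    fderiv ℝ (fun w => ξ ⬝ᵥ H.mu i w) u v = ξ ⬝ᵥ fderiv ℝ (H.mu i) u v := by
  have h1 := (AffFun.hasFDerivAt_val (ξ, 0) (H.mu i u)).comp u (H.differentiableAt_mu hu).hasFDerivAt
  have h2 : (fun w => ξ ⬝ᵥ H.mu i w) = AffFun.val (ξ, 0) ∘ H.mu i := by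
    funext w; simp [AffFun.val]
  rw [h2, h1.fderiv]
  simp [dotProduct, _root_.sum_apply]

theorem fderiv_val_mu (l : AffFun r) {i : ι} {u : Cn n} :
    fderiv ℝ (fun w => l.val (H.mu i w)) u = fderiv ℝ (fun w => l.1 ⬝ᵥ H.mu i w) u := by
  simp only [AffFun.val, fderiv_add_const]

theorem grad_val_mu (l : AffFun r) {i : ι} {u : Cn n} :
    BilinField.grad (K.metric i) (fun w => l.val (H.mu i w)) u =
      BilinField.grad (K.metric i) (fun w => l.1 ⬝ᵥ H.mu i w) u := by
  simp only [BilinField.grad, BilinField.partialD, H.fderiv_val_mu]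

/-- The differential of the momentum map along the gradient of `l(μ)`. -/
theorem fderiv_mu_grad (l : AffFun r) {i : ι} {u : Cn n} (hu : u ∈ K.dom i) :
    fderiv ℝ (H.mu i) u (BilinField.grad (K.metric i) (fun w => l.val (H.mu i w)) u) =
      H.pairMu l i u := by
  have hg := K.isMetricOn i
  have hfield : ∀ α β : Fin r, fderiv ℝ (fun w => (Pi.single α 1 : Fin r → ℝ) ⬝ᵥ H.mu i w) u
      (BilinField.grad (K.metric i) (fun w => (Pi.single β 1 : Fin r → ℝ) ⬝ᵥ H.mu i w) u) =
      H.fieldGram α β i u := fun α β => by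
    rw [← hg.metric_grad hu, H.grad_moment _ hu, H.grad_moment _ hu]
    simp only [map_neg, _root_.neg_apply, neg_neg]
    rw [K.hermitian i u hu, fieldGram]
  funext α
  rw [grad_val_mu]
  -- `⟨d μ_α, d l⟩ = ⟨d l, d μ_α⟩`, and the right-hand side is linear in `l`
  calc _ = fderiv ℝ (fun w => (Pi.single α 1 : Fin r → ℝ) ⬝ᵥ H.mu i w) u
        (BilinField.grad (K.metric i) (fun w => l.1 ⬝ᵥ H.mu i w) u) := by
          rw [H.fderiv_dotProduct_mu _ hu]
          simp
    _ = fderiv ℝ (fun w => l.1 ⬝ᵥ H.mu i w) u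
        (BilinField.grad (K.metric i) (fun w => (Pi.single α 1 : Fin r → ℝ) ⬝ᵥ H.mu i w) u) := by
          rw [← hg.metric_grad hu, ← hg.metric_grad hu, hg.symm u hu]
    _ = ∑ β, H.fieldGram α β i u * l.1 β := by
          rw [H.fderiv_dotProduct_mu _ hu, dotProduct]
          refine Finset.sum_congr rfl fun β _ => ?_
          rw [← hfield, ← hg.metric_grad hu, hg.symm u hu, hg.metric_grad hu,
            H.fderiv_dotProduct_mu (Pi.single β 1) hu]
          simp [mul_comm]

/-- Green's formula for functions of the momentum map. -/
theorem integral_comp_mu_mul_lap [T2Space X] [CompactSpace X] {φ : (Fin r → ℝ) → ℝ}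
    (hφ : ∀ x ∈ H.polytope, ContDiffAt ℝ 1 φ x) (l : AffFun r) :
    K.integral (fun i u => φ (H.mu i u) * K.lap (fun x => l.val (H.moment x)) i u) =
      K.integral fun i u => fderiv ℝ φ (H.mu i u) (H.pairMu l i u) := by
  have hC1 : K.IsC1 fun x => φ (H.moment x) := fun i u hu =>
    ((hφ _ (H.mu_mem_polytope i u)).comp u (((H.moment_smooth i).contDiffAt
      ((K.isOpen_dom i).mem_nhds hu)).of_le (by simp))).contDiffWithinAt
  refine (integral_mul_lap (f := fun x => φ (H.moment x)) hC1 (H.contDiffOn_val_moment l)).trans ?_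
  refine K.integral_congr fun i u hu => ?_
  have h1 : HasFDerivAt (fun w => φ (H.moment (K.proj i w)))
      ((fderiv ℝ φ (H.mu i u)).comp (fderiv ℝ (H.mu i) u)) u :=
    ((hφ _ (H.mu_mem_polytope i u)).differentiableAt one_ne_zero).hasFDerivAt.comp u
      (H.differentiableAt_mu hu).hasFDerivAt
  rw [gradPairing, h1.fderiv, ← H.fderiv_mu_grad l hu]
  rfl

/-- The weighted scalar curvature for a weight that is a function of one affine function. -/
theorem weightedScal_comp_val {ψ ψ' : ℝ → ℝ} {ψ'' : ℝ} (l : AffFun r) {i : ι} {u : Cn n}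
    (hu : u ∈ K.dom i) (hψ : ∀ᶠ t in 𝓝 (l.val (H.mu i u)), HasDerivAt ψ (ψ' t) t)
    (hψ' : HasDerivAt ψ' ψ'' (l.val (H.mu i u))) :
    H.weightedScal (fun x => ψ (l.val x)) i u = ψ (l.val (H.mu i u)) * H.scal i u
      + 2 * ψ' (l.val (H.mu i u)) * K.lap (fun x => l.val (H.moment x)) i u
      - ψ'' * H.normSq l i u := by
  have h1 := (K.isMetricOn i).laplacian_comp (K.isOpen_dom i) (H.contDiffOn_val_moment l i) hu
    hψ hψ'
  have h2 : fderiv ℝ (fun w => l.val (H.mu i w)) u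
      (BilinField.grad (K.metric i) (fun w => l.val (H.mu i w)) u) = H.normSq l i u := by
    rw [fderiv_val_mu, H.fderiv_dotProduct_mu _ hu, H.fderiv_mu_grad l hu, normSq]
  have h3 : ∑ α, ∑ β, hess (fun x => ψ (l.val x)) (H.mu i u) α β *
      K.metric i u (H.field (Pi.single α 1) i u) (H.field (Pi.single β 1) i u) =
      ψ'' * H.normSq l i u := by
    simp only [hess_comp_val hψ hψ', normSq, pairMu, dotProduct, Finset.mul_sum]
    exact Finset.sum_congr rfl fun α _ => Finset.sum_congr rfl fun β _ => by
      rw [fieldGram]; ring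
  rw [weightedScal, h3]
  change ψ (l.val (H.mu i u)) * H.scal i u + 2 * BilinField.laplacian (K.metric i)
    (fun w => ψ (l.val (H.moment (K.proj i w)))) u + _ = _
  rw [h1]
  change _ + 2 * (_ - ψ'' * fderiv ℝ (fun w => l.val (H.mu i w)) u
      (BilinField.grad (K.metric i) (fun w => l.val (H.mu i w)) u)) + _ = _
  rw [h2, lap]
  change _ + 2 * (ψ' (l.val (H.mu i u)) * _ - _) + _ = _
  ring

/-- The pairs `(a, l)` with `1 + a l > 0` on the momentum polytope. This open set contains all the
admissible pairs, and the upper bound `1 + a l < 2` plays no role for regularity. -/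
def positive : Set (ℝ × AffFun r) := {q | ∀ x ∈ H.polytope, 0 < 1 + q.1 * q.2.val x}

theorem mem_positive_of_mem_admissible {a : ℝ} {l : AffFun r} (h : l ∈ H.admissible a) :
    (a, l) ∈ H.positive := fun x hx => (h x hx).1

variable {H} {a : ℝ} {l : AffFun r} (hl : (a, l) ∈ H.positive)
include hl

theorem pos_mu (i : ι) (u : Cn n) : 0 < 1 + a * l.val (H.mu i u) := hl _ (H.mu_mem_polytope i u)

/-- `Scal_{F_1(l)} = F_1 Scal + 2 (1 - a) F_2 Δ l - (1 - a) (1 - 2 a) F_3 |d l|²`. -/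
theorem weightedScal_weightF {i : ι} {u : Cn n} (hu : u ∈ K.dom i) :
    H.weightedScal (fun x => weightF 1 a (l.val x)) i u =
      weightF 1 a (l.val (H.mu i u)) * H.scal i u
      + 2 * ((1 - a) * weightF 2 a (l.val (H.mu i u))) * K.lap (fun x => l.val (H.moment x)) i u
      - (1 - a) * ((1 - 2 * a) * weightF 3 a (l.val (H.mu i u))) * H.normSq l i u := by
  have hpos := pos_mu hl i u
  have hev : ∀ᶠ t in 𝓝 (l.val (H.mu i u)), 0 < 1 + a * t :=
    ContinuousAt.eventually_lt (by fun_prop) (by fun_prop) hpos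
  refine H.weightedScal_comp_val (ψ' := fun t => (1 - a) * weightF 2 a t) l hu ?_ ?_
  · filter_upwards [hev] with t ht
    simpa using hasDerivAt_weightF 1 ht
  · simpa using (hasDerivAt_weightF 2 hpos).const_mul (1 - a)

theorem contDiffAt_weightF_val (k : ℕ) {x : Fin r → ℝ} (hx : x ∈ H.polytope) :
    ContDiffAt ℝ ∞ (fun y => weightF k a (l.val y)) x :=
  (contDiffAt_weightF_right k (hl x hx)).comp x l.contDiff_val_right.contDiffAt

theorem isCont_weightF (k : ℕ) : K.IsCont fun i u => weightF k a (l.val (H.mu i u)) :=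
  H.isCont_comp_mu fun _ hx => (contDiffAt_weightF_val hl k hx).continuousAt.continuousWithinAt

omit hl in
theorem isCont_val (h : AffFun r) : K.IsCont fun i u => h.val (H.mu i u) :=
  H.isCont_comp_mu h.continuous_val.continuousOn

theorem isCont_weightedScal :
    K.IsCont (H.weightedScal fun x => weightF 1 a (l.val x)) := by
  have cw := fun k => isCont_weightF hl k
  refine IsCont.congr ((((cw 1).mul H.isCont_scal).add (((IsCont.const 2).mul
    ((IsCont.const (1 - a)).mul (cw 2))).mul (H.isCont_lap l))).sub (((IsCont.const (1 - a)).mul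
    ((IsCont.const (1 - 2 * a)).mul (cw 3))).mul (H.isCont_normSq l))) fun i u hu => ?_
  exact weightedScal_weightF hl hu

/-- `∫ F_k(l) h Δ l = ∫ ⟨d (F_k(l) h), d l⟩`. -/
theorem integral_weightF_mul_lap [T2Space X] [CompactSpace X] (k : ℕ) (h : AffFun r) :
    K.integral (fun i u => weightF k a (l.val (H.mu i u)) * h.val (H.mu i u) *
        K.lap (fun x => l.val (H.moment x)) i u) =
      K.integral fun i u => (1 - k * a) * weightF (k + 1) a (l.val (H.mu i u)) * h.val (H.mu i u) *
        H.normSq l i u + weightF k a (l.val (H.mu i u)) * (h.1 ⬝ᵥ H.pairMu l i u) := by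
  rw [H.integral_comp_mu_mul_lap (φ := fun x => weightF k a (l.val x) * h.val x)
    fun x hx => ((contDiffAt_weightF_val hl k hx).of_le (by simp)).mul
      h.contDiff_val_right.contDiffAt]
  refine K.integral_congr fun i u hu => ?_
  have h1 := (hasDerivAt_weightF k (pos_mu hl i u)).comp_hasFDerivAt (H.mu i u)
    (l.hasFDerivAt_val (H.mu i u))
  have h2 : fderiv ℝ (fun x => weightF k a (l.val x) * h.val x) (H.mu i u) = _ :=
    (h1.mul (h.hasFDerivAt_val (H.mu i u))).fderiv
  rw [h2, normSq]
  simp [dotProduct, _root_.sum_apply]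
  ring

variable [CompactSpace X]

/-- `∫ F_1(l) Δ l = (1 - a) ∫ F_2(l) |d l|²`. -/
theorem integral_weightF_one_mul_lap [T2Space X] :
    K.integral (fun i u => weightF 1 a (l.val (H.mu i u)) *
        K.lap (fun x => l.val (H.moment x)) i u) =
      (1 - a) * K.integral fun i u => weightF 2 a (l.val (H.mu i u)) * H.normSq l i u := by
  have h := integral_weightF_mul_lap hl 1 ((0 : Fin r → ℝ), (1 : ℝ))
  simp only [AffFun.val, zero_dotProduct, zero_add, mul_one, mul_zero, add_zero, Nat.cast_one,
    one_mul, mul_assoc] at h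
  refine Eq.trans ?_ (h.trans ?_)
  · rfl
  · exact integral_const_mul (1 - a) ((isCont_weightF hl 2).mul (H.isCont_normSq l))

/-- The total weighted scalar curvature after integration by parts: a form in which the integrand
contains `l` only through functions of the momentum map. -/
theorem S_eq [T2Space X] : H.S a l =
    K.integral (fun i u => H.scal i u * weightF 0 a (l.val (H.mu i u))) +
      (1 - a) * K.integral fun i u => weightF 2 a (l.val (H.mu i u)) * H.normSq l i u := by
  have c0 := (isCont_weightF hl 0)
  have c1 := (isCont_weightF hl 1)
  have c2 := (isCont_weightF hl 2)
  have e : H.S a l = K.integral fun i u => H.scal i u * weightF 0 a (l.val (H.mu i u)) +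
      ((2 * (1 - a)) * (weightF 1 a (l.val (H.mu i u)) * K.lap (fun x => l.val (H.moment x)) i u)
      - ((1 - a) * (1 - 2 * a)) * (weightF 2 a (l.val (H.mu i u)) * H.normSq l i u)) := by
    refine K.integral_congr fun i u hu => ?_
    have hpos := pos_mu hl i u
    rw [weightedScal_weightF hl hu, weightF_succ_mul 0 hpos, weightF_succ_mul 1 hpos,
      weightF_succ_mul 2 hpos]
    ring
  have cl := c1.mul (H.isCont_lap l)
  have cn := c2.mul (H.isCont_normSq l)
  rw [e, integral_add (H.isCont_scal.mul c0)
    (((IsCont.const _).mul cl).sub ((IsCont.const _).mul cn)),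
    integral_sub ((IsCont.const _).mul cl) ((IsCont.const _).mul cn), integral_const_mul _ cl,
    integral_const_mul _ cn, integral_weightF_one_mul_lap hl]
  ring

end HamiltonianAction

end KahlerOrbifold

/-! ### Smooth dependence on the parameter and on the affine function -/

namespace KahlerOrbifold

theorem weightF_zero_right (k : ℕ) (t : ℝ) : weightF k 0 t = Real.exp t := if_pos rfl

namespace HamiltonianAction

variable {n r : ℕ} {ι X : Type*} [TopologicalSpace X] {K : KahlerOrbifold n ι X}
  [MulAction (Torus r) X] [ContinuousSMul (Torus r) X] (H : K.HamiltonianAction r)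
  [CompactSpace X]

theorem isOpen_positive : IsOpen H.positive := by
  refine isOpen_iff_mem_nhds.2 fun q hq => ?_
  refine H.isCompact_polytope.eventually_forall_of_forall_eventually
    (P := fun (q : ℝ × AffFun r) x => 0 < 1 + q.1 * q.2.val x) fun x hx => ?_
  refine ContinuousAt.eventually_lt (by fun_prop) ?_ (hq x hx)
  have := (AffFun.contDiff_val (r := r) (m := 0)).continuous
  exact (continuous_const.add ((continuous_fst.comp continuous_fst).mul
    (this.comp ((continuous_snd.comp continuous_fst).prodMk continuous_snd)))).continuousAt

/-- The condition `0 < 1 + a l < 2` is open in the pair `(a, l)`. -/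
theorem isOpen_admissible_prod : IsOpen {q : ℝ × AffFun r | q.2 ∈ H.admissible q.1} := by
  refine isOpen_iff_mem_nhds.2 fun q hq => ?_
  refine H.isCompact_polytope.eventually_forall_of_forall_eventually
    (P := fun (q : ℝ × AffFun r) x => 0 < 1 + q.1 * q.2.val x ∧ 1 + q.1 * q.2.val x < 2) fun x hx => ?_
  have := (AffFun.contDiff_val (r := r) (m := 0)).continuous
  have hc : Continuous fun z : (ℝ × AffFun r) × (Fin r → ℝ) => 1 + z.1.1 * z.1.2.val z.2 :=
    continuous_const.add ((continuous_fst.comp continuous_fst).mul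
      (this.comp ((continuous_snd.comp continuous_fst).prodMk continuous_snd)))
  have ht := hc.tendsto (q, x)
  exact (ht.eventually_const_lt (hq x hx).1).and (ht.eventually_lt_const (hq x hx).2)

theorem isOpen_admissible (a : ℝ) : IsOpen (H.admissible a) :=
  H.isOpen_admissible_prod.preimage (by fun_prop : Continuous fun l : AffFun r => (a, l))

omit [CompactSpace X] in
theorem admissible_zero : H.admissible 0 = univ :=
  eq_univ_of_forall fun l x _ => by norm_num

theorem eventually_subset_admissible {C : Set (AffFun r)} (hC : IsCompact C) :
    ∀ᶠ a in 𝓝 (0 : ℝ), C ⊆ H.admissible a :=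
  hC.eventually_forall_of_forall_eventually (P := fun a l => l ∈ H.admissible a) fun l _ =>
    H.isOpen_admissible_prod.mem_nhds (by simp [admissible_zero] : l ∈ H.admissible 0)

theorem contDiffOn_integral_weightF {m : ℕ} (k : ℕ) {f : ι → Cn n → ℝ} (hf : K.IsCont f)
    {p : AffFun r × (Fin r → ℝ) → ℝ} (hp : ContDiff ℝ m p) :
    ContDiffOn ℝ m (fun q : ℝ × AffFun r => K.integral fun i u =>
      f i u * (p (q.2, H.mu i u) * weightF k q.1 (q.2.val (H.mu i u)))) H.positive := by
  have hv : ContDiff ℝ m fun z : (ℝ × AffFun r) × (Fin r → ℝ) => (z.1.1, z.1.2.val z.2) :=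
    (contDiff_fst.fst).prodMk
      (AffFun.contDiff_val.comp ((contDiff_snd.comp contDiff_fst).prodMk contDiff_snd))
  have hΩ : IsOpen {z : (ℝ × AffFun r) × (Fin r → ℝ) | 0 < 1 + z.1.1 * z.1.2.val z.2} :=
    isOpen_lt continuous_const (continuous_const.add
      ((continuous_fst.comp hv.continuous).mul (continuous_snd.comp hv.continuous)))
  refine H.contDiffOn_integral (Φ := fun z : (ℝ × AffFun r) × (Fin r → ℝ) =>
    p (z.1.2, z.2) * weightF k z.1.1 (z.1.2.val z.2)) hΩ ?_ H.isOpen_positive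
    (fun q hq x hx => hq x hx) hf
  intro z hz
  refine ((hp.comp ((contDiff_snd.comp contDiff_fst).prodMk contDiff_snd)).contDiffAt.mul
    ?_).contDiffWithinAt
  exact ((contDiffAt_weightF k (q := (z.1.1, z.1.2.val z.2)) hz).of_le
    (by exact_mod_cast le_top)).comp z hv.contDiffAt

theorem contDiffOn_intF {m : ℕ} (k : ℕ) :
    ContDiffOn ℝ m (fun q : ℝ × AffFun r => H.intF k q.1 q.2) H.positive := by
  simpa [intF] using H.contDiffOn_integral_weightF k (IsCont.const 1) (contDiff_const (c := (1 : ℝ)))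

/-- The square norm against a weight, as a quadratic form in the linear part of `l`. -/
theorem integral_mul_normSq {w : ι → Cn n → ℝ} (hw : K.IsCont w) (l : AffFun r) :
    K.integral (fun i u => w i u * H.normSq l i u) =
      ∑ α, ∑ β, K.integral fun i u => H.fieldGram α β i u * (l.1 α * l.1 β * w i u) := by
  have hc : ∀ α β, K.IsCont fun i u => H.fieldGram α β i u * (l.1 α * l.1 β * w i u) :=
    fun α β => (H.isCont_fieldGram α β).mul ((IsCont.const _).mul hw)
  calc _ = K.integral fun i u => ∑ α, ∑ β, H.fieldGram α β i u * (l.1 α * l.1 β * w i u) := by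
        refine K.integral_congr fun i u _ => ?_
        simp only [normSq, pairMu, dotProduct, Finset.mul_sum]
        exact Finset.sum_congr rfl fun α _ => Finset.sum_congr rfl fun β _ => by ring
    _ = _ := by
        rw [integral_sum fun α _ => IsCont.sum fun β _ => hc α β]
        exact Finset.sum_congr rfl fun α _ => integral_sum fun β _ => hc α β

theorem contDiffOn_S [T2Space X] {m : ℕ} :
    ContDiffOn ℝ m (fun q : ℝ × AffFun r => H.S q.1 q.2) H.positive := by
  have h1 : ContDiffOn ℝ m (fun q : ℝ × AffFun r => K.integral fun i u =>
      H.scal i u * weightF 0 q.1 (q.2.val (H.mu i u))) H.positive := by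
    simpa using H.contDiffOn_integral_weightF 0 H.isCont_scal (contDiff_const (c := (1 : ℝ)))
  have h2 : ContDiffOn ℝ m (fun q : ℝ × AffFun r => ∑ α, ∑ β, K.integral fun i u =>
      H.fieldGram α β i u * (q.2.1 α * q.2.1 β * weightF 2 q.1 (q.2.val (H.mu i u))))
      H.positive :=
    ContDiffOn.sum fun α _ => ContDiffOn.sum fun β _ =>
      H.contDiffOn_integral_weightF 2 (H.isCont_fieldGram α β)
        (p := fun z => z.1.1 α * z.1.1 β) (by fun_prop)
  have h3 : ContDiff ℝ m fun q : ℝ × AffFun r => 1 - q.1 := by fun_prop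
  refine (h1.add (h3.contDiffOn.mul h2)).congr fun q hq => ?_
  rw [S_eq hq, H.integral_mul_normSq (isCont_weightF hq 2)]

variable {H} in
theorem intF_pos [Nonempty X] {a : ℝ} {l : AffFun r} (hl : (a, l) ∈ H.positive) (k : ℕ) :
    0 < H.intF k a l :=
  integral_pos (isCont_weightF hl k) fun i u _ => weightF_pos k (pos_mu hl i u)

variable {H} in
theorem V_pos [Nonempty X] {a : ℝ} {l : AffFun r} (hl : (a, l) ∈ H.positive) : 0 < H.V a l :=
  Real.rpow_pos_of_pos (intF_pos hl 1) _

/-- A form of the functional without a division by `a`: since `F_0 = F_1 + a l F_1`, the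
coefficient of `lam` is `((V - I) / a - ∫ l F_1) / V` with `I = ∫ F_1`, and
`V = I exp (a log I / (1 - a))`. -/
theorem EH_eq [Nonempty X] {a : ℝ} (ha : a ≠ 1) {l : AffFun r} (hl : (a, l) ∈ H.positive)
    (lam b : ℝ) :
    H.EH lam a b l = (H.S a l + lam * (H.intF 1 a l *
      (Real.log (H.intF 1 a l) / (1 - a) * expQuot (a * (Real.log (H.intF 1 a l) / (1 - a))))
        - K.integral fun i u => l.val (H.mu i u) * weightF 1 a (l.val (H.mu i u))) + b)
      / Real.exp (Real.log (H.intF 1 a l) / (1 - a)) := by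
  have hI := intF_pos hl 1
  have ha' : 1 - a ≠ 0 := sub_ne_zero.2 ha.symm
  have hV : H.V a l = Real.exp (Real.log (H.intF 1 a l) / (1 - a)) := by
    rw [V, Real.rpow_def_of_pos hI]; congr 1; ring
  rw [← hV]
  have hVp := V_pos hl
  rcases eq_or_ne a 0 with rfl | h0
  · have hV' : H.V 0 l = H.intF 1 0 l := by rw [V]; norm_num
    rw [EH, if_pos rfl, hV']
    simp only [weightF_zero_right, sub_zero, div_one, zero_mul, expQuot_zero, mul_one]
    field_simp
    ring
  · have h1 : H.intF 0 a l = H.intF 1 a l +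
        a * K.integral fun i u => l.val (H.mu i u) * weightF 1 a (l.val (H.mu i u)) := by
      have c1 := (isCont_val (H := H) l).mul (isCont_weightF hl 1)
      rw [intF, intF, ← integral_const_mul a c1,
        ← integral_add (isCont_weightF hl 1) ((IsCont.const a).mul c1)]
      refine K.integral_congr fun i u _ => ?_
      rw [weightF_succ_mul 0 (pos_mu hl i u)]
      ring
    set L := K.integral fun i u => l.val (H.mu i u) * weightF 1 a (l.val (H.mu i u))
    set s := Real.log (H.intF 1 a l) / (1 - a) with hs
    have h2 : H.V a l = H.intF 1 a l * (1 + a * s * expQuot (a * s)) := by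
      rw [mul_expQuot, hV, add_sub_cancel]
      nth_rw 1 [← Real.exp_log hI]
      rw [← Real.exp_add]
      congr 1
      rw [hs]
      field_simp
      ring
    rw [EH, if_neg h0, h1]
    field_simp
    rw [h2]
    ring

/-- The functional is `C²` jointly in the parameters and in the affine function. -/
theorem contDiffOn_EH [T2Space X] [Nonempty X] (lam : ℝ) {m : ℕ} :
    ContDiffOn ℝ m (fun z : (ℝ × ℝ) × AffFun r => H.EH lam z.1.1 z.1.2 z.2)
      {z | z.1.1 ≠ 1 ∧ (z.1.1, z.2) ∈ H.positive} := by
  set O := {z : (ℝ × ℝ) × AffFun r | z.1.1 ≠ 1 ∧ (z.1.1, z.2) ∈ H.positive}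
  have hpr : ContDiffOn ℝ m (fun z : (ℝ × ℝ) × AffFun r => (z.1.1, z.2)) O := by fun_prop
  have hmaps : MapsTo (fun z : (ℝ × ℝ) × AffFun r => (z.1.1, z.2)) O H.positive := fun z hz => hz.2
  have hS := H.contDiffOn_S.comp hpr hmaps
  have hI := (H.contDiffOn_intF 1).comp hpr hmaps
  have hL : ContDiffOn ℝ m (fun q : ℝ × AffFun r => K.integral fun i u =>
      q.2.val (H.mu i u) * weightF 1 q.1 (q.2.val (H.mu i u))) H.positive := by
    simpa using H.contDiffOn_integral_weightF 1 (IsCont.const 1) AffFun.contDiff_val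
  have hL := hL.comp hpr hmaps
  have ha : ContDiffOn ℝ m (fun z : (ℝ × ℝ) × AffFun r => z.1.1) O := by fun_prop
  have hb : ContDiffOn ℝ m (fun z : (ℝ × ℝ) × AffFun r => z.1.2) O := by fun_prop
  have ha' : ContDiffOn ℝ m (fun z : (ℝ × ℝ) × AffFun r => 1 - z.1.1) O := by fun_prop
  have hs := (hI.log fun z hz => (intF_pos hz.2 1).ne').div ha' fun z hz =>
    sub_ne_zero.2 hz.1.symm
  have hq := (contDiff_expQuot.of_le (by exact_mod_cast le_top : (m : WithTop ℕ∞) ≤ ∞)).comp_contDiffOn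
    (ha.mul hs)
  refine (((hS.add ((contDiffOn_const (c := lam)).mul ((hI.mul (hs.mul hq)).sub hL))).add hb).div
    hs.exp fun _ _ => (Real.exp_pos _).ne').congr fun z hz => ?_
  exact H.EH_eq hz.1 hz.2 lam _

end HamiltonianAction

end KahlerOrbifold

/-! ### The first variation -/

namespace KahlerOrbifold.HamiltonianAction

variable {n r : ℕ} {ι X : Type*} [TopologicalSpace X] {K : KahlerOrbifold n ι X}
  [MulAction (Torus r) X] [ContinuousSMul (Torus r) X] {H : K.HamiltonianAction r}
  [CompactSpace X] {a : ℝ} {l : AffFun r} (hl : (a, l) ∈ H.positive) (h : AffFun r)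
include hl

/-- The variation of an integral with a weight `p F_k(l)`, where `p` may depend on `l` too. -/
theorem hasDerivAt_integral_weightF (k : ℕ) {f : ι → Cn n → ℝ} (hf : K.IsCont f)
    {p : ℝ × (Fin r → ℝ) → ℝ} (hp : ContDiff ℝ 1 p) {p' : (Fin r → ℝ) → ℝ}
    (hp' : ∀ x, HasDerivAt (fun t => p (t, x)) (p' x) 0) :
    HasDerivAt (fun t => K.integral fun i u =>
        f i u * (p (t, H.mu i u) * weightF k a (AffFun.val (l + t • h) (H.mu i u))))
      (K.integral fun i u => f i u * (p' (H.mu i u) * weightF k a (l.val (H.mu i u)) +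
        p (0, H.mu i u) * ((1 - k * a) * weightF (k + 1) a (l.val (H.mu i u)) *
          h.val (H.mu i u)))) 0 := by
  have hv : ContDiff ℝ 1 fun z : ℝ × (Fin r → ℝ) => l.val z.2 + z.1 * h.val z.2 :=
    (l.contDiff_val_right.comp contDiff_snd).add
      (contDiff_fst.mul (h.contDiff_val_right.comp contDiff_snd))
  have hΩ : IsOpen {z : ℝ × (Fin r → ℝ) | 0 < 1 + a * (l.val z.2 + z.1 * h.val z.2)} :=
    isOpen_lt continuous_const (continuous_const.add (continuous_const.mul hv.continuous))
  simp only [AffFun.val_add_smul]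
  refine H.hasDerivAt_integral
    (Φ := fun z => p z * weightF k a (l.val z.2 + z.1 * h.val z.2))
    (Φ' := fun x => p' x * weightF k a (l.val x) +
      p (0, x) * ((1 - k * a) * weightF (k + 1) a (l.val x) * h.val x))
    hΩ ?_ (fun x hx => by simpa using hl x hx) ?_ hf
  · intro z hz
    exact (hp.contDiffAt.mul (((contDiffAt_weightF_right k hz).of_le (by simp)).comp z
      hv.contDiffAt)).contDiffWithinAt
  · intro x hx
    have h1 : HasDerivAt (fun t => l.val x + t * h.val x) (h.val x) 0 := by
      simpa using ((hasDerivAt_id (0 : ℝ)).mul_const (h.val x)).const_add (l.val x)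
    have h2 : HasDerivAt (weightF k a) ((1 - k * a) * weightF (k + 1) a (l.val x))
        (l.val x + 0 * h.val x) := by
      simpa using hasDerivAt_weightF k (hl x hx)
    have h3 := (hp' x).mul (h2.comp 0 h1)
    exact h3.congr_deriv (by simp)

theorem hasDerivAt_intF (k : ℕ) :
    HasDerivAt (fun t : ℝ => H.intF k a (l + t • h))
      ((1 - k * a) * K.integral fun i u => weightF (k + 1) a (l.val (H.mu i u)) * h.val (H.mu i u))
      0 := by
  rw [← integral_const_mul _ ((isCont_weightF hl (k + 1)).mul (isCont_val h))]
  simpa [intF, mul_assoc] using hasDerivAt_integral_weightF hl h k (IsCont.const 1)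
    (p := fun _ => 1) contDiff_const (p' := fun _ => 0) fun _ => hasDerivAt_const _ _

theorem eventually_mem_positive : ∀ᶠ t in 𝓝 (0 : ℝ), (a, l + t • h) ∈ H.positive := by
  have hc : ContinuousAt (fun t : ℝ => (a, l + t • h)) 0 := by fun_prop
  exact hc.eventually_mem (by simpa using H.isOpen_positive.mem_nhds hl)

/-- The variation of `∫ F_2(l) |d l|²`. -/
theorem hasDerivAt_integral_normSq :
    HasDerivAt (fun t : ℝ => K.integral fun i u =>
        weightF 2 a (AffFun.val (l + t • h) (H.mu i u)) * H.normSq (l + t • h) i u)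
      (K.integral fun i u => (1 - 2 * a) * weightF 3 a (l.val (H.mu i u)) * h.val (H.mu i u) *
        H.normSq l i u + 2 * (weightF 2 a (l.val (H.mu i u)) * (h.1 ⬝ᵥ H.pairMu l i u))) 0 := by
  have hd : HasDerivAt (fun t : ℝ => ∑ α, ∑ β, K.integral fun i u => H.fieldGram α β i u *
      ((l.1 α + t * h.1 α) * (l.1 β + t * h.1 β) *
        weightF 2 a (AffFun.val (l + t • h) (H.mu i u)))) (∑ α, ∑ β, K.integral fun i u =>
      H.fieldGram α β i u * ((h.1 α * l.1 β + l.1 α * h.1 β) * weightF 2 a (l.val (H.mu i u)) +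
        l.1 α * l.1 β * ((1 - 2 * a) * weightF 3 a (l.val (H.mu i u)) * h.val (H.mu i u)))) 0 := by
    refine HasDerivAt.fun_sum fun α _ => HasDerivAt.fun_sum fun β _ => ?_
    have h1 : ∀ γ, HasDerivAt (fun t => l.1 γ + t * h.1 γ) (h.1 γ) 0 := fun γ => by
      simpa using ((hasDerivAt_id (0 : ℝ)).mul_const (h.1 γ)).const_add (l.1 γ)
    simpa using hasDerivAt_integral_weightF hl h 2 (H.isCont_fieldGram α β)
      (p := fun z => (l.1 α + z.1 * h.1 α) * (l.1 β + z.1 * h.1 β)) (by fun_prop)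
      (p' := fun _ => h.1 α * l.1 β + l.1 α * h.1 β) fun _ => by
        exact ((h1 α).mul (h1 β)).congr_deriv (by simp)
  have hw := isCont_weightF hl 2
  have hw3 := isCont_weightF hl 3
  refine (hd.congr_of_eventuallyEq ?_).congr_deriv ?_
  · filter_upwards [eventually_mem_positive hl h] with t ht
    rw [H.integral_mul_normSq (isCont_weightF ht 2)]
    simp
  · have hc : ∀ α β, K.IsCont fun i u => H.fieldGram α β i u *
        ((h.1 α * l.1 β + l.1 α * h.1 β) * weightF 2 a (l.val (H.mu i u)) +
        l.1 α * l.1 β * ((1 - 2 * a) * weightF 3 a (l.val (H.mu i u)) * h.val (H.mu i u))) :=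
      fun α β => (H.isCont_fieldGram α β).mul (((IsCont.const _).mul hw).add
        ((IsCont.const _).mul (((IsCont.const _).mul hw3).mul (isCont_val h))))
    rw [Finset.sum_congr rfl fun α _ => (integral_sum fun β _ => hc α β).symm,
      ← integral_sum fun α _ => IsCont.sum fun β _ => hc α β]
    refine K.integral_congr fun i u hu => ?_
    -- the two mixed terms agree because `g` is symmetric
    have hs : ∑ α, ∑ β, H.fieldGram α β i u * (l.1 α * h.1 β) =
        ∑ α, ∑ β, H.fieldGram α β i u * (h.1 α * l.1 β) := by
      rw [Finset.sum_comm]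
      refine Finset.sum_congr rfl fun α _ => Finset.sum_congr rfl fun β _ => ?_
      rw [fieldGram, K.symm i u hu, ← fieldGram]
      ring
    have e : ∀ ξ : Fin r → ℝ, ξ ⬝ᵥ H.pairMu l i u =
        ∑ α, ∑ β, H.fieldGram α β i u * (ξ α * l.1 β) := fun ξ => by
      simp only [pairMu, dotProduct, Finset.mul_sum]
      exact Finset.sum_congr rfl fun α _ => Finset.sum_congr rfl fun β _ => by ring
    rw [normSq, e, e]
    set w := weightF 2 a (l.val (H.mu i u))
    set y := (1 - 2 * a) * weightF 3 a (l.val (H.mu i u)) * h.val (H.mu i u)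
    calc _ = w * ∑ α, ∑ β, H.fieldGram α β i u * (h.1 α * l.1 β) +
          w * ∑ α, ∑ β, H.fieldGram α β i u * (l.1 α * h.1 β) +
          y * ∑ α, ∑ β, H.fieldGram α β i u * (l.1 α * l.1 β) := by
            simp only [Finset.mul_sum, ← Finset.sum_add_distrib]
            exact Finset.sum_congr rfl fun α _ => Finset.sum_congr rfl fun β _ => by ring
      _ = _ := by rw [hs]; ring

/-- The variation of the total weighted scalar curvature is the weighted scalar curvature: the term
with `Δ l` in `Scal_{F_1(l)}` is integrated by parts, and what results is the variation of the
integrated form `S_eq`. -/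
theorem hasDerivAt_S [T2Space X] :
    HasDerivAt (fun t : ℝ => H.S a (l + t • h))
      (K.integral fun i u => H.weightedScal (fun x => weightF 1 a (l.val x)) i u *
        h.val (H.mu i u)) 0 := by
  have c1 := (isCont_weightF hl 1).mul (isCont_val (H := H) h)
  have c2 := (isCont_weightF hl 2).mul (isCont_val (H := H) h)
  have c3 := (isCont_weightF hl 3).mul (isCont_val (H := H) h)
  have cn := c3.mul (H.isCont_normSq l)
  have cp := (isCont_weightF hl 2).mul (H.isCont_dotProduct_pairMu l h.1)
  have cs := H.isCont_scal.mul c1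
  have cl := c2.mul (H.isCont_lap l)
  have hd0 : HasDerivAt (fun t : ℝ => K.integral fun i u =>
      H.scal i u * weightF 0 a (AffFun.val (l + t • h) (H.mu i u)))
      (K.integral fun i u => H.scal i u * (weightF 1 a (l.val (H.mu i u)) * h.val (H.mu i u))) 0 := by
    simpa using hasDerivAt_integral_weightF hl h 0 H.isCont_scal
      (p := fun _ => 1) contDiff_const (p' := fun _ => 0) fun _ => hasDerivAt_const _ _
  refine ((hd0.add ((hasDerivAt_integral_normSq hl h).const_mul (1 - a))).congr_of_eventuallyEq
    ?_).congr_deriv ?_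
  · filter_upwards [eventually_mem_positive hl h] with t ht
    exact S_eq ht
  · have e1 : K.integral (fun i u => (1 - 2 * a) * weightF 3 a (l.val (H.mu i u)) *
        h.val (H.mu i u) * H.normSq l i u +
          2 * (weightF 2 a (l.val (H.mu i u)) * (h.1 ⬝ᵥ H.pairMu l i u))) =
        (1 - 2 * a) * K.integral (fun i u => weightF 3 a (l.val (H.mu i u)) *
          h.val (H.mu i u) * H.normSq l i u) +
        2 * K.integral (fun i u => weightF 2 a (l.val (H.mu i u)) * (h.1 ⬝ᵥ H.pairMu l i u)) := by
      rw [← integral_const_mul _ cn, ← integral_const_mul _ cp,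
        ← integral_add ((IsCont.const _).mul cn) ((IsCont.const _).mul cp)]
      simp only [mul_assoc]
    have e2 : K.integral (fun i u => weightF 2 a (l.val (H.mu i u)) * h.val (H.mu i u) *
        K.lap (fun x => l.val (H.moment x)) i u) =
        (1 - 2 * a) * K.integral (fun i u => weightF 3 a (l.val (H.mu i u)) *
          h.val (H.mu i u) * H.normSq l i u) +
        K.integral (fun i u => weightF 2 a (l.val (H.mu i u)) * (h.1 ⬝ᵥ H.pairMu l i u)) := by
      rw [integral_weightF_mul_lap hl 2 h, ← integral_const_mul _ cn,
        ← integral_add ((IsCont.const _).mul cn) cp]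
      simp only [mul_assoc, Nat.cast_ofNat, Nat.reduceAdd]
    have e3 : K.integral (fun i u => H.weightedScal (fun x => weightF 1 a (l.val x)) i u *
        h.val (H.mu i u)) =
        K.integral (fun i u => H.scal i u * (weightF 1 a (l.val (H.mu i u)) * h.val (H.mu i u))) +
        (2 * (1 - a) * K.integral (fun i u => weightF 2 a (l.val (H.mu i u)) * h.val (H.mu i u) *
          K.lap (fun x => l.val (H.moment x)) i u) -
        (1 - a) * (1 - 2 * a) * K.integral (fun i u => weightF 3 a (l.val (H.mu i u)) *
          h.val (H.mu i u) * H.normSq l i u)) := by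
      rw [← integral_const_mul _ cn, ← integral_const_mul _ cl,
        ← integral_sub ((IsCont.const _).mul cl) ((IsCont.const _).mul cn),
        ← integral_add cs (((IsCont.const _).mul cl).sub ((IsCont.const _).mul cn))]
      refine K.integral_congr fun i u hu => ?_
      rw [weightedScal_weightF hl hu]
      ring
    rw [e3, e2, e1]
    ring

/-- `d V = V ^ a ∫ F_2(l) h`. -/
theorem hasDerivAt_V [Nonempty X] (ha : a ≠ 1) :
    HasDerivAt (fun t : ℝ => H.V a (l + t • h)) ((H.V a l) ^ a *
      K.integral fun i u => weightF 2 a (l.val (H.mu i u)) * h.val (H.mu i u)) 0 := by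
  have ha' : 1 - a ≠ 0 := sub_ne_zero.2 ha.symm
  have hI := intF_pos hl 1
  have hd := (hasDerivAt_intF hl h 1).rpow_const (p := 1 / (1 - a))
    (Or.inl (by simpa using hI.ne'))
  refine hd.congr_deriv ?_
  have hp : (H.V a l) ^ a = H.intF 1 a l ^ (1 / (1 - a) - 1) := by
    rw [V, ← Real.rpow_mul hI.le]
    congr 1
    field_simp
    ring
  rw [hp, zero_smul, add_zero, Nat.cast_one, one_mul]
  field_simp

end KahlerOrbifold.HamiltonianAction

namespace KahlerOrbifold.HamiltonianAction

variable {n r : ℕ} {ι X : Type*} [TopologicalSpace X] [T2Space X] [CompactSpace X] [Nonempty X]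
  {K : KahlerOrbifold n ι X} [MulAction (Torus r) X] [ContinuousSMul (Torus r) X]
  {H : K.HamiltonianAction r}

theorem hasDerivAt_EH_of_ne_zero (lam b : ℝ) {a : ℝ} (h0 : a ≠ 0) (ha : a ≠ 1) {l : AffFun r}
    (hl : (a, l) ∈ H.positive) (h : AffFun r) :
    HasDerivAt (fun t : ℝ => H.EH lam a b (l + t • h)) (H.Fut lam a b l h / H.V a l) 0 := by
  have hV := V_pos hl
  have c1 := (isCont_weightF hl 1).mul (isCont_val (H := H) h)
  have c2 := (isCont_weightF hl 2).mul (isCont_val (H := H) h)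
  have cS : K.IsCont fun i u => H.weightedScal (fun x => weightF 1 a (l.val x)) i u *
      h.val (H.mu i u) :=
    (isCont_weightedScal hl).mul (isCont_val h)
  have hdS := hasDerivAt_S hl h
  have hdV := hasDerivAt_V hl h ha
  have hd0 := hasDerivAt_intF hl h 0
  simp only [Nat.cast_zero, zero_mul, sub_zero, one_mul, zero_add] at hd0
  have hF : H.Fut lam a b l h =
      (K.integral fun i u => H.weightedScal (fun x => weightF 1 a (l.val x)) i u *
        h.val (H.mu i u)) - lam / a * ((K.integral fun i u =>
          weightF 1 a (l.val (H.mu i u)) * h.val (H.mu i u)) -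
        K.integral fun i u => weightF 2 a (l.val (H.mu i u)) * h.val (H.mu i u)) -
      (H.cConst lam a l + b / (H.V a l) ^ (1 - a)) *
        K.integral fun i u => weightF 2 a (l.val (H.mu i u)) * h.val (H.mu i u) := by
    rw [Fut, if_neg h0, ← integral_sub c1 c2, ← integral_const_mul _ (c1.sub c2),
      ← integral_sub cS ((IsCont.const _).mul (c1.sub c2)), ← integral_const_mul _ c2]
    congr 1
    · exact K.integral_congr fun i u _ => by ring
    · exact K.integral_congr fun i u _ => by ring
  have hVa : 0 < (H.V a l) ^ a := Real.rpow_pos_of_pos hV a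
  have hV1 : (H.V a l) ^ (1 - a) = H.V a l / (H.V a l) ^ a := by
    rw [Real.rpow_sub hV, Real.rpow_one]
  have hd := (((hdS.div hdV (by simpa using hV.ne')).add
    ((((hd0.neg).div (hdV.const_mul a) (by simpa using ⟨h0, hV.ne'⟩)).add_const (1 / a)).const_mul
      lam))).add ((hasDerivAt_const (0 : ℝ) b).div hdV (by simpa using hV.ne'))
  have hfun : (fun t : ℝ => H.EH lam a b (l + t • h)) = fun t : ℝ =>
      H.S a (l + t • h) / H.V a (l + t • h) + lam * (-H.intF 0 a (l + t • h) /
        (a * H.V a (l + t • h)) + 1 / a) + b / H.V a (l + t • h) := by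
    funext t; rw [EH, if_neg h0]
  rw [hfun]
  refine hd.congr_deriv ?_
  rw [hF, cConst, if_neg h0, EH, if_neg h0, hV1]
  simp only [zero_smul, add_zero, Pi.neg_apply]
  field_simp
  ring

theorem hasDerivAt_EH_zero (lam b : ℝ) (l h : AffFun r) :
    HasDerivAt (fun t : ℝ => H.EH lam 0 b (l + t • h)) (H.Fut lam 0 b l h / H.V 0 l) 0 := by
  have hl' : ∀ l, (0, l) ∈ H.positive := fun l x _ => by simp
  have hl := hl' l
  have hV := V_pos hl
  have cw : K.IsCont fun i u => Real.exp (l.val (H.mu i u)) := by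
    simpa only [weightF_zero_right] using isCont_weightF hl 1
  have c1 := cw.mul (isCont_val (H := H) h)
  have c2 := ((isCont_val (H := H) l).mul cw).mul (isCont_val (H := H) h)
  have cS : K.IsCont fun i u => H.weightedScal (fun x => Real.exp (l.val x)) i u *
      h.val (H.mu i u) := by
    simpa only [weightF_zero_right] using (isCont_weightedScal hl).mul (isCont_val (H := H) h)
  have hdS := hasDerivAt_S hl h
  have hdV := hasDerivAt_V hl h zero_ne_one
  have hdL : HasDerivAt (fun t : ℝ => K.integral fun i u => AffFun.val (l + t • h) (H.mu i u) *
      Real.exp (AffFun.val (l + t • h) (H.mu i u)))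
      ((K.integral fun i u => Real.exp (l.val (H.mu i u)) * h.val (H.mu i u)) +
        K.integral fun i u => l.val (H.mu i u) * Real.exp (l.val (H.mu i u)) * h.val (H.mu i u))
      0 := by
    have hp : ContDiff ℝ 1 fun z : ℝ × (Fin r → ℝ) => l.val z.2 + z.1 * h.val z.2 :=
      (l.contDiff_val_right.comp contDiff_snd).add
        (contDiff_fst.mul (h.contDiff_val_right.comp contDiff_snd))
    have hd := hasDerivAt_integral_weightF hl h 1 (IsCont.const 1) hp (p' := h.val) fun x => by
      simpa using ((hasDerivAt_id (0 : ℝ)).mul_const (h.val x)).const_add (l.val x)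
    rw [← integral_add c1 c2]
    simp only [weightF_zero_right, mul_zero, sub_zero, one_mul, zero_mul, add_zero,
      ← AffFun.val_add_smul] at hd
    refine hd.congr_deriv (K.integral_congr fun i u _ => ?_)
    ring
  simp only [weightF_zero_right, Real.rpow_zero, one_mul] at hdS hdV
  have hF : H.Fut lam 0 b l h =
      (K.integral fun i u => H.weightedScal (fun x => Real.exp (l.val x)) i u *
        h.val (H.mu i u)) - lam * (K.integral fun i u =>
          l.val (H.mu i u) * Real.exp (l.val (H.mu i u)) * h.val (H.mu i u)) -
      (H.cConst lam 0 l + b / H.V 0 l) *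
        K.integral fun i u => Real.exp (l.val (H.mu i u)) * h.val (H.mu i u) := by
    rw [Fut, if_pos rfl, ← integral_const_mul _ c1, ← integral_const_mul _ c2,
      ← integral_sub cS ((IsCont.const _).mul c2),
      ← integral_sub (cS.sub ((IsCont.const _).mul c2)) ((IsCont.const _).mul c1)]
    exact K.integral_congr fun i u _ => by ring
  have hV0 : H.V 0 (l + (0 : ℝ) • h) ≠ 0 := by simpa using hV.ne'
  have hd := ((hdS.div hdV hV0).add (((hdL.neg.div hdV hV0).add (hdV.log hV0)).const_mul lam)).add
    ((hasDerivAt_const (0 : ℝ) b).div hdV hV0)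
  have hfun : (fun t : ℝ => H.EH lam 0 b (l + t • h)) = fun t : ℝ =>
      H.S 0 (l + t • h) / H.V 0 (l + t • h)
      + lam * (-(K.integral fun i u => AffFun.val (l + t • h) (H.mu i u) *
          Real.exp (AffFun.val (l + t • h) (H.mu i u))) / H.V 0 (l + t • h)
          + Real.log (H.V 0 (l + t • h)))
      + b / H.V 0 (l + t • h) := by
    funext t; rw [EH, if_pos rfl]
  rw [hfun]
  refine hd.congr_deriv ?_
  rw [hF, cConst, if_pos rfl, EH, if_pos rfl]
  simp only [zero_smul, add_zero, Pi.neg_apply]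
  field_simp
  ring

theorem hasDerivAt_EH (lam b : ℝ) {a : ℝ} (ha : a ≠ 1) {l : AffFun r}
    (hl : (a, l) ∈ H.positive) (h : AffFun r) :
    HasDerivAt (fun t : ℝ => H.EH lam a b (l + t • h)) (H.Fut lam a b l h / H.V a l) 0 := by
  rcases eq_or_ne a 0 with rfl | h0
  · exact hasDerivAt_EH_zero lam b l h
  · exact hasDerivAt_EH_of_ne_zero lam b h0 ha hl h

/-! ### The logarithmic volume functional -/

variable (H)

/-- The constant part `c` of `l` does not matter: a factor `exp c` cancels from the quotients, and
the two terms with coefficient `lam` change by `c` with opposite signs. -/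
theorem EH_zero_zero (lam : ℝ) (ξ : Fin r → ℝ) (c : ℝ) :
    H.EH lam 0 0 (ξ, c) = H.logVol lam ξ := by
  set l : AffFun r := (ξ, c)
  have hl : (0, l) ∈ H.positive := fun x _ => by simp
  have hV : H.V 0 l = H.intF 1 0 l := by rw [V]; norm_num
  have cξ : K.IsCont fun i u => ξ ⬝ᵥ H.mu i u := by
    simpa [AffFun.val] using isCont_val (H := H) (ξ, 0)
  have ce : K.IsCont fun i u => Real.exp (ξ ⬝ᵥ H.mu i u) := fun i => (cξ i).rexp
  have hexp : ∀ i u, Real.exp (l.val (H.mu i u)) = Real.exp c * Real.exp (ξ ⬝ᵥ H.mu i u) :=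
    fun i u => by rw [AffFun.val, Real.exp_add, mul_comm]
  have hlap : ∀ i u, K.lap (fun x => l.val (H.moment x)) i u =
      BilinField.laplacian (K.metric i) (fun w => ξ ⬝ᵥ H.mu i w) u := fun i u => by
    simp only [lap, BilinField.laplacian, BilinField.partialD]
    change _ * ∑ p, fderiv ℝ (fun w => _ * ∑ q, _ *
      fderiv ℝ (fun w => l.val (H.mu i w)) w _) u _ = _
    simp only [H.fderiv_val_mu]
    rfl
  have clap : K.IsCont fun i u =>
      BilinField.laplacian (K.metric i) (fun w => ξ ⬝ᵥ H.mu i w) u := by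
    simpa only [← hlap] using H.isCont_lap l
  have hI : H.intF 1 0 l = Real.exp c * K.integral fun i u => Real.exp (ξ ⬝ᵥ H.mu i u) := by
    rw [← integral_const_mul _ ce, intF]
    simp only [weightF_zero_right, hexp]
  have hS : H.S 0 l = Real.exp c * ((K.integral fun i u => Real.exp (ξ ⬝ᵥ H.mu i u) * H.scal i u) +
      K.integral fun i u => Real.exp (ξ ⬝ᵥ H.mu i u) *
        BilinField.laplacian (K.metric i) (fun w => ξ ⬝ᵥ H.mu i w) u) := by
    rw [S_eq hl, ← integral_weightF_one_mul_lap hl, mul_add,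
      ← integral_const_mul _ (ce.mul H.isCont_scal), ← integral_const_mul _ (ce.mul clap)]
    simp only [weightF_zero_right, hexp, hlap]
    congr 1
    · exact K.integral_congr fun i u _ => by ring
    · exact K.integral_congr fun i u _ => by ring
  have hL : (K.integral fun i u => l.val (H.mu i u) * Real.exp (l.val (H.mu i u))) =
      Real.exp c * ((K.integral fun i u => Real.exp (ξ ⬝ᵥ H.mu i u) * (ξ ⬝ᵥ H.mu i u)) +
        c * K.integral fun i u => Real.exp (ξ ⬝ᵥ H.mu i u)) := by
    rw [← integral_const_mul _ ce, ← integral_add (ce.mul cξ) ((IsCont.const _).mul ce),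
      ← integral_const_mul _ ((ce.mul cξ).add ((IsCont.const _).mul ce))]
    refine K.integral_congr fun i u _ => ?_
    rw [hexp, AffFun.val]
    ring
  have hN : (K.integral fun i u => Real.exp (ξ ⬝ᵥ H.mu i u) *
      (H.scal i u + BilinField.laplacian (K.metric i) (fun w => ξ ⬝ᵥ H.mu i w) u
        - lam * (ξ ⬝ᵥ H.mu i u))) =
      (K.integral fun i u => Real.exp (ξ ⬝ᵥ H.mu i u) * H.scal i u) +
      (K.integral fun i u => Real.exp (ξ ⬝ᵥ H.mu i u) *
        BilinField.laplacian (K.metric i) (fun w => ξ ⬝ᵥ H.mu i w) u) -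
      lam * K.integral fun i u => Real.exp (ξ ⬝ᵥ H.mu i u) * (ξ ⬝ᵥ H.mu i u) := by
    rw [← integral_const_mul _ (ce.mul cξ),
      ← integral_add (ce.mul H.isCont_scal) (ce.mul clap),
      ← integral_sub ((ce.mul H.isCont_scal).add (ce.mul clap)) ((IsCont.const _).mul (ce.mul cξ))]
    exact K.integral_congr fun i u _ => by ring
  have hpos : 0 < K.integral fun i u => Real.exp (ξ ⬝ᵥ H.mu i u) :=
    integral_pos ce fun i u _ => Real.exp_pos _
  rw [EH, if_pos rfl, logVol, hN, hV, hI, hS, hL, Real.log_mul (Real.exp_pos c).ne' hpos.ne',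
    Real.log_exp]
  field_simp
  ring

end KahlerOrbifold.HamiltonianAction

end

end

theorem mainTheorem5 {n r : ℕ} {ι X : Type*} [TopologicalSpace X] [T2Space X] [CompactSpace X]
    [Nonempty X] [MulAction (KahlerOrbifold.Torus r) X]
    [ContinuousSMul (KahlerOrbifold.Torus r) X]
    (K : KahlerOrbifold n ι X) (H : K.HamiltonianAction r) (lam : ℝ) :
    -- every functional is of class `C²` on its domain
    (∀ a b : ℝ, a ≠ 1 → IsOpen (H.admissible a) ∧
      ContDiffOn ℝ 2 (H.EH lam a b) (H.admissible a)) ∧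
    -- convergence in `C²_loc` as `(a, b) → (0, 0)`
    (H.admissible 0 = Set.univ ∧
      ∀ C : Set (KahlerOrbifold.AffFun r), IsCompact C →
        (∀ᶠ a in 𝓝 (0 : ℝ), C ⊆ H.admissible a) ∧
        ∀ m : ℕ, m ≤ 2 →
          TendstoUniformlyOn (fun p : ℝ × ℝ => iteratedFDeriv ℝ m (H.EH lam p.1 p.2))
            (iteratedFDeriv ℝ m (H.EH lam 0 0)) (𝓝 ((0 : ℝ), (0 : ℝ))) C) ∧
    -- the limit is Inoue's log-volume functional
    (∀ (ξ : Fin r → ℝ) (c : ℝ), H.EH lam 0 0 (ξ, c) = H.logVol lam ξ) ∧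
    -- the first variation is the weighted Futaki invariant divided by `V_a(l)`
    (∀ a b : ℝ, a ≠ 1 → ∀ l ∈ H.admissible a,
      DifferentiableAt ℝ (H.EH lam a b) l ∧
      ∀ h : KahlerOrbifold.AffFun r,
        fderiv ℝ (H.EH lam a b) l h = H.Fut lam a b l h / H.V a l) := by
  have hC2 : ∀ a b : ℝ, a ≠ 1 → ContDiffOn ℝ 2 (H.EH lam a b) (H.admissible a) := fun a b ha =>
    (H.contDiffOn_EH lam (m := 2)).comp (g := fun z : (ℝ × ℝ) × KahlerOrbifold.AffFun r =>
      H.EH lam z.1.1 z.1.2 z.2) (f := fun l => ((a, b), l)) (by fun_prop)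
      fun l hl => ⟨ha, H.mem_positive_of_mem_admissible hl⟩
  refine ⟨fun a b ha => ⟨H.isOpen_admissible a, hC2 a b ha⟩, ⟨H.admissible_zero, fun C hC =>
    ⟨H.eventually_subset_admissible hC, fun m hm => ?_⟩⟩, H.EH_zero_zero lam, fun a b ha l hl => ?_⟩
  · refine tendstoUniformlyOn_iteratedFDeriv_of_contDiffOn
      (F := fun (p : ℝ × ℝ) (l : KahlerOrbifold.AffFun r) => H.EH lam p.1 p.2 l) ?_ hm
      (H.contDiffOn_EH lam (m := 2)) hC
      fun l _ => ⟨zero_ne_one, H.mem_positive_of_mem_admissible (by simp [H.admissible_zero])⟩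
    exact (isOpen_ne_fun (by fun_prop) continuous_const).inter
      (H.isOpen_positive.preimage (by fun_prop))
  · have hd := ((hC2 a b ha).contDiffAt ((H.isOpen_admissible a).mem_nhds hl)).differentiableAt
      two_ne_zero
    refine ⟨hd, fun h => ?_⟩
    have hline : HasDerivAt (fun t : ℝ => l + t • h) h 0 := by
      simpa using ((hasDerivAt_id (0 : ℝ)).smul_const h).const_add l
    have hd' : HasFDerivAt (H.EH lam a b) (fderiv ℝ (H.EH lam a b) l) (l + (0 : ℝ) • h) := by
      simpa using hd.hasFDerivAt
    have hc : HasDerivAt (fun t : ℝ => H.EH lam a b (l + t • h))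
      (fderiv ℝ (H.EH lam a b) l h) 0 :=
      hd'.comp_hasDerivAt (f := fun t : ℝ => l + t • h) 0 hline
    exact hc.unique (KahlerOrbifold.HamiltonianAction.hasDerivAt_EH lam b ha
        (H.mem_positive_of_mem_admissible hl) h)
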